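/- **Theorem 4.1.** A *planar cubic map* is a cellular embedding of a connected finite graph (loops and multiple edges allowed) all of whose vertices have degree $3$ (a loop counting twice) in the oriented sphere. A *tree-rooted* planar cubic map is a planar cubic map together with a distinguished spanning tree of its graph; no edge is marked. Such objects are counted up to orientation-preserving homeomorphisms of the sphere that carry map to map and tree to tree. For $n\ge 1$ let $t_n$ be the number of tree-rooted planar cubic maps with $2n$ vertices, and let $C_m=\frac1{m+1}\binom{2m}{m}$ denote the Catalan numbers. Then, with $k$ a positive integer, $$(2n+2)\,t_n=\begin{cases} C_{n+1}C_{2n}+\frac12\,(n+1)\,C_n\binom{2k}{k}, & \text{if } n+1=2k-1 \text{ and } 3\nmid n+1,\\[2pt] C_{n+1}C_{2n}+(n+1)\,C_n\binom{2k}{k}, & \text{if } n+1=2k \text{ and } 3\nmid n+1,\\[2pt] C_{n+1}C_{2n}+4(2k-1)\,C_{4k-3}\binom{4k-2}{2k-1}+\frac12\,(n+1)\,C_n\binom{6k-2}{3k-1}, & \text{if } n+1=3(2k-1),\\[2pt] C_{n+1}C_{2n}+8k\,C_{4k-1}\binom{4k}{2k}+(n+1)\,C_n\binom{6k}{3k},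 & \text{if } n+1=6k. \end{cases}$$ -/

import Mathlib

/-- A combinatorial map (ribbon graph, rotation system) on a set `D` of darts, i.e. directed edges:
`σ` sends a dart to the next dart, counterclockwise, around the vertex from which it issues, and
`α` reverses a dart. Loops and multiple edges are allowed. -/
structure CombMap (D : Type*) where
  σ : Equiv.Perm D
  α : Equiv.Perm D
  α_α : ∀ d, α (α d) = d
  α_ne : ∀ d, α d ≠ d

namespace CombMap

variable {D : Type*} (M : CombMap D)

/-- The vertices are the cycles of `σ`. -/
def Vertex : Type _ := Quotient (Equiv.Perm.SameCycle.setoid M.σ)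

/-- The edges are the cycles of `α`. -/
def Edge : Type _ := Quotient (Equiv.Perm.SameCycle.setoid M.α)

/-- The faces are the cycles of `d ↦ σ (α d)`. -/
def Face : Type _ := Quotient (Equiv.Perm.SameCycle.setoid (M.σ * M.α))

/-- The vertex from which a dart issues. -/
def vertexOf (d : D) : M.Vertex := Quotient.mk (Equiv.Perm.SameCycle.setoid M.σ) d

/-- The edge that carries a dart. -/
def edgeOf (d : D) : M.Edge := Quotient.mk (Equiv.Perm.SameCycle.setoid M.α) d

/-- The map is connected: `σ` and `α` generate a group that is transitive on the darts. -/
def IsConnected : Prop :=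
  ∀ d e : D, ∃ g ∈ Subgroup.closure {M.σ, M.α}, g d = e

/-- Planarity of a finite map: it is connected and has genus `0`, i.e. `V - E + F = 2`. -/
def IsPlanar : Prop :=
  M.IsConnected ∧ Nat.card M.Vertex + Nat.card M.Face = Nat.card M.Edge + 2

/-- Every vertex has degree three (a loop contributes two to the degree of its vertex). -/
def IsCubic : Prop :=
  ∀ v : M.Vertex, Nat.card {d : D // M.vertexOf d = v} = 3

/-- The simple graph, on all vertices of the map, underlying a set `T` of edges. -/
def graphOf (T : Set M.Edge) : SimpleGraph M.Vertex :=
  SimpleGraph.fromRel fun u v =>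
    ∃ d : D, M.edgeOf d ∈ T ∧ M.vertexOf d = u ∧ M.vertexOf (M.α d) = v

/-- A set `T` of edges is a spanning tree: it contains no loop (cycle of length one), no two
parallel edges (cycle of length two), and the simple graph it then forms on all the vertices is
connected and has no cycle. -/
structure IsSpanningTree (T : Set M.Edge) : Prop where
  no_loop : ∀ d : D, M.edgeOf d ∈ T → M.vertexOf d ≠ M.vertexOf (M.α d)
  no_parallel : ∀ d e : D, M.edgeOf d ∈ T → M.edgeOf e ∈ T → M.vertexOf d = M.vertexOf e →
    M.vertexOf (M.α d) = M.vertexOf (M.α e) → M.edgeOf d = M.edgeOf e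
  isTree : (M.graphOf T).IsTree

end CombMap

/-- A tree-rooted planar cubic map with `m` vertices: a finite planar cubic map with a
distinguished spanning tree (and no marked edge). -/
structure TreeRootedCubicMap (m : ℕ) where
  Dart : Type
  finite_dart : Finite Dart
  map : CombMap Dart
  planar : map.IsPlanar
  cubic : map.IsCubic
  card_vertex : Nat.card map.Vertex = m
  tree : Set map.Edge
  spanning : map.IsSpanningTree tree

namespace TreeRootedCubicMap

variable {m : ℕ}

/-- An (orientation preserving) isomorphism of tree-rooted maps: a bijection of the darts that
respects `σ`, `α` and the distinguished trees. -/
structure Iso (A B : TreeRootedCubicMap m) where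
  toEquiv : A.Dart ≃ B.Dart
  map_σ : ∀ d, toEquiv (A.map.σ d) = B.map.σ (toEquiv d)
  map_α : ∀ d, toEquiv (A.map.α d) = B.map.α (toEquiv d)
  map_tree : ∀ d, B.map.edgeOf (toEquiv d) ∈ B.tree ↔ A.map.edgeOf d ∈ A.tree

/-- The relation of being isomorphic. -/
def isoSetoid (m : ℕ) : Setoid (TreeRootedCubicMap m) where
  r A B := Nonempty (Iso A B)
  iseqv :=
    { refl := fun A => ⟨⟨Equiv.refl _, fun _ => rfl, fun _ => rfl, fun _ => Iff.rfl⟩⟩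
      symm := fun {A B} ⟨f⟩ => ⟨⟨f.toEquiv.symm,
        fun d => by rw [Equiv.symm_apply_eq, f.map_σ, Equiv.apply_symm_apply],
        fun d => by rw [Equiv.symm_apply_eq, f.map_α, Equiv.apply_symm_apply],
        fun d => by rw [← f.map_tree, Equiv.apply_symm_apply]⟩⟩
      trans := fun {A B C} ⟨f⟩ ⟨g⟩ => ⟨⟨f.toEquiv.trans g.toEquiv,
        fun d => by simp only [Equiv.trans_apply, f.map_σ, g.map_σ],
        fun d => by simp only [Equiv.trans_apply, f.map_α, g.map_α],
        fun d => by rw [Equiv.trans_apply, g.map_tree, f.map_tree]⟩⟩ }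

end TreeRootedCubicMap

/-- The number of tree-rooted planar cubic maps with `m` vertices, up to isomorphism. -/
noncomputable def numTreeRootedCubicMaps (m : ℕ) : ℕ :=
  Nat.card (Quotient (TreeRootedCubicMap.isoSetoid m))

/-! Cut every edge off the distinguished tree in its middle. What is left is a plane cubic tree with
2n nodes, and its N = 2n+2 leaves are the halves of the n+1 cut edges. Such a tree is dual to a
triangulation of a convex N-gon: nodes become triangles, tree edges become diagonals, leaves become
sides. Regluing the leaves is a perfect matching of the N sides, and the glued map is planar exactly
when the matching is noncrossing. Because no edge is marked, the sides are numbered only up to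
rotation, so t_n is the number of orbits of ZMod N on pairs (triangulation, noncrossing matching).

The correspondence rests on the tour, the permutation `CombMap.tour` that walks around the tree. It
is a single cycle. Multiplying it by the reversal of the tree edges gives σ, and multiplying it by
the reversal of the other edges gives σα, so vertices and faces are cycle counts of products of the
tour with partial involutions. Such a product has the largest possible number of cycles exactly when
the pairs of the involution do not cross along the tour (`NonCrossing.numCycles_eq`,
`nonCrossing_of_numCycles`). This turns Euler's formula into a noncrossing condition and back.
Counting the leaves met along the tour labels the darts by ZMod N. `exists_labels` and `exists_map`
give the two directions, and `Labels.nonempty_iso` and `Labels.exists_vadd` show that nothing is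
lost except the rotation.

The count is then Burnside's lemma (`sum_numFixed`). A triangulation has either a diameter or a
central triangle, so only rotations of order 1, 2 and 3 fix any (`Triangulation.rotation_of_fixed`).
The identity fixes C_{2n} triangulations and C_{n+1} matchings. A rotation by L = N/2 or L = N/3
fixes L·C_{L-1} triangulations: L positions of the centre, and one binary tree repeated around it.
Matchings fixed by a rotation by d are of two kinds. If N = 2d with d odd, there is a diameter, and
there are d·C_{(d-1)/2} of them. If d is even, they unroll to d-periodic matchings of the integers,
which are determined by an arbitrary choice of d/2 left ends among d residues, giving the central
binomial coefficients. The four cases of the formula record the parity of n+1 and whether rotations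
of order 3 exist. -/

/-! ### Cycle counts under multiplication by a transposition -/

namespace Equiv.Perm

variable {D : Type*}

/-- The number of cycles of a permutation, fixed points included. -/
noncomputable def numCycles (f : Perm D) : ℕ := Nat.card (Quotient (SameCycle.setoid f))

/-- On a finite set every point of a cycle is reached by a nonnegative power, so forward invariance
of `I` is enough. -/
theorem mem_of_sameCycle [Finite D] {f : Perm D} {I : Set D} (hI : ∀ x ∈ I, f x ∈ I) {x y : D}
    (h : SameCycle f x y) (hx : x ∈ I) : y ∈ I := by
  obtain ⟨n, rfl⟩ := h.exists_nat_pow_eq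
  induction n with
  | zero => simpa using hx
  | succ n ih => rw [pow_succ', mul_apply]; exact hI _ (ih (sameCycle_pow_right.2 SameCycle.rfl))

theorem rel_of_sameCycle [Finite D] {f : Perm D} {r : D → D → Prop} (hr : Equivalence r)
    (hf : ∀ x, r x (f x)) {x y : D} (h : SameCycle f x y) : r x y :=
  mem_of_sameCycle (I := {z | r x z}) (fun z hz => hr.trans hz (hf z)) h (hr.refl x)

variable [DecidableEq D]

/-- The cycle is cut: if n > 0 is least with f^n a = b, the segment f a, …, f^n a = b is closed
under the new permutation, and it contains b but not a. -/
theorem not_sameCycle_mul_swap [Finite D] {f : Perm D} {a b : D} (hab : a ≠ b)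
    (h : SameCycle f a b) : ¬ SameCycle (f * swap a b) a b := by
  classical
  have hex : ∃ n : ℕ, 0 < n ∧ (f ^ n) a = b := by
    obtain ⟨n, hn⟩ := h.exists_nat_pow_eq
    refine ⟨n, Nat.pos_of_ne_zero ?_, hn⟩
    rintro rfl
    exact hab (by simpa using hn)
  let n := Nat.find hex
  obtain ⟨hn0, hn⟩ : 0 < n ∧ (f ^ n) a = b := Nat.find_spec hex
  have hmin : ∀ m, 0 < m → m < n → (f ^ m) a ≠ b := fun m h0 hm he =>
    Nat.find_min hex hm ⟨h0, he⟩
  have hna : ∀ m, 0 < m → m ≤ n → (f ^ m) a ≠ a := by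
    intro m h0 hm he
    rcases hm.lt_or_eq with hm | rfl
    · refine hmin (n - m) (by omega) (by omega) ?_
      rw [← hn, ← Nat.sub_add_cancel hm.le, pow_add, mul_apply, he, Nat.add_sub_cancel]
    · exact hab (he.symm.trans hn)
  intro hs
  have hI : ∀ x ∈ {x | ∃ m, 0 < m ∧ m ≤ n ∧ (f ^ m) a = x},
      (f * swap a b) x ∈ {x | ∃ m, 0 < m ∧ m ≤ n ∧ (f ^ m) a = x} := by
    rintro x ⟨m, h0, hm, rfl⟩
    rcases hm.lt_or_eq with hm | rfl
    · refine ⟨m + 1, by omega, by omega, ?_⟩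
      rw [mul_apply, swap_apply_of_ne_of_ne (hna m h0 hm.le) (hmin m h0 hm), pow_succ', mul_apply]
    · refine ⟨1, one_pos, h0, ?_⟩
      rw [mul_apply, hn, swap_apply_right, pow_one]
  obtain ⟨m, h0, hm, he⟩ := mem_of_sameCycle hI hs.symm ⟨n, hn0, le_rfl, hn⟩
  exact hna m h0 hm he

/-- The cycles are joined: the new permutation sends b to f a and then follows the old cycle of a,
which does not meet b, until it arrives at a. -/
theorem sameCycle_mul_swap [Finite D] {f : Perm D} {a b : D} (h : ¬ SameCycle f a b) :
    SameCycle (f * swap a b) a b := by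
  by_contra hc
  classical
  have key : ∀ n : ℕ, SameCycle (f * swap a b) b ((f ^ (n + 1)) a) := by
    intro n
    induction n with
    | zero =>
      refine ⟨1, ?_⟩
      simp
    | succ n ih =>
      have ha : (f ^ (n + 1)) a ≠ a := fun he => hc (by rw [he] at ih; exact ih.symm)
      have hb : (f ^ (n + 1)) a ≠ b := fun he => h ⟨((n + 1 : ℕ) : ℤ), by rw [zpow_natCast]; exact he⟩
      refine ih.trans ⟨1, ?_⟩
      rw [zpow_one, mul_apply, swap_apply_of_ne_of_ne ha hb, pow_succ' f (n + 1), mul_apply]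
  obtain ⟨n, hn0, -, hn⟩ := (SameCycle.refl f a).exists_pow_eq''
  obtain ⟨m, rfl⟩ : ∃ m, n = m + 1 := ⟨n - 1, by omega⟩
  exact hc (by have := key m; rw [hn] at this; exact this.symm)

theorem SameCycle.mul_swap [Finite D] {f : Perm D} {a b : D} (h : ¬ SameCycle f a b) {x y : D}
    (hxy : SameCycle f x y) : SameCycle (f * swap a b) x y := by
  have hab := sameCycle_mul_swap h
  refine rel_of_sameCycle (SameCycle.equivalence _) (fun z => ?_) hxy
  by_cases ha : z = a
  · subst ha
    exact hab.trans ⟨1, by simp⟩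
  by_cases hb : z = b
  · subst hb
    exact hab.symm.trans ⟨1, by simp⟩
  exact ⟨1, by rw [zpow_one, mul_apply, swap_apply_of_ne_of_ne ha hb]⟩

/-- Only the cycles of a and b merge, so the old cycles other than that of b are in bijection with
the new ones. The set `A` below is the merged cycle. -/
theorem numCycles_mul_swap_add_one [Finite D] {f : Perm D} {a b : D} (h : ¬ SameCycle f a b) :
    (f * swap a b).numCycles + 1 = f.numCycles := by
  classical
  let A : Set D := {x | SameCycle f a x ∨ SameCycle f b x}
  have hr : Equivalence (fun x y => SameCycle f x y ∨ (x ∈ A ∧ y ∈ A)) := by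
    refine ⟨fun x => Or.inl SameCycle.rfl, fun hxy => ?_, fun hxy hyz => ?_⟩
    · exact hxy.imp SameCycle.symm And.symm
    · rcases hxy with hxy | ⟨hx, hy⟩ <;> rcases hyz with hyz | ⟨hy', hz⟩
      · exact Or.inl (hxy.trans hyz)
      · exact Or.inr ⟨hy'.imp (·.trans hxy.symm) (·.trans hxy.symm), hz⟩
      · exact Or.inr ⟨hx, hy.imp (·.trans hyz) (·.trans hyz)⟩
      · exact Or.inr ⟨hx, hz⟩
  have hg : ∀ {x y}, SameCycle (f * swap a b) x y → SameCycle f x y ∨ (x ∈ A ∧ y ∈ A) := by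
    refine rel_of_sameCycle hr fun z => ?_
    by_cases ha : z = a
    · subst ha
      exact Or.inr ⟨Or.inl SameCycle.rfl, Or.inr ⟨1, by simp⟩⟩
    by_cases hb : z = b
    · subst hb
      exact Or.inr ⟨Or.inr SameCycle.rfl, Or.inl ⟨1, by simp⟩⟩
    exact Or.inl ⟨1, by rw [zpow_one, mul_apply, swap_apply_of_ne_of_ne ha hb]⟩
  let q : D → Quotient (SameCycle.setoid f) := Quotient.mk _
  let q' : D → Quotient (SameCycle.setoid (f * swap a b)) := Quotient.mk _
  let F : Quotient (SameCycle.setoid f) → Quotient (SameCycle.setoid (f * swap a b)) :=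
    Quotient.map' id fun x y hxy => hxy.mul_swap h
  have hbij : Function.Bijective (fun u : {u // u ≠ q b} => F u.1) := by
    constructor
    · rintro ⟨u, hu⟩ ⟨v, hv⟩ huv
      induction u using Quotient.inductionOn with | _ x
      induction v using Quotient.inductionOn with | _ y
      have hxb : ¬ SameCycle f b x := fun hc => hu (Quotient.sound hc.symm)
      have hyb : ¬ SameCycle f b y := fun hc => hv (Quotient.sound hc.symm)
      have hxy : SameCycle (f * swap a b) x y := Quotient.exact huv
      refine Subtype.ext (Quotient.sound ?_)
      rcases hg hxy with hxy | ⟨hx, hy⟩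
      · exact hxy
      · exact (hx.resolve_right hxb).symm.trans (hy.resolve_right hyb)
    · intro v
      induction v using Quotient.inductionOn with | _ y
      by_cases hy : SameCycle f y b
      · refine ⟨⟨q a, fun hc => h (Quotient.exact hc)⟩, Quotient.sound ?_⟩
        exact (sameCycle_mul_swap h).trans (hy.symm.mul_swap h)
      · exact ⟨⟨q y, fun hc => hy (Quotient.exact hc)⟩, rfl⟩
  have h1 : (f * swap a b).numCycles = Nat.card {u // u ≠ q b} :=
    (Nat.card_congr (Equiv.ofBijective _ hbij)).symm
  have h2 := Nat.card_congr (Equiv.sumCompl (fun u : Quotient (SameCycle.setoid f) => u = q b))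
  rw [Nat.card_sum] at h2
  rw [h1, numCycles, ← h2]
  simp [add_comm]

theorem numCycles_mul_swap_of_sameCycle [Finite D] {f : Perm D} {a b : D} (hab : a ≠ b)
    (h : SameCycle f a b) : (f * swap a b).numCycles = f.numCycles + 1 := by
  have := numCycles_mul_swap_add_one (not_sameCycle_mul_swap hab h)
  rw [mul_assoc, swap_mul_self, mul_one] at this
  exact this.symm

theorem numCycles_mul_swap_le [Finite D] (f : Perm D) (a b : D) :
    (f * swap a b).numCycles ≤ f.numCycles + 1 := by
  by_cases hab : a = b
  · subst hab; rw [swap_self]; exact Nat.le_succ _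
  by_cases h : SameCycle f a b
  · exact (numCycles_mul_swap_of_sameCycle hab h).le
  · have := numCycles_mul_swap_add_one h
    omega

end Equiv.Perm

/-! ### Restrictions of a fixed-point-free involution -/

open Equiv Equiv.Perm

section Involution

variable {D : Type*} {α : Perm D}

open Classical in
/-- The permutation that agrees with the involution `α` on the `α`-stable set `P` and fixes the
other points. -/
noncomputable def restrInv (α : Perm D) (hα : ∀ d, α (α d) = d) (P : Set D)
    (hP : ∀ d, α d ∈ P ↔ d ∈ P) : Perm D :=
  Function.Involutive.toPerm (fun d => if d ∈ P then α d else d) fun d => by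
    by_cases h : d ∈ P <;> simp [h, hP, hα]

variable {hα : ∀ d, α (α d) = d} {P : Set D} {hP : ∀ d, α d ∈ P ↔ d ∈ P}

theorem restrInv_of_mem {d : D} (h : d ∈ P) : restrInv α hα P hP d = α d :=
  if_pos h

theorem restrInv_of_not_mem {d : D} (h : d ∉ P) : restrInv α hα P hP d = d :=
  if_neg h

theorem restrInv_mul_compl :
    restrInv α hα P hP * restrInv α hα Pᶜ (fun d => not_congr (hP d)) = α := by
  ext d
  rw [Perm.mul_apply]
  by_cases h : d ∈ P
  · rw [restrInv_of_not_mem (P := Pᶜ) (by simpa using h), restrInv_of_mem h]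
  · rw [restrInv_of_mem (P := Pᶜ) (by simpa using h), restrInv_of_not_mem (by rwa [hP])]

theorem restrInv_mul_self : restrInv α hα P hP * restrInv α hα P hP = 1 := by
  ext d
  rw [Perm.mul_apply]
  by_cases h : d ∈ P
  · rw [restrInv_of_mem h, restrInv_of_mem (by rwa [hP]), hα]; rfl
  · rw [restrInv_of_not_mem h, restrInv_of_not_mem h]; rfl

theorem insert_pair_stable (hα : ∀ d, α (α d) = d) (hP : ∀ d, α d ∈ P ↔ d ∈ P) (a : D) (d : D) :
    α d ∈ insert a (insert (α a) P) ↔ d ∈ insert a (insert (α a) P) := by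
  simp only [Set.mem_insert_iff, hP, α.injective.eq_iff]
  have : α d = a ↔ d = α a := ⟨fun h => by rw [← h, hα], fun h => by rw [h, hα]⟩
  rw [this]
  tauto

/-- Adding one pair is multiplication by one transposition; this is how the cycle counts above
apply. -/
theorem restrInv_insert [DecidableEq D] {a : D} (ha : a ∉ P) :
    restrInv α hα (insert a (insert (α a) P)) (insert_pair_stable hα hP a) =
      restrInv α hα P hP * swap a (α a) := by
  have ha' : α a ∉ P := by rwa [hP]
  ext d
  rw [Perm.mul_apply]
  by_cases h1 : d = a
  · subst h1
    rw [swap_apply_left, restrInv_of_mem (by simp), restrInv_of_not_mem ha']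
  by_cases h2 : d = α a
  · subst h2
    rw [swap_apply_right, restrInv_of_mem (by simp), restrInv_of_not_mem ha, hα]
  rw [swap_apply_of_ne_of_ne h1 h2]
  by_cases h : d ∈ P
  · rw [restrInv_of_mem h, restrInv_of_mem (by simp [h])]
  · rw [restrInv_of_not_mem h, restrInv_of_not_mem (by simp [h, h1, h2])]

theorem restrInv_empty (hP : ∀ d, α d ∈ (∅ : Set D) ↔ d ∈ (∅ : Set D)) :
    restrInv α hα ∅ hP = 1 := by
  ext d
  rw [restrInv_of_not_mem (Set.notMem_empty d)]; rfl

/-- Induction over the stable subsets between `P` and `Q`, adding one pair `{a, α a}` at a time. -/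
theorem stable_induction [Finite D] (hα : ∀ d, α (α d) = d) (hne : ∀ d, α d ≠ d)
    {P Q : Set D} (hP : ∀ d, α d ∈ P ↔ d ∈ P) (hQ : ∀ d, α d ∈ Q ↔ d ∈ Q) (hPQ : P ⊆ Q)
    (C : (R : Set D) → (∀ d, α d ∈ R ↔ d ∈ R) → ℕ → Prop) (h0 : C P hP 0)
    (hstep : ∀ R hR c a, P ⊆ R → R ⊆ Q → a ∈ Q → a ∉ R → C R hR c →
      C (insert a (insert (α a) R)) (insert_pair_stable hα hR a) (c + 1)) :
    ∃ c, Nat.card Q = Nat.card P + 2 * c ∧ C Q hQ c := by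
  classical
  -- Strong induction on the number of points of `Q` still missing from `R`; the number of pairs
  -- added so far is carried along to keep track of cardinalities.
  suffices H : ∀ m (R : Set D) (hR : ∀ d, α d ∈ R ↔ d ∈ R) (c : ℕ), P ⊆ R → R ⊆ Q →
      (Q \ R).ncard = m → C R hR c → ∃ c', Nat.card Q = Nat.card R + 2 * (c' - c) ∧ c ≤ c' ∧
        C Q hQ c' by
    obtain ⟨c, h1, -, h2⟩ := H _ P hP 0 subset_rfl hPQ rfl h0
    exact ⟨c, by simpa using h1, h2⟩
  intro m
  induction m using Nat.strong_induction_on with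
  | _ m ih =>
    intro R hR c hPR hRQ hm hC
    by_cases hQR : Q ⊆ R
    · obtain rfl := hRQ.antisymm hQR
      exact ⟨c, by simp, le_rfl, hC⟩
    · obtain ⟨a, haQ, haR⟩ := Set.not_subset.1 hQR
      have ha' : α a ∉ insert a R := by
        simp [hne a, hR, haR]
      have hsub : insert a (insert (α a) R) ⊆ Q := by
        rw [Set.insert_subset_iff, Set.insert_subset_iff]
        exact ⟨haQ, (hQ a).2 haQ, hRQ⟩
      have haR' : a ∉ insert (α a) R := by
        simp [haR, (hne a).symm]
      have hcard : Nat.card ↥(insert a (insert (α a) R)) = Nat.card R + 2 := by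
        rw [Nat.card_coe_set_eq, Nat.card_coe_set_eq, Set.ncard_insert_of_notMem haR',
          Set.ncard_insert_of_notMem (by rwa [hR])]
      have hlt : (Q \ insert a (insert (α a) R)).ncard < m := by
        rw [← hm]
        refine Set.ncard_lt_ncard ⟨Set.sdiff_subset_sdiff_right ?_, fun hc => ?_⟩
        · intro x hx; simp [hx]
        · exact (hc ⟨haQ, haR⟩).2 (by simp)
      obtain ⟨c', h1, h2, h3⟩ := ih _ hlt _ (insert_pair_stable hα hR a) (c + 1)
        (hPR.trans fun x hx => by simp [hx]) hsub rfl (hstep R hR c a hPR hRQ haQ haR hC)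
      exact ⟨c', by omega, by omega, h3⟩

end Involution

/-! ### Noncrossing pairs along a cyclic permutation -/

open Equiv Equiv.Perm

section Tour

variable {D : Type*} {τ : Perm D}

theorem numCycles_eq_one (hτ : ∀ x y, SameCycle τ x y) (b : D) : τ.numCycles = 1 := by
  rw [numCycles, Nat.card_eq_one_iff_unique]
  refine ⟨⟨fun u v => ?_⟩, ⟨Quotient.mk _ b⟩⟩
  induction u using Quotient.inductionOn
  induction v using Quotient.inductionOn
  exact Quotient.sound (hτ _ _)

theorem zpow_add_one_apply (b : D) (k : ℤ) : (τ ^ (k + 1)) b = τ ((τ ^ k) b) := by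
  rw [add_comm, zpow_add, zpow_one, mul_apply]

variable [Finite D]

/-- A single cycle makes D a copy of the integers modulo its cardinality, so cyclic order can be
argued with integer positions in a window of one period. -/
theorem zpow_apply_eq_zpow_apply_iff (hτ : ∀ x y, SameCycle τ x y) (b : D) (k l : ℤ) :
    (τ ^ k) b = (τ ^ l) b ↔ (Nat.card D : ℤ) ∣ l - k := by
  have := Fintype.ofFinite D
  have hc : τ.IsCycleOn ((Finset.univ : Finset D) : Set D) := by
    rw [Finset.coe_univ]
    exact ⟨⟨fun _ _ => trivial, τ.injective.injOn, fun x _ => ⟨τ.symm x, trivial, by simp⟩⟩,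
      fun x _ y _ => hτ x y⟩
  rw [hc.zpow_apply_eq_zpow_apply (Finset.mem_univ b), Finset.card_univ, Nat.card_eq_fintype_card,
    Int.modEq_iff_dvd]

theorem exists_zpow_apply_eq (hτ : ∀ x y, SameCycle τ x y) (b d : D) (i : ℤ) :
    ∃ k, i ≤ k ∧ k < i + Nat.card D ∧ (τ ^ k) b = d := by
  obtain ⟨k, hk⟩ := hτ b d
  have hpos : (0 : ℤ) < Nat.card D := by
    have : Nonempty D := ⟨b⟩
    exact_mod_cast Nat.card_pos
  refine ⟨i + (k - i) % Nat.card D, by have := Int.emod_nonneg (k - i) hpos.ne'; omega,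
    by have := Int.emod_lt_of_pos (k - i) hpos; omega, ?_⟩
  rw [← hk, zpow_apply_eq_zpow_apply_iff hτ]
  refine ⟨(k - i) / Nat.card D, ?_⟩
  have := Int.emod_add_mul_ediv (k - i) (Nat.card D)
  linarith

theorem exists_zpow_apply_eq_of_ne (hτ : ∀ x y, SameCycle τ x y) {b d : D} {i : ℤ}
    (h : d ≠ (τ ^ i) b) : ∃ k, i < k ∧ k < i + Nat.card D ∧ (τ ^ k) b = d := by
  obtain ⟨k, h1, h2, h3⟩ := exists_zpow_apply_eq hτ b d i
  refine ⟨k, lt_of_le_of_ne h1 ?_, h2, h3⟩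
  rintro rfl
  exact h h3.symm

theorem zpow_apply_inj (hτ : ∀ x y, SameCycle τ x y) {b : D} {k l : ℤ}
    (h : (τ ^ k) b = (τ ^ l) b) (h1 : k < l + Nat.card D) (h2 : l < k + Nat.card D) : k = l := by
  rw [zpow_apply_eq_zpow_apply_iff hτ] at h
  have := Int.eq_zero_of_abs_lt_dvd h (by rw [abs_lt]; constructor <;> linarith)
  linarith

variable {α : Perm D} {P : Set D}

/-- The pairs `{d, α d}` with `d ∈ P` do not cross each other with respect to the cyclic order
`b, τ b, τ² b, …`. -/
def NonCrossing (τ α : Perm D) (b : D) (P : Set D) : Prop :=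
  ∀ i j k l : ℤ, i < j → j < k → k < l → l < i + Nat.card D → (τ ^ i) b ∈ P → (τ ^ j) b ∈ P →
    (τ ^ k) b = α ((τ ^ i) b) → (τ ^ l) b = α ((τ ^ j) b) → False

/-- Start from the one cycle of τ and add the pairs one by one. Since no two pairs cross, each new
pair separates its two ends into different cycles and so adds one cycle. -/
theorem NonCrossing.numCycles_eq (hα : ∀ d, α (α d) = d) (hne : ∀ d, α d ≠ d)
    (hP : ∀ d, α d ∈ P ↔ d ∈ P) (hτ : ∀ x y, SameCycle τ x y) {b : D}
    (h : NonCrossing τ α b P) :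
    2 * (τ * restrInv α hα P hP).numCycles = Nat.card P + 2 := by
  classical
  obtain ⟨c, h1, h2⟩ := stable_induction (P := ∅) (Q := P) hα hne (by simp) hP (by simp)
    (fun R hR c => (τ * restrInv α hα R hR).numCycles = c + 1) (by
      rw [restrInv_empty, mul_one, numCycles_eq_one hτ b]) (by
      intro R hR c a _ hRP haP haR hc
      rw [restrInv_insert (hP := hR) haR, ← mul_assoc, ← hc]
      obtain ⟨i, -, -, rfl⟩ := exists_zpow_apply_eq hτ b a 0
      obtain ⟨j, hij, hj, hja⟩ := exists_zpow_apply_eq_of_ne hτ (hne ((τ ^ i) b))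
      have hns : ¬ SameCycle (τ * restrInv α hα R hR * swap ((τ ^ i) b) (α ((τ ^ i) b)))
          ((τ ^ i) b) (α ((τ ^ i) b)) := by
        intro hs
        -- The positions in (i, j], where j is the mate of i, are preserved: a pair of `R` that
        -- begins inside also ends inside, and the last position is sent to i + 1.
        have hI : ∀ x ∈ {x | ∃ k : ℤ, i < k ∧ k ≤ j ∧ (τ ^ k) b = x},
            (τ * restrInv α hα R hR * swap ((τ ^ i) b) (α ((τ ^ i) b))) x ∈
              {x | ∃ k : ℤ, i < k ∧ k ≤ j ∧ (τ ^ k) b = x} := by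
          rintro x ⟨k, hik, hkj, rfl⟩
          have hxa : (τ ^ k) b ≠ (τ ^ i) b := fun he => by
            have := zpow_apply_inj hτ he (by omega) (by omega)
            omega
          rcases hkj.lt_or_eq with hkj | rfl
          · have hxa' : (τ ^ k) b ≠ α ((τ ^ i) b) := fun he => by
              have := zpow_apply_inj hτ (he.trans hja.symm) (by omega) (by omega)
              omega
            rw [mul_apply, swap_apply_of_ne_of_ne hxa hxa', mul_apply]
            by_cases hx : (τ ^ k) b ∈ R
            · rw [restrInv_of_mem hx]
              obtain ⟨l, hl, hl', hlx⟩ := exists_zpow_apply_eq_of_ne hτ (b := b)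
                (d := α ((τ ^ k) b)) (i := i) (fun he => hxa' (by rw [← he, hα]))
              rcases lt_trichotomy l j with hlj | rfl | hlj
              · exact ⟨l + 1, by omega, by omega, by rw [zpow_add_one_apply, hlx]⟩
              · exact absurd (α.injective (hlx.symm.trans hja)) hxa
              · exact (h i k j l hik hkj hlj hl' haP (hRP hx) hja hlx).elim
            · rw [restrInv_of_not_mem hx]
              exact ⟨k + 1, by omega, by omega, by rw [zpow_add_one_apply]⟩
          · rw [mul_apply, hja, swap_apply_right, mul_apply, restrInv_of_not_mem haR]
            exact ⟨i + 1, by omega, by omega, by rw [zpow_add_one_apply]⟩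
        obtain ⟨k, h1, h2, h3⟩ := mem_of_sameCycle hI hs.symm ⟨j, hij, le_rfl, hja⟩
        have := zpow_apply_inj hτ h3 (by omega) (by omega)
        omega
      rw [← numCycles_mul_swap_add_one hns, mul_assoc _ (swap _ _), swap_mul_self, mul_one])
  rw [h2, h1]
  simp
  omega

/-- Suppose two pairs cross. The first splits the cycle in two and the second joins the halves
again, so two pairs are spent with one cycle left. The other pairs add at most one cycle each, which
leaves the total two short. -/
theorem nonCrossing_of_numCycles (hα : ∀ d, α (α d) = d) (hne : ∀ d, α d ≠ d)
    (hP : ∀ d, α d ∈ P ↔ d ∈ P) (hτ : ∀ x y, SameCycle τ x y) (b : D)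
    (h : 2 * (τ * restrInv α hα P hP).numCycles = Nat.card P + 2) : NonCrossing τ α b P := by
  classical
  intro i j k l hij hjk hkl hl hi hj hk hlj
  set a := (τ ^ i) b with ha
  set x := (τ ^ j) b with hx
  have hxa : x ≠ a := fun he => by
    have := zpow_apply_inj hτ he (by omega) (by omega)
    omega
  have hxa' : x ≠ α a := fun he => by
    have := zpow_apply_inj hτ (he.trans hk.symm) (by omega) (by omega)
    omega
  have hE : ∀ d, α d ∈ (∅ : Set D) ↔ d ∈ (∅ : Set D) := by simp
  have hS1 := insert_pair_stable hα hE a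
  have hS2 := insert_pair_stable hα hS1 x
  have hxS : x ∉ insert a (insert (α a) (∅ : Set D)) := by simp [hxa, hxa']
  have e1 : τ * restrInv α hα _ hS1 = τ * swap a (α a) := by
    rw [restrInv_insert (hP := hE) (Set.notMem_empty a), restrInv_empty, one_mul]
  have n1 : (τ * restrInv α hα _ hS1).numCycles = 2 := by
    rw [e1, numCycles_mul_swap_of_sameCycle (hne a).symm (hτ _ _), numCycles_eq_one hτ b]
  -- After the first pair (i, k) the positions in (i, k] are closed; they contain j but not l.
  have hns : ¬ SameCycle (τ * restrInv α hα _ hS1) x (α x) := by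
    rw [e1]
    intro hs
    have hI : ∀ x ∈ {x | ∃ m : ℤ, i < m ∧ m ≤ k ∧ (τ ^ m) b = x},
        (τ * swap a (α a)) x ∈ {x | ∃ m : ℤ, i < m ∧ m ≤ k ∧ (τ ^ m) b = x} := by
      rintro y ⟨m, him, hmk, rfl⟩
      rcases hmk.lt_or_eq with hmk | rfl
      · rw [mul_apply, swap_apply_of_ne_of_ne]
        · exact ⟨m + 1, by omega, by omega, by rw [zpow_add_one_apply]⟩
        · intro he
          have := zpow_apply_inj hτ he (by omega) (by omega)
          omega
        · intro he
          have := zpow_apply_inj hτ (he.trans hk.symm) (by omega) (by omega)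
          omega
      · rw [mul_apply, hk, swap_apply_right]
        exact ⟨i + 1, by omega, by omega, by rw [zpow_add_one_apply]⟩
    obtain ⟨m, h1, h2, h3⟩ := mem_of_sameCycle hI hs ⟨j, hij, hjk.le, rfl⟩
    have := zpow_apply_inj hτ (h3.trans hlj.symm) (by omega) (by omega)
    omega
  have n2 : (τ * restrInv α hα _ hS2).numCycles = 1 := by
    have := numCycles_mul_swap_add_one hns
    rw [n1] at this
    rw [restrInv_insert (hP := hS1) hxS, ← mul_assoc]
    omega
  have hsub : insert x (insert (α x) (insert a (insert (α a) (∅ : Set D)))) ⊆ P := by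
    intro y hy
    simp only [Set.mem_insert_iff, Set.mem_empty_iff_false, or_false] at hy
    rcases hy with rfl | rfl | rfl | rfl
    exacts [hj, (hP _).2 hj, hi, (hP _).2 hi]
  obtain ⟨c, h1, h2⟩ := stable_induction hα hne hS2 hP hsub
    (fun R hR c => (τ * restrInv α hα R hR).numCycles ≤ c + 1) n2.le (by
      intro R hR c y _ _ _ hyR hc
      rw [restrInv_insert (hP := hR) hyR, ← mul_assoc]
      exact (numCycles_mul_swap_le _ _ _).trans (by omega))
  have hcard : Nat.card ↥(insert x (insert (α x) (insert a (insert (α a) (∅ : Set D))))) = 4 := by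
    have hx1 : α x ≠ a := fun he => hxa' (by rw [← he, hα])
    have hx2 : α x ≠ α a := fun he => hxa (α.injective he)
    rw [Nat.card_coe_set_eq, Set.ncard_insert_of_notMem, Set.ncard_insert_of_notMem,
      Set.ncard_insert_of_notMem, Set.ncard_insert_of_notMem]
    · simp
    · simp
    · simp [(hne a).symm]
    · simp [hx1, hx2]
    · simp [hxa, hxa', (hne x).symm]
  omega

end Tour

/-! ### Spanning trees and planarity in terms of the tour -/

open Equiv Equiv.Perm

theorem Nat.card_eq_mul_of_fiber {X Y : Type*} [Finite X] [Finite Y] (f : X → Y) (k : ℕ)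
    (h : ∀ y, Nat.card {x // f x = y} = k) : Nat.card X = k * Nat.card Y := by
  have := Fintype.ofFinite Y
  rw [← Nat.card_congr (Equiv.sigmaFiberEquiv f), Nat.card_sigma, Finset.sum_congr rfl fun y _ => h y]
  simp [mul_comm]

theorem Equiv.Perm.sameCycle_iff_of_involutive {D : Type*} {α : Perm D} (hα : ∀ d, α (α d) = d)
    {d e : D} : SameCycle α d e ↔ e = d ∨ e = α d := by
  constructor
  · rintro ⟨k, rfl⟩
    have h2 : α * α = 1 := Equiv.ext hα
    rcases Int.even_or_odd' k with ⟨m, rfl | rfl⟩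
    · left
      rw [zpow_mul, zpow_two, h2, one_zpow, one_apply]
    · right
      rw [zpow_add, zpow_mul, zpow_two, h2, one_zpow, one_mul, zpow_one]
  · rintro (rfl | rfl)
    exacts [SameCycle.rfl, ⟨1, rfl⟩]

namespace CombMap

variable {D : Type*} (M : CombMap D)

instance [Finite D] : Finite M.Vertex := inferInstanceAs (Finite (Quotient _))
instance [Finite D] : Finite M.Edge := inferInstanceAs (Finite (Quotient _))
theorem vertexOf_eq_iff {d e : D} : M.vertexOf d = M.vertexOf e ↔ SameCycle M.σ d e :=
  Quotient.eq

theorem edgeOf_eq_iff {d e : D} : M.edgeOf d = M.edgeOf e ↔ e = d ∨ e = M.α d :=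
  Quotient.eq.trans (sameCycle_iff_of_involutive M.α_α)

theorem edgeOf_α (d : D) : M.edgeOf (M.α d) = M.edgeOf d :=
  (M.edgeOf_eq_iff.2 (Or.inr rfl)).symm

theorem vertexOf_σ (d : D) : M.vertexOf (M.σ d) = M.vertexOf d :=
  (M.vertexOf_eq_iff.2 ⟨1, rfl⟩).symm

/-- The darts of the edges in `T`. -/
def dartsOf (T : Set M.Edge) : Set D := {d | M.edgeOf d ∈ T}

theorem dartsOf_stable (T : Set M.Edge) (d : D) : M.α d ∈ M.dartsOf T ↔ d ∈ M.dartsOf T := by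
  simp only [dartsOf, Set.mem_ofPred_eq, edgeOf_α]

/-- The tour around the edges in `T`: a dart of `T` is followed by the successor of its reverse,
any other dart by its own successor. -/
noncomputable def tour (T : Set M.Edge) : Perm D :=
  M.σ * restrInv M.α M.α_α (M.dartsOf T) (M.dartsOf_stable T)

variable {M}

theorem tour_of_mem {T : Set M.Edge} {d : D} (h : M.edgeOf d ∈ T) : M.tour T d = M.σ (M.α d) := by
  rw [tour, Perm.mul_apply, restrInv_of_mem (P := M.dartsOf T) h]

theorem tour_of_not_mem {T : Set M.Edge} {d : D} (h : M.edgeOf d ∉ T) : M.tour T d = M.σ d := by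
  rw [tour, Perm.mul_apply, restrInv_of_not_mem (P := M.dartsOf T) h]

theorem tour_mul_restrInv (T : Set M.Edge) :
    M.tour T * restrInv M.α M.α_α (M.dartsOf T) (M.dartsOf_stable T) = M.σ := by
  rw [tour, mul_assoc, restrInv_mul_self, mul_one]

/-- Relative to the tour, the pairs of `T` produce the vertices and the remaining pairs produce the
faces. Both cycle counts are thus instances of the results on noncrossing pairs. -/
theorem tour_mul_restrInv_compl (T : Set M.Edge) :
    M.tour T * restrInv M.α M.α_α (M.dartsOf T)ᶜ (fun d => not_congr (M.dartsOf_stable T d)) =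
      M.σ * M.α := by
  rw [tour, mul_assoc, restrInv_mul_compl]

theorem isCycleOn_vertexOf (d : D) :
    M.σ.IsCycleOn {x | M.vertexOf x = M.vertexOf d} := by
  refine ⟨⟨fun x hx => (M.vertexOf_σ x).trans hx, M.σ.injective.injOn, fun x hx => ?_⟩, ?_⟩
  · refine ⟨M.σ.symm x, ?_, by simp⟩
    rw [Set.mem_ofPred_eq, ← hx, ← M.vertexOf_σ (M.σ.symm x), Equiv.apply_symm_apply]
  · intro x hx y hy
    exact M.vertexOf_eq_iff.1 (hx.trans hy.symm)

theorem reachable_of_mem {T : Set M.Edge} {d : D} (h : M.edgeOf d ∈ T) :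
    (M.graphOf T).Reachable (M.vertexOf d) (M.vertexOf (M.α d)) := by
  by_cases hv : M.vertexOf d = M.vertexOf (M.α d)
  · rw [hv]
  · exact SimpleGraph.Adj.reachable ((SimpleGraph.fromRel_adj _ _ _).2 ⟨hv, Or.inl ⟨d, h, rfl, rfl⟩⟩)

section Finite

variable [Finite D]

theorem card_edge : Nat.card D = 2 * Nat.card M.Edge := by
  refine Nat.card_eq_mul_of_fiber M.edgeOf 2 fun q => ?_
  induction q using Quotient.inductionOn with | _ d
  have : {x | M.edgeOf x = M.edgeOf d} = {d, M.α d} := by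
    ext x
    rw [Set.mem_ofPred_eq, eq_comm, edgeOf_eq_iff]; rfl
  change Nat.card {x | M.edgeOf x = M.edgeOf d} = 2
  rw [this, Nat.card_coe_set_eq, Set.ncard_pair (M.α_ne d).symm]

theorem card_dartsOf (T : Set M.Edge) : Nat.card (M.dartsOf T) = 2 * Nat.card T := by
  refine Nat.card_eq_mul_of_fiber (fun d : M.dartsOf T => (⟨M.edgeOf d.1, d.2⟩ : T)) 2 ?_
  rintro ⟨q, hq⟩
  induction q using Quotient.inductionOn with | _ d
  have hd : d ∈ M.dartsOf T := hq
  have : {x : M.dartsOf T | (⟨M.edgeOf x.1, x.2⟩ : T) = ⟨M.edgeOf d, hq⟩} =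
      {⟨d, hd⟩, ⟨M.α d, (M.dartsOf_stable T d).2 hd⟩} := by
    ext x
    refine Subtype.ext_iff.trans (Eq.comm.trans (M.edgeOf_eq_iff.trans ?_))
    rw [Set.mem_insert_iff, Set.mem_singleton_iff, Subtype.ext_iff, Subtype.ext_iff]
  change Nat.card {x : M.dartsOf T | (⟨M.edgeOf x.1, x.2⟩ : T) = ⟨M.edgeOf d, hq⟩} = 2
  rw [this, Nat.card_coe_set_eq, Set.ncard_pair]
  simpa [Subtype.ext_iff] using (M.α_ne d).symm

theorem card_dartsOf_add_compl (T : Set M.Edge) :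
    Nat.card (M.dartsOf T) + Nat.card ↥(M.dartsOf T)ᶜ = Nat.card D := by
  rw [Nat.card_coe_set_eq, Nat.card_coe_set_eq, Set.ncard_add_ncard_compl]

theorem IsCubic.card_eq (h : M.IsCubic) : Nat.card D = 3 * Nat.card M.Vertex :=
  Nat.card_eq_mul_of_fiber M.vertexOf 3 h

theorem IsCubic.σ_pow (h : M.IsCubic) (d : D) (k : ℕ) : (M.σ ^ k) d = d ↔ 3 ∣ k := by
  classical
  have := Fintype.ofFinite D
  have hc := isCycleOn_vertexOf (M := M) d
  have hcard : (Finset.univ.filter fun x => M.vertexOf x = M.vertexOf d).card = 3 := by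
    rw [← h (M.vertexOf d), Nat.card_eq_fintype_card, Fintype.card_subtype]
  have hc' : M.σ.IsCycleOn
      ((Finset.univ.filter fun x => M.vertexOf x = M.vertexOf d : Finset D) : Set D) := by
    simpa using hc
  rw [hc'.pow_apply_eq (by simp), hcard]

theorem IsCubic.σ_σ_σ (h : M.IsCubic) (d : D) : M.σ (M.σ (M.σ d)) = d := by
  simpa [pow_succ] using (h.σ_pow d 3).2 dvd_rfl

theorem IsCubic.σ_ne (h : M.IsCubic) (d : D) : M.σ d ≠ d := fun he => by
  simpa using (h.σ_pow d 1).1 (by simpa using he)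

theorem IsCubic.σ_σ_ne (h : M.IsCubic) (d : D) : M.σ (M.σ d) ≠ d := fun he =>
  absurd ((h.σ_pow d 2).1 (by simpa [pow_succ] using he)) (by decide)

theorem isCubic_of_σ (h3 : ∀ d, M.σ (M.σ (M.σ d)) = d) (h1 : ∀ d, M.σ d ≠ d) : M.IsCubic := by
  intro v
  induction v using Quotient.inductionOn with | _ d
  have h2 : M.σ (M.σ d) ≠ d := fun he => h1 d (by rw [← congrArg M.σ he, h3])
  have : {x | M.vertexOf x = M.vertexOf d} = {d, M.σ d, M.σ (M.σ d)} := by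
    ext x
    constructor
    · intro hx
      refine mem_of_sameCycle (f := M.σ) ?_ (M.vertexOf_eq_iff.1 hx.symm) (Or.inl rfl)
      rintro y (rfl | rfl | rfl)
      exacts [Or.inr (Or.inl rfl), Or.inr (Or.inr rfl), Or.inl (h3 _)]
    · rintro (rfl | rfl | rfl)
      · rfl
      · exact M.vertexOf_σ _
      · exact (M.vertexOf_σ _).trans (M.vertexOf_σ _)
  change Nat.card {x | M.vertexOf x = M.vertexOf d} = 3
  rw [this, Nat.card_coe_set_eq, Set.ncard_eq_three]
  exact ⟨d, M.σ d, M.σ (M.σ d), (h1 d).symm, h2.symm, (h1 _).symm, rfl⟩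

/-- One step of the tour either stays at a vertex or crosses an edge of `T`. -/
theorem reachable_of_sameCycle_tour {T : Set M.Edge} {x y : D} (h : SameCycle (M.tour T) x y) :
    (M.graphOf T).Reachable (M.vertexOf x) (M.vertexOf y) := by
  refine rel_of_sameCycle (f := M.tour T)
    (r := fun x y => (M.graphOf T).Reachable (M.vertexOf x) (M.vertexOf y))
    ⟨fun x => SimpleGraph.Reachable.refl _, fun h => h.symm, fun h h' => h.trans h'⟩ (fun z => ?_) h
  by_cases hz : M.edgeOf z ∈ T
  · rw [tour_of_mem hz, vertexOf_σ]
    exact reachable_of_mem hz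
  · rw [tour_of_not_mem hz, vertexOf_σ]

/-- Insert the edges of `T` into σ one at a time. Each joins two different cycles, so cycles only
grow and their number drops by one per edge. -/
theorem IsSpanningTree.tour_aux {T : Set M.Edge} (hT : M.IsSpanningTree T) :
    (∀ x y, SameCycle M.σ x y → SameCycle (M.tour T) x y) ∧
      (∀ x ∈ M.dartsOf T, SameCycle (M.tour T) x (M.α x)) ∧
      2 * (M.tour T).numCycles + Nat.card (M.dartsOf T) = 2 * Nat.card M.Vertex := by
  classical
  obtain ⟨c, h1, h2, h3, h4⟩ := stable_induction (P := ∅) (Q := M.dartsOf T) M.α_α M.α_ne (by simp)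
    (M.dartsOf_stable T) (by simp)
    (fun R hR c => (∀ x y, SameCycle M.σ x y → SameCycle (M.σ * restrInv M.α M.α_α R hR) x y) ∧
      (∀ x ∈ R, SameCycle (M.σ * restrInv M.α M.α_α R hR) x (M.α x)) ∧
      (M.σ * restrInv M.α M.α_α R hR).numCycles + c = M.σ.numCycles)
    (by rw [restrInv_empty, mul_one]; simp) (by
      intro R hR c a _ hRT haT haR hC
      obtain ⟨h1, h2, h3⟩ := hC
      -- If the ends of `a` were already in one cycle, the edges of `R` would connect its two end
      -- vertices; but every edge of a tree is a bridge.
      have hns : ¬ SameCycle (M.σ * restrInv M.α M.α_α R hR) a (M.α a) := by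
        intro hs
        have hR' : M.dartsOf (M.edgeOf '' R) = R := by
          ext x
          constructor
          · rintro ⟨y, hy, hyx⟩
            rcases M.edgeOf_eq_iff.1 hyx with rfl | rfl
            exacts [hy, (hR y).2 hy]
          · exact fun hx => ⟨x, hx, rfl⟩
        have hs' : SameCycle (M.tour (M.edgeOf '' R)) a (M.α a) := by
          have : M.tour (M.edgeOf '' R) = M.σ * restrInv M.α M.α_α R hR := by
            unfold tour; congr!
          rwa [this]
        have hr := reachable_of_sameCycle_tour hs'
        have hva := hT.no_loop a haT
        have hadj : (M.graphOf T).Adj (M.vertexOf a) (M.vertexOf (M.α a)) :=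
          (SimpleGraph.fromRel_adj _ _ _).2 ⟨hva, Or.inl ⟨a, haT, rfl, rfl⟩⟩
        have hb := SimpleGraph.isAcyclic_iff_forall_adj_isBridge.1 hT.isTree.isAcyclic hadj
        rw [SimpleGraph.isBridge_iff] at hb
        refine hb (hr.mono ?_)
        -- Absence of parallel edges ensures that deleting the adjacency of `a` from the simple
        -- graph deletes no edge of `R`.
        have key : ∀ x, M.edgeOf x ∈ M.edgeOf '' R →
            s(M.vertexOf x, M.vertexOf (M.α x)) ≠ s(M.vertexOf a, M.vertexOf (M.α a)) := by
          intro x hx he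
          have hxR : x ∈ R := by rw [← hR']; exact hx
          have hxT : M.edgeOf x ∈ T := hRT hxR
          have : M.edgeOf x = M.edgeOf a := by
            rcases Sym2.eq_iff.1 he with ⟨e1, e2⟩ | ⟨e1, e2⟩
            · exact hT.no_parallel x a hxT haT e1 e2
            · rw [← M.edgeOf_α a]
              exact hT.no_parallel x (M.α a) hxT (by rwa [edgeOf_α]) e1 (by rwa [M.α_α])
          rcases M.edgeOf_eq_iff.1 this with rfl | rfl
          · exact haR hxR
          · exact haR ((hR x).2 hxR)
        intro u v huv
        obtain ⟨hne, huv⟩ := (SimpleGraph.fromRel_adj _ _ _).1 huv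
        rw [SimpleGraph.deleteEdges_adj]
        rcases huv with ⟨x, hx, rfl, rfl⟩ | ⟨x, hx, rfl, rfl⟩
        · have hxR : x ∈ R := by rw [← hR']; exact hx
          refine ⟨(SimpleGraph.fromRel_adj _ _ _).2 ⟨hne, Or.inl ⟨x, hRT hxR, rfl, rfl⟩⟩, ?_⟩
          exact key x hx
        · have hxR : x ∈ R := by rw [← hR']; exact hx
          refine ⟨(SimpleGraph.fromRel_adj _ _ _).2 ⟨hne, Or.inr ⟨x, hRT hxR, rfl, rfl⟩⟩, ?_⟩
          exact fun hc => key x hx (Sym2.eq_swap.trans hc)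
      rw [restrInv_insert (hP := hR) haR, ← mul_assoc]
      refine ⟨fun x y hxy => (h1 x y hxy).mul_swap hns, ?_, ?_⟩
      · rintro x (rfl | rfl | hx)
        · exact sameCycle_mul_swap hns
        · rw [M.α_α]; exact (sameCycle_mul_swap hns).symm
        · exact (h2 x hx).mul_swap hns
      · have := numCycles_mul_swap_add_one hns
        omega)
  refine ⟨h2, h3, ?_⟩
  have : M.σ.numCycles = Nat.card M.Vertex := rfl
  simp only [Nat.card_of_isEmpty] at h1
  change (M.tour T).numCycles + c = _ at h4
  omega

/-- A tour cycle contains whole vertices and both darts of each tree edge, so following a walk in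
the tree shows that there is only one. -/
theorem IsSpanningTree.sameCycle_tour {T : Set M.Edge} (hT : M.IsSpanningTree T) (x y : D) :
    SameCycle (M.tour T) x y := by
  obtain ⟨h1, h2, -⟩ := hT.tour_aux
  have hadj : ∀ {u v}, (M.graphOf T).Adj u v → ∀ x y, M.vertexOf x = u → M.vertexOf y = v →
      SameCycle (M.tour T) x y := by
    intro u v huv x y hx hy
    rcases ((SimpleGraph.fromRel_adj _ _ _).1 huv).2 with ⟨z, hz, rfl, rfl⟩ | ⟨z, hz, rfl, rfl⟩
    · exact ((h1 _ _ (M.vertexOf_eq_iff.1 hx)).trans (h2 z hz)).trans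
        (h1 _ _ (M.vertexOf_eq_iff.1 hy)).symm
    · exact ((h1 _ _ (M.vertexOf_eq_iff.1 hx)).trans (h2 z hz).symm).trans
        (h1 _ _ (M.vertexOf_eq_iff.1 hy)).symm
  have hwalk : ∀ {u v}, (M.graphOf T).Walk u v → ∀ x y, M.vertexOf x = u → M.vertexOf y = v →
      SameCycle (M.tour T) x y := by
    intro u v p
    induction p with
    | nil => exact fun x y hx hy => h1 _ _ (M.vertexOf_eq_iff.1 (hx.trans hy.symm))
    | @cons u v w huv p ih =>
      intro x y hx hy
      obtain ⟨z, rfl⟩ : ∃ z, M.vertexOf z = v := Quotient.exists_rep v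
      exact (hadj huv x z hx rfl).trans (ih z y rfl hy)
  obtain ⟨p⟩ := hT.isTree.connected.preconnected (M.vertexOf x) (M.vertexOf y)
  exact hwalk p x y rfl rfl

theorem IsSpanningTree.card_dartsOf [Nonempty D] {T : Set M.Edge} (hT : M.IsSpanningTree T) :
    Nat.card (M.dartsOf T) + 2 = 2 * Nat.card M.Vertex := by
  have := hT.tour_aux.2.2
  rw [numCycles_eq_one hT.sameCycle_tour (Classical.arbitrary D)] at this
  omega

/-- The product of the tour with the tree pairs is σ, whose number of cycles, one per vertex, is the
maximal one. -/
theorem IsSpanningTree.nonCrossing {T : Set M.Edge} (hT : M.IsSpanningTree T) (b : D) :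
    NonCrossing (M.tour T) M.α b (M.dartsOf T) := by
  have : Nonempty D := ⟨b⟩
  refine nonCrossing_of_numCycles M.α_α M.α_ne (M.dartsOf_stable T) hT.sameCycle_tour b ?_
  rw [tour_mul_restrInv, hT.card_dartsOf]
  rfl

/-- Here the product is σα, and Euler's formula says that the number of faces is maximal. -/
theorem IsSpanningTree.nonCrossing_compl {T : Set M.Edge} (hT : M.IsSpanningTree T)
    (hM : M.IsPlanar) (b : D) : NonCrossing (M.tour T) M.α b (M.dartsOf T)ᶜ := by
  have : Nonempty D := ⟨b⟩
  refine nonCrossing_of_numCycles M.α_α M.α_ne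
    (fun d => not_congr (M.dartsOf_stable T d)) hT.sameCycle_tour b ?_
  rw [tour_mul_restrInv_compl]
  have h1 := hT.card_dartsOf
  have h2 := card_dartsOf_add_compl T
  have h3 := card_edge (M := M)
  have h4 := hM.2
  have h5 : (M.σ * M.α).numCycles = Nat.card M.Face := rfl
  omega

section Converse

variable {T : Set M.Edge}

theorem isConnected_of_tour (hτ : ∀ x y, SameCycle (M.tour T) x y) : M.IsConnected := by
  intro d e
  refine rel_of_sameCycle (f := M.tour T)
    (r := fun x y => ∃ g ∈ Subgroup.closure {M.σ, M.α}, g x = y) ⟨?_, ?_, ?_⟩ (fun z => ?_) (hτ d e)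
  · exact fun x => ⟨1, one_mem _, rfl⟩
  · rintro x y ⟨g, hg, rfl⟩
    exact ⟨g⁻¹, inv_mem hg, by simp⟩
  · rintro x y z ⟨g, hg, rfl⟩ ⟨g', hg', rfl⟩
    exact ⟨g' * g, mul_mem hg' hg, rfl⟩
  · by_cases hz : M.edgeOf z ∈ T
    · exact ⟨M.σ * M.α, mul_mem (Subgroup.subset_closure (by simp))
        (Subgroup.subset_closure (by simp)), (tour_of_mem hz).symm⟩
    · exact ⟨M.σ, Subgroup.subset_closure (by simp), (tour_of_not_mem hz).symm⟩

/-- A single tour gives connectedness, so the simple graph has at least V - 1 edges. It has at most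
as many as `T` has non-loops, and `T` has V - 1 elements. Equality throughout excludes loops and
parallel edges and makes the graph a tree. -/
theorem isSpanningTree_of_tour [Nonempty D] (hτ : ∀ x y, SameCycle (M.tour T) x y)
    (hcard : Nat.card (M.dartsOf T) + 2 = 2 * Nat.card M.Vertex) : M.IsSpanningTree T := by
  let φ : M.Edge → Sym2 M.Vertex :=
    Quotient.lift (fun d => s(M.vertexOf d, M.vertexOf (M.α d))) (by
      intro d e hde
      rcases (sameCycle_iff_of_involutive M.α_α).1 hde with rfl | rfl
      · rfl
      · simp only [M.α_α]; exact Sym2.eq_swap)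
  have hφ : ∀ d, φ (M.edgeOf d) = s(M.vertexOf d, M.vertexOf (M.α d)) := fun _ => rfl
  have hconn : (M.graphOf T).Connected := by
    have : Nonempty M.Vertex := ⟨M.vertexOf (Classical.arbitrary D)⟩
    refine ⟨fun u v => ?_⟩
    obtain ⟨x, rfl⟩ : ∃ z, M.vertexOf z = u := Quotient.exists_rep u
    obtain ⟨y, rfl⟩ : ∃ z, M.vertexOf z = v := Quotient.exists_rep v
    exact reachable_of_sameCycle_tour (hτ x y)
  have hsub : (M.graphOf T).edgeSet ⊆ φ '' {q ∈ T | ¬ (φ q).IsDiag} := by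
    intro s hs
    induction s with | _ u v
    obtain ⟨hne, huv⟩ := (SimpleGraph.fromRel_adj _ _ _).1 (SimpleGraph.mem_edgeSet _ |>.1 hs)
    rcases huv with ⟨x, hx, rfl, rfl⟩ | ⟨x, hx, rfl, rfl⟩
    · exact ⟨M.edgeOf x, ⟨hx, by simpa [hφ] using hne⟩, rfl⟩
    · exact ⟨M.edgeOf x, ⟨hx, by simpa [hφ] using hne.symm⟩, by rw [hφ, Sym2.eq_swap]⟩
  have h1 := hconn.card_vert_le_card_edgeSet_add_one
  have h2 := CombMap.card_dartsOf T
  have h3 : (M.graphOf T).edgeSet.ncard ≤ (φ '' {q ∈ T | ¬ (φ q).IsDiag}).ncard :=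
    Set.ncard_le_ncard hsub
  have h4 : (φ '' {q ∈ T | ¬ (φ q).IsDiag}).ncard ≤ {q ∈ T | ¬ (φ q).IsDiag}.ncard :=
    Set.ncard_image_le
  have h5 : {q ∈ T | ¬ (φ q).IsDiag}.ncard ≤ T.ncard := Set.ncard_le_ncard (fun q hq => hq.1)
  rw [Nat.card_coe_set_eq] at h1 h2
  rw [Nat.card_coe_set_eq] at h2
  rw [Nat.card_coe_set_eq] at hcard
  have h6 : {q ∈ T | ¬ (φ q).IsDiag} = T := Set.eq_of_subset_of_ncard_le (fun q hq => hq.1) (by omega)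
  have hinj : Set.InjOn φ T := by
    rw [h6] at h4 h3
    exact Set.injOn_of_ncard_image_eq (by omega)
  refine ⟨fun d hd hv => ?_, fun d e hd he h h' => ?_, ?_⟩
  · rw [← h6] at hd
    exact hd.2 (by rw [hφ, hv]; simp)
  · exact hinj hd he (by rw [hφ, hφ, h, h'])
  · rw [SimpleGraph.isTree_iff_connected_and_card, Nat.card_coe_set_eq]
    exact ⟨hconn, by omega⟩

/-- Noncrossing pairs off the tree determine the number of cycles of σα, which is the number of
faces that Euler's formula asks for. -/
theorem isPlanar_of_tour {b : D} (hτ : ∀ x y, SameCycle (M.tour T) x y)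
    (hcard : Nat.card (M.dartsOf T) + 2 = 2 * Nat.card M.Vertex)
    (hnc : NonCrossing (M.tour T) M.α b (M.dartsOf T)ᶜ) : M.IsPlanar := by
  refine ⟨isConnected_of_tour hτ, ?_⟩
  have h1 := hnc.numCycles_eq M.α_α M.α_ne (fun d => not_congr (M.dartsOf_stable T d)) hτ
  rw [tour_mul_restrInv_compl] at h1
  have h2 := card_dartsOf_add_compl T
  have h3 := card_edge (M := M)
  have h5 : (M.σ * M.α).numCycles = Nat.card M.Face := rfl
  omega

end Converse

end Finite

end CombMap

/-! ### Triangulations and noncrossing matchings of a polygon, with rotations -/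

open Equiv Equiv.Perm

/-- A triangulation of a convex polygon with vertex set `ZMod N`, given by the relation of being
joined by a side or a diagonal. Cyclic order is expressed through integer representatives. -/
@[ext]
structure Triangulation (N : ℕ) where
  Adj : ZMod N → ZMod N → Prop
  irrefl : ∀ a, ¬ Adj a a
  symm : ∀ a b, Adj a b → Adj b a
  side : ∀ a, Adj a (a + 1)
  noncross : ∀ i x j y : ℤ, i < x → x < j → j < y → y < i + N → Adj i j → Adj x y → False
  apex : ∀ i j : ℤ, i + 1 < j → j < i + N → Adj i j → ∃ k : ℤ, i < k ∧ k < j ∧ Adj i k ∧ Adj k j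

/-- A noncrossing perfect matching of the points `ZMod N` on a circle. -/
@[ext]
structure NCMatching (N : ℕ) where
  μ : ZMod N → ZMod N
  μ_μ : ∀ a, μ (μ a) = a
  μ_ne : ∀ a, μ a ≠ a
  noncross : ∀ i x j y : ℤ, i < x → x < j → j < y → y < i + N → μ i = j → μ x = y → False

section Rotation

variable {N : ℕ}

theorem intCast_eq_iff {a b : ℤ} : (a : ZMod N) = b ↔ ∃ c : ℤ, a = b + N * c := by
  rw [eq_comm, ZMod.intCast_eq_intCast_iff_dvd_sub]
  exact ⟨fun ⟨c, hc⟩ => ⟨c, by linarith⟩, fun ⟨c, hc⟩ => ⟨c, by linarith⟩⟩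

theorem intCast_add_mul (a c : ℤ) : ((a + N * c : ℤ) : ZMod N) = a := by
  simp

theorem eq_of_intCast_eq {a b : ℤ} (h : (a : ZMod N) = b) (h1 : a < b + N) (h2 : b < a + N) :
    a = b := by
  rw [ZMod.intCast_eq_intCast_iff_dvd_sub] at h
  have := Int.eq_zero_of_abs_lt_dvd h (by rw [abs_lt]; constructor <;> linarith)
  linarith

/-- Two increasing pairs of representatives of the same pair of residues differ by a common
multiple of `N`. -/
theorem exists_shift {i j i' j' : ℤ} (hi : (i : ZMod N) = i') (hj : (j : ZMod N) = j')
    (h1 : i < j) (h2 : j < i + N) (h1' : i' < j') (h2' : j' < i' + N) :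
    ∃ c : ℤ, i = i' + N * c ∧ j = j' + N * c := by
  obtain ⟨c, hc⟩ := intCast_eq_iff.1 hi
  refine ⟨c, hc, eq_of_intCast_eq (N := N) ?_ (by linarith) (by linarith)⟩
  rw [hj, intCast_add_mul]

instance : AddAction (ZMod N) (Triangulation N) where
  vadd g S :=
    { Adj := fun a b => S.Adj (a - g) (b - g)
      irrefl := fun a => S.irrefl _
      symm := fun a b => S.symm _ _
      side := fun a => by
        have := S.side (a - g)
        rwa [sub_add_eq_add_sub] at this
      noncross := by
        obtain ⟨g, rfl⟩ := ZMod.intCast_surjective g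
        intro i x j y h1 h2 h3 h4 h5 h6
        exact S.noncross (i - g) (x - g) (j - g) (y - g) (by omega) (by omega) (by omega) (by omega)
          (by push_cast; exact h5) (by push_cast; exact h6)
      apex := by
        obtain ⟨g, rfl⟩ := ZMod.intCast_surjective g
        intro i j h1 h2 h3
        obtain ⟨k, h4, h5, h6, h7⟩ := S.apex (i - g) (j - g) (by omega) (by omega)
          (by push_cast; exact h3)
        exact ⟨k + g, by omega, by omega, by push_cast at h6 ⊢; simpa using h6,
          by push_cast at h7 ⊢; simpa using h7⟩ }
  zero_vadd S := by
    ext a b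
    change S.Adj (a - 0) (b - 0) ↔ _
    rw [sub_zero, sub_zero]
  add_vadd g h S := by
    ext a b
    change S.Adj (a - (g + h)) (b - (g + h)) ↔ S.Adj (a - g - h) (b - g - h)
    rw [sub_sub, sub_sub]

instance : AddAction (ZMod N) (NCMatching N) where
  vadd g m :=
    { μ := fun a => m.μ (a - g) + g
      μ_μ := fun a => by rw [add_sub_cancel_right, m.μ_μ, sub_add_cancel]
      μ_ne := fun a h => m.μ_ne (a - g) (by rw [← eq_sub_iff_add_eq] at h; exact h)
      noncross := by
        obtain ⟨g, rfl⟩ := ZMod.intCast_surjective g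
        intro i x j y h1 h2 h3 h4 h5 h6
        refine m.noncross (i - g) (x - g) (j - g) (y - g) (by omega) (by omega) (by omega)
          (by omega) ?_ ?_
        · push_cast; rw [← h5]; simp
        · push_cast; rw [← h6]; simp }
  zero_vadd m := by
    ext a
    change m.μ (a - 0) + 0 = _
    rw [sub_zero, add_zero]
  add_vadd g h m := by
    ext a
    change m.μ (a - (g + h)) + (g + h) = m.μ (a - g - h) + h + g
    rw [sub_sub, add_assoc, add_comm h g]

theorem Triangulation.vadd_adj (g : ZMod N) (S : Triangulation N) (a b : ZMod N) :
    (g +ᵥ S).Adj a b ↔ S.Adj (a - g) (b - g) := Iff.rfl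

theorem NCMatching.vadd_μ (g : ZMod N) (m : NCMatching N) (a : ZMod N) :
    (g +ᵥ m).μ a = m.μ (a - g) + g := rfl

/-- Two different apices over the same base would have crossing legs. -/
theorem Triangulation.apex_unique (S : Triangulation N) {j k k' l : ℤ} (h1 : j < k) (h2 : k < l)
    (h1' : j < k') (h2' : k' < l) (hl : l < j + N) (hjk : S.Adj j k) (hkl : S.Adj k l)
    (hjk' : S.Adj j k') (hkl' : S.Adj k' l) : k = k' := by
  rcases lt_trichotomy k k' with h | h | h
  · exact (S.noncross j k k' l h1 h h2' hl hjk' hkl).elim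
  · exact h
  · exact (S.noncross j k' k l h1' h h2 hl hjk hkl').elim

end Rotation

/-! ### Labelled maps are determined by the pair, and determine it up to rotation -/

variable {m N : ℕ}

/-- The labels `ℓ` identify the darts of `A` with the oriented sides and diagonals of `S`, other
than the sides in negative direction, in such a way that `A` is the map dual to `S`, its edges off
the tree being glued according to the matching `μ` of the sides. -/
structure Labels (A : TreeRootedCubicMap m) (S : Triangulation N) (μ : NCMatching N)
    (ℓ : A.Dart → ZMod N) : Prop where
  inj : ∀ d e, ℓ d = ℓ e → ℓ (A.map.σ d) = ℓ (A.map.σ e) → d = e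
  surj : ∀ a b, S.Adj a b → a ≠ b + 1 → ∃ d, ℓ d = a ∧ ℓ (A.map.σ d) = b
  cyc : ∀ d, ∃ i j k : ℤ, i < j ∧ j < k ∧ k < i + N ∧ ℓ d = i ∧ ℓ (A.map.σ d) = j ∧
    ℓ (A.map.σ (A.map.σ d)) = k
  adj : ∀ d, S.Adj (ℓ d) (ℓ (A.map.σ d))
  leaf : ∀ d, A.map.edgeOf d ∉ A.tree ↔ ℓ (A.map.σ d) = ℓ d + 1
  tree : ∀ d, A.map.edgeOf d ∈ A.tree → ℓ (A.map.α d) = ℓ (A.map.σ d)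
  matched : ∀ d, A.map.edgeOf d ∉ A.tree → ℓ (A.map.α d) = μ.μ (ℓ d)

namespace Labels

variable {A B : TreeRootedCubicMap m} {S S' : Triangulation N} {μ μ' : NCMatching N}
  {ℓ : A.Dart → ZMod N} {ℓ' : B.Dart → ZMod N}

theorem ne (h : Labels A S μ ℓ) (d : A.Dart) : ℓ d ≠ ℓ (A.map.σ d) + 1 := by
  obtain ⟨i, j, k, h1, h2, h3, h4, h5, -⟩ := h.cyc d
  rw [h4, h5]
  intro hc
  have := eq_of_intCast_eq (N := N) (a := i) (b := j + 1) (by push_cast; exact hc) (by omega)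
    (by omega)
  omega

theorem σ_α (h : Labels A S μ ℓ) {d : A.Dart} (hd : A.map.edgeOf d ∈ A.tree) :
    ℓ (A.map.σ (A.map.α d)) = ℓ d := by
  rw [← h.tree _ (by rwa [CombMap.edgeOf_α]), A.map.α_α]

/-- The third label is the apex of the triangle of `S` beyond the first two, so it depends on the
triangulation only. -/
theorem third (h : Labels A S μ ℓ) (h' : Labels B S μ ℓ') {d : A.Dart} {e : B.Dart}
    (h1 : ℓ d = ℓ' e) (h2 : ℓ (A.map.σ d) = ℓ' (B.map.σ e)) :
    ℓ (A.map.σ (A.map.σ d)) = ℓ' (B.map.σ (B.map.σ e)) := by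
  have := A.finite_dart
  have := B.finite_dart
  obtain ⟨i, j, k, a1, a2, a3, a4, a5, a6⟩ := h.cyc d
  obtain ⟨i', j', k', b1, b2, b3, b4, b5, b6⟩ := h'.cyc e
  obtain ⟨c, rfl, rfl⟩ := exists_shift (N := N) (i := i) (j := j) (i' := i') (j' := j')
    (by rw [← a4, ← b4, h1]) (by rw [← a5, ← b5, h2]) a1 (by omega) b1 (by omega)
  have e1 := h.adj (A.map.σ d)
  have e2 := h.adj (A.map.σ (A.map.σ d))
  have e3 := h'.adj (B.map.σ e)
  have e4 := h'.adj (B.map.σ (B.map.σ e))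
  rw [A.cubic.σ_σ_σ] at e2
  rw [B.cubic.σ_σ_σ] at e4
  have hk : k = k' + N * c := by
    refine S.apex_unique (j := j' + N * c) (l := i' + N * c + N) a2 a3 (by linarith) (by linarith)
      (by linarith) ?_ ?_ ?_ ?_
    · rwa [← a5, ← a6]
    · have : ((i' + N * c + N : ℤ) : ZMod N) = ℓ d := by rw [a4]; simp
      rwa [this, ← a6]
    · rwa [← a5, h2, intCast_add_mul, ← b6]
    · have : ((i' + N * c + N : ℤ) : ZMod N) = ℓ' e := by rw [b4]; simp
      rwa [this, intCast_add_mul, ← b6]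
  rw [a6, b6, hk, intCast_add_mul]

theorem exists_partner (h : Labels A S μ ℓ) (h' : Labels B S μ ℓ') (d : A.Dart) :
    ∃ e : B.Dart, ℓ' e = ℓ d ∧ ℓ' (B.map.σ e) = ℓ (A.map.σ d) :=
  h'.surj _ _ (h.adj d) (h.ne d)

/-- A dart is known from its label and that of its σ-successor, and the same label pairs occur in
both maps. The dart bijection so obtained respects σ by `third`; it respects α because a tree dart
is reversed by exchanging its two labels and a leaf is sent where `μ` prescribes. -/
theorem nonempty_iso (h : Labels A S μ ℓ) (h' : Labels B S μ ℓ') : Nonempty (A.Iso B) := by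
  choose f hf1 hf2 using h.exists_partner h'
  choose g hg1 hg2 using h'.exists_partner h
  refine ⟨⟨⟨f, g, fun d => ?_, fun e => ?_⟩, fun d => ?_, fun d => ?_, fun d => ?_⟩⟩
  · exact h.inj _ _ (by rw [hg1, hf1]) (by rw [hg2, hf2])
  · exact h'.inj _ _ (by rw [hf1, hg1]) (by rw [hf2, hg2])
  · refine h'.inj _ _ ?_ ?_
    · exact (hf1 _).trans (hf2 d).symm
    · exact (hf2 _).trans (h.third h' (hf1 d).symm (hf2 d).symm)
  · have ht : A.map.edgeOf d ∈ A.tree ↔ B.map.edgeOf (f d) ∈ B.tree := by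
      rw [← not_iff_not, h.leaf, h'.leaf, hf1, hf2]
    by_cases hd : A.map.edgeOf d ∈ A.tree
    · refine h'.inj _ _ ?_ ?_
      · exact (hf1 _).trans ((h.tree d hd).trans ((hf2 d).symm.trans (h'.tree _ (ht.1 hd)).symm))
      · exact (hf2 _).trans ((h.σ_α hd).trans ((hf1 d).symm.trans (h'.σ_α (ht.1 hd)).symm))
    · have hd' := mt ht.2 hd
      have e1 := h.matched d hd
      have e2 := h'.matched _ hd'
      have e3 := (h.leaf (A.map.α d)).1 (by rwa [CombMap.edgeOf_α])
      have e4 := (h'.leaf (B.map.α (f d))).1 (by rwa [CombMap.edgeOf_α])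
      have e5 : ℓ (A.map.α d) = ℓ' (B.map.α (f d)) := by rw [e1, e2, hf1]
      have e6 : ℓ (A.map.σ (A.map.α d)) = ℓ' (B.map.σ (B.map.α (f d))) := by rw [e3, e4, e5]
      exact h'.inj _ _ ((hf1 _).trans e5) ((hf2 _).trans e6)
  · change B.map.edgeOf (f d) ∈ B.tree ↔ _
    rw [← not_iff_not, h.leaf, h'.leaf, hf1, hf2]

theorem comp (h : Labels B S μ ℓ') (f : A.Iso B) : Labels A S μ (ℓ' ∘ f.toEquiv) where
  inj d e h1 h2 := f.toEquiv.injective (h.inj _ _ h1 (by simpa [f.map_σ] using h2))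
  surj a b hab hne := by
    obtain ⟨e, he⟩ := h.surj a b hab hne
    exact ⟨f.toEquiv.symm e, by simpa [f.map_σ] using he⟩
  cyc d := by simpa [f.map_σ] using h.cyc (f.toEquiv d)
  adj d := by simpa [f.map_σ] using h.adj (f.toEquiv d)
  leaf d := by simpa [f.map_σ, f.map_tree] using h.leaf (f.toEquiv d)
  tree d := by simpa [f.map_σ, f.map_α, f.map_tree] using h.tree (f.toEquiv d)
  matched d := by simpa [f.map_σ, f.map_α, f.map_tree] using h.matched (f.toEquiv d)

theorem tour (h : Labels A S μ ℓ) (d : A.Dart) :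
    ℓ (A.map.tour A.tree d) =
      open Classical in if A.map.edgeOf d ∈ A.tree then ℓ d else ℓ d + 1 := by
  split_ifs with hd
  · rw [CombMap.tour_of_mem hd, h.σ_α hd]
  · rw [CombMap.tour_of_not_mem hd, (h.leaf d).1 hd]

/-- Along the tour any labelling stays constant at tree darts and increases by one at leaves. Two
labellings of one map therefore differ by a constant on the single cycle of the tour. -/
theorem exists_vadd {ℓ'' : A.Dart → ZMod N} (hN : 3 ≤ N) (h : Labels A S μ ℓ)
    (h' : Labels A S' μ' ℓ'') : ∃ g : ZMod N, g +ᵥ S = S' ∧ g +ᵥ μ = μ' := by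
  have := A.finite_dart
  -- For N ≥ 3 a side in positive direction is not also a side in negative direction, so each side
  -- is carried by a dart.
  have hside : ∀ a : ZMod N, a ≠ a + 1 + 1 := by
    intro a ha
    have : ((2 : ℕ) : ZMod N) = 0 := by
      have : a + 2 = a := by rw [← one_add_one_eq_two, ← add_assoc, ← ha]
      simpa using this
    rw [ZMod.natCast_eq_zero_iff] at this
    exact absurd (Nat.le_of_dvd two_pos this) (by omega)
  obtain ⟨d₀, -⟩ := h.surj 0 1 (by simpa using S.side 0) (by simpa using hside 0)
  have hconst : ∀ d, ℓ'' d - ℓ d = ℓ'' d₀ - ℓ d₀ := by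
    intro d
    refine rel_of_sameCycle (f := A.map.tour A.tree)
      (r := fun x y => ℓ'' y - ℓ y = ℓ'' x - ℓ x)
      ⟨fun _ => rfl, fun h => h.symm, fun h h' => h'.trans h⟩ (fun z => ?_)
      (A.spanning.sameCycle_tour d₀ d)
    rw [h.tour, h'.tour]
    split_ifs
    · rfl
    · ring
  set g := ℓ'' d₀ - ℓ d₀ with hg
  have hconst' : ∀ d, ℓ'' d = ℓ d + g := fun d => by rw [← hconst d]; ring
  refine ⟨g, ?_, ?_⟩
  · ext a b
    rw [Triangulation.vadd_adj]
    by_cases hab : a = b + 1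
    · subst hab
      refine iff_of_true ?_ (S'.symm _ _ (S'.side b))
      have := S.symm _ _ (S.side (b - g))
      rwa [sub_add_eq_add_sub] at this
    · constructor
      · intro hS
        obtain ⟨d, h1, h2⟩ := h.surj _ _ hS (fun hc => hab (by
          rw [sub_add_eq_add_sub] at hc; exact sub_left_injective hc))
        have := h'.adj d
        rwa [hconst', hconst', h1, h2, sub_add_cancel, sub_add_cancel] at this
      · intro hS
        obtain ⟨d, rfl, rfl⟩ := h'.surj _ _ hS hab
        have := h.adj d
        rwa [hconst', hconst', add_sub_cancel_right, add_sub_cancel_right]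
  · ext a
    obtain ⟨d, h1, h2⟩ := h.surj (a - g) (a - g + 1) (S.side _) (hside _)
    have hd := (h.leaf d).2 (by rw [h1, h2])
    have e1 := h.matched d hd
    have e2 := h'.matched d hd
    rw [hconst', e1, hconst', h1, sub_add_cancel] at e2
    rw [NCMatching.vadd_μ, e2]

theorem vadd (h : Labels A S μ ℓ) (g : ZMod N) : Labels A (g +ᵥ S) (g +ᵥ μ) (fun d => ℓ d + g) where
  inj d e h1 h2 := h.inj d e (add_right_cancel h1) (add_right_cancel h2)
  surj a b hab hne := by
    obtain ⟨d, h1, h2⟩ := h.surj (a - g) (b - g) hab (fun hc => hne (by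
      rw [sub_add_eq_add_sub] at hc; exact sub_left_injective hc))
    exact ⟨d, by rw [h1, sub_add_cancel], by rw [h2, sub_add_cancel]⟩
  cyc d := by
    obtain ⟨g, rfl⟩ := ZMod.intCast_surjective g
    obtain ⟨i, j, k, h1, h2, h3, h4, h5, h6⟩ := h.cyc d
    exact ⟨i + g, j + g, k + g, by omega, by omega, by omega, by simp [h4], by simp [h5],
      by simp [h6]⟩
  adj d := by
    rw [Triangulation.vadd_adj, add_sub_cancel_right, add_sub_cancel_right]
    exact h.adj d
  leaf d := by
    rw [h.leaf, add_right_comm, add_left_inj]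
  tree d hd := by rw [h.tree d hd]
  matched d hd := by rw [NCMatching.vadd_μ, add_sub_cancel_right, h.matched d hd]

end Labels

/-- If all tree-rooted maps have labels and all pairs of a triangulation and a matching arise from
them, then tree-rooted maps up to isomorphism are such pairs up to rotation. -/
theorem numTreeRootedCubicMaps_eq (hN : 3 ≤ N)
    (h1 : ∀ A : TreeRootedCubicMap m, ∃ (S : Triangulation N) (μ : NCMatching N) (ℓ : _),
      Labels A S μ ℓ)
    (h2 : ∀ (S : Triangulation N) (μ : NCMatching N), ∃ (A : TreeRootedCubicMap m) (ℓ : _),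
      Labels A S μ ℓ) :
    numTreeRootedCubicMaps m =
      Nat.card (AddAction.orbitRel.Quotient (ZMod N) (Triangulation N × NCMatching N)) := by
  choose S μ ℓ hℓ using h1
  let s := TreeRootedCubicMap.isoSetoid m
  let F : Quotient s → AddAction.orbitRel.Quotient (ZMod N) (Triangulation N × NCMatching N) :=
    Quotient.lift (fun A => Quotient.mk _ (S A, μ A)) (by
      rintro A B ⟨f⟩
      obtain ⟨g, e1, e2⟩ := Labels.exists_vadd hN ((hℓ B).comp f) (hℓ A)
      exact Quotient.sound (AddAction.orbitRel_apply.2 ⟨g, Prod.ext e1 e2⟩))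
  refine Nat.card_congr (Equiv.ofBijective F ⟨?_, ?_⟩)
  · intro a b hab
    induction a using Quotient.inductionOn with | _ A
    induction b using Quotient.inductionOn with | _ B
    obtain ⟨g, hg⟩ := AddAction.orbitRel_apply.1 (Quotient.exact hab)
    have e := (hℓ B).vadd g
    have e1 : g +ᵥ S B = S A := congrArg Prod.fst hg
    have e2 : g +ᵥ μ B = μ A := congrArg Prod.snd hg
    rw [e1, e2] at e
    exact Quotient.sound ((hℓ A).nonempty_iso e)
  · intro q
    induction q using Quotient.inductionOn with | _ p
    obtain ⟨A, ℓ', hA⟩ := h2 p.1 p.2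
    obtain ⟨g, e1, e2⟩ := Labels.exists_vadd hN hA (hℓ A)
    exact ⟨Quotient.mk _ A, Quotient.sound (AddAction.orbitRel_apply.2 ⟨g, Prod.ext e1 e2⟩)⟩

/-! ### From a tree-rooted map to a triangulation and a matching -/

open Equiv Equiv.Perm

/-- There is a function on the integers with prescribed increments. -/
theorem exists_int_sum (f : ℤ → ℤ) :
    ∃ L : ℤ → ℤ, L 0 = 0 ∧ (∀ k, L (k + 1) = L k + f k) ∧
      ∀ n : ℕ, L n = ∑ i ∈ Finset.range n, f i := by
  refine ⟨fun k => match k with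
    | Int.ofNat n => ∑ i ∈ Finset.range n, f i
    | Int.negSucc n => -∑ i ∈ Finset.range (n + 1), f (Int.negSucc i), by rfl, ?_, fun n => by rfl⟩
  intro k
  rcases k with n | n
  · change ∑ i ∈ Finset.range (n + 1), f i = _
    rw [Finset.sum_range_succ]; rfl
  · rcases n with _ | n
    · change (0 : ℤ) = -∑ i ∈ Finset.range 1, f (Int.negSucc i) + f (Int.negSucc 0)
      simp
    · change -∑ i ∈ Finset.range (n + 1), f (Int.negSucc i) =
        -∑ i ∈ Finset.range (n + 1 + 1), f (Int.negSucc i) + f (Int.negSucc (n + 1))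
      rw [Finset.sum_range_succ _ (n + 1)]
      ring

theorem int_mul_add_of_add {f : ℤ → ℤ} {K N : ℤ} (h : ∀ k, f (k + K) = f k + N) (k c : ℤ) :
    f (k + K * c) = f k + N * c := by
  induction c using Int.induction_on with
  | zero => simp
  | succ c ih => rw [mul_add, mul_one, ← add_assoc, h, ih]; ring
  | pred c ih =>
    have := h (k + K * (-c - 1))
    rw [show k + K * (-(c : ℤ) - 1) + K = k + K * -c by ring, ih] at this
    linarith

/-- A counter of the visits of `Q` along the cyclic sequence `b, τ b, τ² b, …`. -/
theorem exists_counter {D : Type*} [Finite D] {τ : Perm D} (hτ : ∀ x y, SameCycle τ x y) (b : D)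
    (Q : Set D) : ∃ L : ℤ → ℤ, L 0 = 0 ∧ (∀ k, (τ ^ k) b ∈ Q → L (k + 1) = L k + 1) ∧
      (∀ k, (τ ^ k) b ∉ Q → L (k + 1) = L k) ∧
      ∀ k c, L (k + Nat.card D * c) = L k + Nat.card Q * c := by
  classical
  obtain ⟨L, h0, h1, h2⟩ := exists_int_sum fun k => if (τ ^ k) b ∈ Q then 1 else 0
  -- One period of the tour visits each element of `Q` exactly once.
  have hK : L (Nat.card D) = Nat.card Q := by
    let s : Finset ℕ := (Finset.range (Nat.card D)).filter fun x : ℕ => (τ ^ (x : ℤ)) b ∈ Q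
    have hs : Nat.card {x : ℕ // x ∈ s} = s.card := by simp
    rw [h2, Finset.sum_boole]
    change (s.card : ℤ) = _
    rw [← hs]
    congr 1
    refine Nat.card_congr (Equiv.ofBijective (fun x => ⟨(τ ^ (x.1 : ℤ)) b, ?_⟩) ⟨?_, ?_⟩)
    · have := x.2
      simp only [s, Finset.mem_filter] at this
      exact this.2
    · rintro ⟨x, hx⟩ ⟨y, hy⟩ hxy
      simp only [s, Finset.mem_filter, Finset.mem_range] at hx hy
      have := zpow_apply_inj (k := x) (l := y) hτ (Subtype.ext_iff.1 hxy) (by omega) (by omega)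
      simpa using this
    · rintro ⟨d, hd⟩
      obtain ⟨k, hk, hk', rfl⟩ := exists_zpow_apply_eq hτ b d 0
      obtain ⟨k, rfl⟩ := Int.eq_ofNat_of_zero_le hk
      refine ⟨⟨k, ?_⟩, rfl⟩
      simp only [s, Finset.mem_filter, Finset.mem_range]
      exact ⟨by omega, hd⟩
  have hper : ∀ k, L (k + Nat.card D) = L k + Nat.card Q := by
    intro k
    have hstep : ∀ k, L (k + 1 + Nat.card D) - L (k + 1) = L (k + Nat.card D) - L k := by
      intro k
      have e : (τ ^ (k + Nat.card D : ℤ)) b = (τ ^ k) b := by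
        rw [zpow_apply_eq_zpow_apply_iff hτ]
        exact ⟨-1, by ring⟩
      rw [add_right_comm, h1, h1, e]
      ring
    induction k using Int.induction_on with
    | zero => rw [zero_add, hK, h0, zero_add]
    | succ k ih => have := hstep k; linarith
    | pred k ih => have := hstep (-k - 1); rw [sub_add_cancel] at this; linarith
  refine ⟨L, h0, fun k hk => by rw [h1, if_pos hk], fun k hk => by rw [h1, if_neg hk, add_zero],
    fun k c => int_mul_add_of_add hper k c⟩

/-- The tour of a plane cubic tree with `N` leaves, the darts being listed by `e` periodically, and
the visits of leaves, i.e. darts off `T`, being counted by `L`. The next dart, in the tour, with the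
same origin as the dart in position `k` is in position `nxt k`. -/
structure TreeTour {D : Type*} (σ α : Perm D) (T : Set D) (e : ℤ → D) (L nxt : ℤ → ℤ) (K N : ℕ) :
    Prop where
  hN : 3 ≤ N
  K_eq : (K : ℤ) = 3 * N - 6
  e_surj : ∀ d, ∃ k, e k = d
  e_eq : ∀ {k l}, e k = e l ↔ ∃ c, k = l + K * c
  e_tree : ∀ {k}, e k ∈ T → e (k + 1) = σ (α (e k))
  e_leaf : ∀ {k}, e k ∉ T → e (k + 1) = σ (e k)
  stable : ∀ d, α d ∈ T ↔ d ∈ T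
  α_α : ∀ d, α (α d) = d
  σ_σ_σ : ∀ d, σ (σ (σ d)) = d
  σ_ne : ∀ d, σ d ≠ d
  σ_σ_ne : ∀ d, σ (σ d) ≠ d
  nc : ∀ {i j k l : ℤ}, i < j → j < k → k < l → l < i + K → e i ∈ T → e j ∈ T →
    e k = α (e i) → e l = α (e j) → False
  L_tree : ∀ {k}, e k ∈ T → L (k + 1) = L k
  L_leaf : ∀ {k}, e k ∉ T → L (k + 1) = L k + 1
  L_add : ∀ k c, L (k + K * c) = L k + N * c
  nxt_leaf : ∀ {k}, e k ∉ T → nxt k = k + 1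
  nxt_tree : ∀ {k}, e k ∈ T → k < nxt k - 1 ∧ nxt k - 1 < k + K ∧ e (nxt k - 1) = α (e k)

namespace TreeTour

variable {D : Type*} {σ α : Perm D} {T : Set D} {e : ℤ → D} {L nxt : ℤ → ℤ} {K N : ℕ}

theorem e_inj (t : TreeTour σ α T e L nxt K N) {k l : ℤ} (h : e k = e l)
    (h1 : k < l + K) (h2 : l < k + K) : k = l := by
  obtain ⟨c, rfl⟩ := t.e_eq.1 h
  have hK : (0 : ℤ) < K := by omega
  have : c < 1 := by by_contra hc; nlinarith
  have : -1 < c := by by_contra hc; nlinarith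
  obtain rfl : c = 0 := by omega
  simp

theorem e_add (t : TreeTour σ α T e L nxt K N) (k c : ℤ) : e (k + K * c) = e k := t.e_eq.2 ⟨c, rfl⟩

theorem K_pos (t : TreeTour σ α T e L nxt K N) : (0 : ℤ) < K := by
  have := t.K_eq
  have := t.hN
  omega

theorem lt_nxt (t : TreeTour σ α T e L nxt K N) (k : ℤ) : k < nxt k := by
  by_cases h : e k ∈ T
  · have := t.nxt_tree h; omega
  · have := t.nxt_leaf h; omega

theorem e_nxt (t : TreeTour σ α T e L nxt K N) (k : ℤ) : e (nxt k) = σ (e k) := by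
  by_cases h : e k ∈ T
  · obtain ⟨-, -, h3⟩ := t.nxt_tree h
    have := t.e_tree (k := nxt k - 1) (by rw [h3, t.stable]; exact h)
    rwa [sub_add_cancel, h3, t.α_α] at this
  · rw [t.nxt_leaf h, t.e_leaf h]

theorem L_mono (t : TreeTour σ α T e L nxt K N) {k l : ℤ} (h : k ≤ l) : L k ≤ L l := by
  obtain ⟨m, rfl⟩ : ∃ m : ℕ, l = k + m := ⟨(l - k).toNat, by omega⟩
  clear h
  induction m with
  | zero => simp
  | succ m ih =>
    push_cast
    rw [← add_assoc]
    by_cases hm : e (k + m) ∈ T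
    · rw [t.L_tree hm]; exact ih
    · rw [t.L_leaf hm]; omega

theorem lt_of_L_lt (t : TreeTour σ α T e L nxt K N) {k l : ℤ} (h : L k < L l) : k < l := by
  by_contra hc
  exact absurd (t.L_mono (not_lt.1 hc)) (by omega)

theorem L_add_one_le (t : TreeTour σ α T e L nxt K N) {k l : ℤ} (h : k < l)
    (hk : e k ∉ T) : L k + 1 ≤ L l := by
  rw [← t.L_leaf hk]
  exact t.L_mono (by omega)

theorem nxt_add (t : TreeTour σ α T e L nxt K N) (k c : ℤ) : nxt (k + K * c) = nxt k + K * c := by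
  by_cases h : e k ∈ T
  · have h' : e (k + K * c) ∈ T := by rwa [t.e_add]
    obtain ⟨a1, a2, a3⟩ := t.nxt_tree h
    obtain ⟨b1, b2, b3⟩ := t.nxt_tree h'
    rw [t.e_add, ← a3, ← t.e_add (nxt k - 1) c] at b3
    have := t.e_inj b3 (by linarith) (by linarith)
    linarith
  · have h' : e (k + K * c) ∉ T := by rwa [t.e_add]
    rw [t.nxt_leaf h, t.nxt_leaf h']
    ring

/-- Inside the tour of the subtree beyond the tree dart in position `k`. -/
theorem nested (t : TreeTour σ α T e L nxt K N) {k v : ℤ} (hk : e k ∈ T)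
    (h1 : k < v) (h2 : v < nxt k - 1) :
    nxt v ≤ nxt k - 1 ∨ ∃ w, k < w ∧ w < v ∧ e w = α (e v) ∧ nxt v = w + K + 1 := by
  obtain ⟨a1, a2, a3⟩ := t.nxt_tree hk
  by_cases hv : e v ∈ T
  · obtain ⟨b1, b2, b3⟩ := t.nxt_tree hv
    have hne : nxt v ≠ nxt k := fun he => by
      rw [he, a3] at b3
      have := t.e_inj (α.injective b3) (by omega) (by omega)
      omega
    rcases lt_or_gt_of_ne hne with h | h
    · left; omega
    -- The mate of position v lies beyond that of k. Within the period after k this is a crossing;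
    -- otherwise the mate, moved back by one period, lies between k and v.
    · rcases lt_trichotomy (nxt v - 1) (k + K) with h' | h' | h'
      · exact (t.nc h1 h2 (by omega) h' hk hv a3 b3).elim
      · rw [h'] at b3
        have := t.e_add k 1
        rw [mul_one, b3] at this
        rw [← this, t.α_α] at a3
        have := t.e_inj a3 (by omega) (by omega)
        omega
      · right
        refine ⟨nxt v - 1 - K, by omega, by omega, ?_, by omega⟩
        have := t.e_add (nxt v - 1 - K) 1
        rw [mul_one, sub_add_cancel] at this
        rw [← this, b3]
  · left
    rw [t.nxt_leaf hv]
    omega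

/-- The tour of the subtree beyond a tree dart consists of the tours of the two branches at the far
vertex, one after the other, followed by the reversed dart in position `nxt k - 1`. -/
theorem split (t : TreeTour σ α T e L nxt K N) {k : ℤ} (hk : e k ∈ T) :
    nxt (k + 1) < nxt k - 1 ∧ nxt (nxt (k + 1)) = nxt k - 1 := by
  obtain ⟨a1, a2, a3⟩ := t.nxt_tree hk
  have e1 : e (k + 1) = σ (α (e k)) := t.e_tree hk
  have e2 : e (nxt (k + 1)) = σ (σ (α (e k))) := by rw [t.e_nxt, e1]
  have e3 : e (nxt (nxt (k + 1))) = α (e k) := by rw [t.e_nxt, e2, t.σ_σ_σ]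
  have h1 : k + 1 < nxt k - 1 := by
    refine lt_of_le_of_ne (by omega) fun he => ?_
    rw [← he, e1] at a3
    exact t.σ_ne _ a3
  have h2 : nxt (k + 1) ≤ nxt k - 1 := by
    rcases t.nested hk (lt_add_one k) h1 with h | ⟨w, hw1, hw2, -⟩
    · exact h
    · omega
  have h3 : nxt (k + 1) < nxt k - 1 := by
    refine lt_of_le_of_ne h2 fun he => ?_
    rw [he, a3] at e2
    exact t.σ_σ_ne _ e2.symm
  refine ⟨h3, ?_⟩
  have h4 := t.lt_nxt (k + 1)
  have h5 := t.lt_nxt (nxt (k + 1))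
  rcases t.nested hk (by omega) h3 with h | ⟨w, hw1, hw2, hw3, hw4⟩
  · exact t.e_inj (e3.trans a3.symm) (by omega) (by omega)
  -- The third dart at the far vertex could be a full period late only if the second one had its
  -- mate before it. That mate would cross the pair of `k + 1`, or coincide with one of its two
  -- ends, or start as a leaf with too long a step.
  · exfalso
    by_cases hk1 : e (k + 1) ∈ T
    · obtain ⟨b1, b2, b3⟩ := t.nxt_tree hk1
      rcases lt_trichotomy w (nxt (k + 1) - 1) with h | h | h
      · rcases lt_or_eq_of_le (show k + 1 ≤ w by omega) with h' | h'
        · have hw : e w ∈ T := by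
            by_contra hc
            have hc' : e (nxt (k + 1)) ∉ T := by rwa [← t.stable, ← hw3]
            rw [t.nxt_leaf hc'] at hw4
            omega
          exact t.nc (l := nxt (k + 1)) h' h (by omega) (by omega) hk1 hw b3 (by rw [hw3, t.α_α])
        · rw [← h', ← t.α_α (e (k + 1)), ← b3] at hw3
          have := t.e_inj (α.injective hw3) (by omega) (by omega)
          omega
      · rw [h, b3] at hw3
        have := t.e_inj (α.injective hw3) (by omega) (by omega)
        omega
      · omega
    · have := t.nxt_leaf hk1
      obtain rfl : w = k + 1 := by omega
      have hc' : e (nxt (k + 1)) ∉ T := by rwa [← t.stable, ← hw3]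
      rw [t.nxt_leaf hc'] at hw4
      have := t.K_pos
      omega

theorem L_nxt_sub_one (t : TreeTour σ α T e L nxt K N) {k : ℤ} (hk : e k ∈ T) :
    L (nxt k - 1) = L (nxt k) := by
  have := t.L_tree (k := nxt k - 1) (by rwa [(t.nxt_tree hk).2.2, t.stable])
  rw [sub_add_cancel] at this
  exact this.symm

/-- A subtree with l leaves takes 3l - 2 steps of the tour: one step for a leaf, and for two
branches 1 + (3a - 2) + (3b - 2) + 1 = 3(a + b) - 2. -/
theorem nxt_sub (t : TreeTour σ α T e L nxt K N) (k : ℤ) :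
    nxt k - k = 3 * (L (nxt k) - L k) - 2 := by
  obtain ⟨m, hm⟩ : ∃ m : ℕ, nxt k - k = m := ⟨(nxt k - k).toNat, by have := t.lt_nxt k; omega⟩
  induction m using Nat.strong_induction_on generalizing k with
  | _ m ih =>
    by_cases hk : e k ∈ T
    · obtain ⟨h1, h2⟩ := t.split hk
      have h3 := t.lt_nxt (k + 1)
      have h4 := ih (nxt (k + 1) - (k + 1)).toNat (by omega) (k + 1) (by omega)
      have h5 := ih (nxt (nxt (k + 1)) - (nxt (k + 1))).toNat (by omega) (nxt (k + 1)) (by omega)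
      have h6 := t.L_nxt_sub_one hk
      have h7 := t.L_tree hk
      rw [h2] at h5
      omega
    · rw [t.nxt_leaf hk, t.L_leaf hk]
      omega

theorem L_lt_nxt (t : TreeTour σ α T e L nxt K N) (k : ℤ) : L k < L (nxt k) := by
  have := t.nxt_sub k
  have := t.lt_nxt k
  omega

/-- Going around a vertex returns to the same dart after some number c of periods. Summing the three
step lengths gives Kc = 3Nc - 6, and K = 3N - 6 forces c = 1. -/
theorem nxt_nxt_nxt (t : TreeTour σ α T e L nxt K N) (k : ℤ) : nxt (nxt (nxt k)) = k + K := by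
  have h : e (nxt (nxt (nxt k))) = e k := by rw [t.e_nxt, t.e_nxt, t.e_nxt, t.σ_σ_σ]
  obtain ⟨c, hc⟩ := t.e_eq.1 h
  have h1 := t.nxt_sub k
  have h2 := t.nxt_sub (nxt k)
  have h3 := t.nxt_sub (nxt (nxt k))
  have h4 := t.L_add k c
  have h5 : (K : ℤ) * c = 3 * (N * c) - 6 * c := by rw [t.K_eq]; ring
  rw [← hc] at h4
  obtain rfl : c = 1 := by linarith
  rw [hc, mul_one]

theorem L_nxt_nxt_lt (t : TreeTour σ α T e L nxt K N) (k : ℤ) : L (nxt (nxt k)) < L k + N := by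
  have := t.L_lt_nxt (nxt (nxt k))
  rw [t.nxt_nxt_nxt] at this
  have h := t.L_add k 1
  rw [mul_one, mul_one] at h
  omega

theorem L_tree_nxt (t : TreeTour σ α T e L nxt K N) {k : ℤ} (hk : e k ∈ T) :
    L k + 2 ≤ L (nxt k) := by
  obtain ⟨h1, h2⟩ := t.split hk
  have h3 := t.L_lt_nxt (k + 1)
  have h4 := t.L_lt_nxt (nxt (k + 1))
  have h5 := t.L_nxt_sub_one hk
  have h6 := t.L_tree hk
  rw [h2] at h4
  omega

/-- A subtree is determined by its interval of leaves. With equal intervals the two tours have equal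
length by `nxt_sub`, so one cannot be properly nested in the other; the alternative in `nested`
would count a whole turn of leaves. -/
theorem eq_of_L_eq (t : TreeTour σ α T e L nxt K N) {k k' : ℤ} (h : L k = L k')
    (h' : L (nxt k) = L (nxt k')) : k = k' := by
  suffices H : ∀ {k k'}, L k = L k' → L (nxt k) = L (nxt k') → ¬ k < k' by
    exact le_antisymm (not_lt.1 (H h.symm h'.symm)) (not_lt.1 (H h h'))
  intro k k' h h' hlt
  have hk : e k ∈ T := by
    by_contra hc
    have := t.L_add_one_le hlt hc
    omega
  have h1 := t.nxt_sub k
  have h2 := t.nxt_sub k'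
  have h3 := t.L_nxt_sub_one hk
  have h4 := t.L_lt_nxt k
  have h5 : k' < nxt k - 1 := t.lt_of_L_lt (by omega)
  rcases t.nested hk hlt h5 with h6 | ⟨w, hw1, hw2, hw3, hw4⟩
  · omega
  · have h7 := t.L_mono (show k + K * 1 ≤ nxt k' by omega)
    have h8 := t.L_nxt_nxt_lt k
    have h9 := t.L_lt_nxt (nxt k)
    rw [t.L_add] at h7
    omega

/-- The counter is unbounded in both directions and increases by steps of one, only at leaves; the
last position with value at most i does it. -/
theorem exists_leaf (t : TreeTour σ α T e L nxt K N) (i : ℤ) : ∃ k, e k ∉ T ∧ L k = i := by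
  have hN := t.hN
  have h1 : L (0 + K * (i - L 0 + 1)) = L 0 + N * (i - L 0 + 1) := t.L_add _ _
  have h2 : L (0 + K * (i - L 0 - 1)) = L 0 + N * (i - L 0 - 1) := t.L_add _ _
  have hup : ∃ u, i < L u := by
    by_cases h : 0 ≤ i - L 0
    · exact ⟨_, by rw [h1]; nlinarith⟩
    · exact ⟨0, by omega⟩
  have hlow : ∃ u, L u ≤ i := by
    by_cases h : 0 ≤ i - L 0
    · exact ⟨0, by omega⟩
    · exact ⟨_, by rw [h2]; nlinarith⟩
  obtain ⟨u, hu⟩ := hup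
  obtain ⟨k, hk, hmax⟩ := Int.exists_greatest_of_bdd (P := fun k => L k ≤ i)
    ⟨u, fun z hz => (t.lt_of_L_lt (by omega)).le⟩ hlow
  have hk1 : i < L (k + 1) := by
    by_contra hc
    have := hmax (k + 1) (not_lt.1 hc)
    omega
  have hkT : e k ∉ T := fun hc => by
    rw [t.L_tree hc] at hk1
    omega
  refine ⟨k, hkT, ?_⟩
  rw [t.L_leaf hkT] at hk1
  omega

theorem one_ne_zero' (t : TreeTour σ α T e L nxt K N) : (1 : ZMod N) ≠ 0 := by
  intro h
  have hN := t.hN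
  have := eq_of_intCast_eq (N := N) (a := 1) (b := 0) (by exact_mod_cast h) (by omega) (by omega)
  omega

variable {ℓ : D → ZMod N}

/-- The labels are residues; any integer lift of the two labels of a dart within one turn is
realized by counter values at one and the same position. -/
theorem exists_position (t : TreeTour σ α T e L nxt K N)
    (hℓ : ∀ k, ℓ (e k) = L k) {d : D} {i j : ℤ} (hi : ℓ d = i) (hj : ℓ (σ d) = j) (h1 : i < j)
    (h2 : j < i + N) : ∃ k, e k = d ∧ L k = i ∧ L (nxt k) = j := by
  obtain ⟨k, rfl⟩ := t.e_surj d
  rw [← t.e_nxt] at hj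
  have h3 := t.L_lt_nxt k
  have h4 := t.L_nxt_nxt_lt k
  have h5 := t.L_lt_nxt (nxt k)
  obtain ⟨c, rfl, rfl⟩ := exists_shift (N := N) (hi.symm.trans (hℓ _)) (hj.symm.trans (hℓ _))
    h1 h2 h3 (by omega)
  exact ⟨k + K * c, t.e_add _ _, t.L_add _ _, by rw [t.nxt_add, t.L_add]⟩

theorem label_inj (t : TreeTour σ α T e L nxt K N)
    (hℓ : ∀ k, ℓ (e k) = L k) {d d' : D} (h : ℓ d = ℓ d') (h' : ℓ (σ d) = ℓ (σ d')) : d = d' := by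
  obtain ⟨k, rfl⟩ := t.e_surj d
  have h1 := t.L_nxt_nxt_lt k
  have h2 := t.L_lt_nxt (nxt k)
  obtain ⟨k', rfl, h3, h4⟩ := t.exists_position hℓ (h.symm.trans (hℓ k))
    (h'.symm.trans (by rw [← t.e_nxt, hℓ])) (t.L_lt_nxt k) (by omega)
  rw [t.eq_of_L_eq h3 h4]

/-- A leaf advances the counter by one, whereas the subtree beyond a tree dart has at least two
leaves. -/
theorem label_leaf (t : TreeTour σ α T e L nxt K N)
    (hℓ : ∀ k, ℓ (e k) = L k) {d : D} : d ∉ T ↔ ℓ (σ d) = ℓ d + 1 := by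
  obtain ⟨k, rfl⟩ := t.e_surj d
  constructor
  · intro h
    rw [← t.e_leaf h, hℓ, hℓ, t.L_leaf h, Int.cast_add, Int.cast_one]
  · intro h hk
    have h1 := t.L_nxt_nxt_lt k
    have h2 := t.L_lt_nxt (nxt k)
    have h3 := t.L_tree_nxt hk
    rw [← t.e_nxt, hℓ, hℓ, ← Int.cast_one, ← Int.cast_add] at h
    have := eq_of_intCast_eq h (by omega) (by omega)
    omega

theorem label_α (t : TreeTour σ α T e L nxt K N)
    (hℓ : ∀ k, ℓ (e k) = L k) {d : D} (h : d ∈ T) : ℓ (α d) = ℓ (σ d) := by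
  obtain ⟨k, rfl⟩ := t.e_surj d
  rw [← (t.nxt_tree h).2.2, ← t.e_nxt, hℓ, hℓ, t.L_nxt_sub_one h]

theorem label_σ_α (t : TreeTour σ α T e L nxt K N)
    (hℓ : ∀ k, ℓ (e k) = L k) {d : D} (h : d ∈ T) : ℓ (σ (α d)) = ℓ d := by
  rw [← t.label_α hℓ ((t.stable d).2 h), t.α_α]

theorem exists_leaf_label (t : TreeTour σ α T e L nxt K N)
    (hℓ : ∀ k, ℓ (e k) = L k) (a : ZMod N) : ∃ d, d ∉ T ∧ ℓ d = a := by
  obtain ⟨i, rfl⟩ := ZMod.intCast_surjective a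
  obtain ⟨k, hk, rfl⟩ := t.exists_leaf i
  exact ⟨e k, hk, hℓ k⟩

end TreeTour

open Equiv Equiv.Perm

namespace TreeTour

variable {D : Type*} {σ α : Perm D} {T : Set D} {e : ℤ → D} {L nxt : ℤ → ℤ} {K N : ℕ}
  {ℓ : D → ZMod N}

/-- The triangulation dual to the tree. -/
def triangulation (t : TreeTour σ α T e L nxt K N) (hℓ : ∀ k, ℓ (e k) = L k) :
    Triangulation N where
  Adj a b := (∃ d, ℓ d = a ∧ ℓ (σ d) = b) ∨ a = b + 1
  irrefl := by
    rintro a (⟨d, h1, h2⟩ | h)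
    · obtain ⟨k, rfl⟩ := t.e_surj d
      have h3 := t.L_lt_nxt k
      have h4 := t.L_nxt_nxt_lt k
      have h5 := t.L_lt_nxt (nxt k)
      rw [← t.e_nxt, hℓ, ← h1, hℓ] at h2
      have := eq_of_intCast_eq h2 (by omega) (by omega)
      omega
    · exact t.one_ne_zero' (by simpa using h)
  symm := by
    rintro a b (⟨d, rfl, rfl⟩ | rfl)
    · by_cases hd : d ∈ T
      · exact Or.inl ⟨α d, t.label_α hℓ hd, t.label_σ_α hℓ hd⟩
      · exact Or.inr ((t.label_leaf hℓ).1 hd)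
    · obtain ⟨d, hd, rfl⟩ := t.exists_leaf_label hℓ b
      exact Or.inl ⟨d, rfl, (t.label_leaf hℓ).1 hd⟩
  side a := by
    obtain ⟨d, hd, rfl⟩ := t.exists_leaf_label hℓ a
    exact Or.inl ⟨d, rfl, (t.label_leaf hℓ).1 hd⟩
  noncross := by
    rintro i x j y h1 h2 h3 h4 (⟨d, hd1, hd2⟩ | h) (⟨f, hf1, hf2⟩ | h')
    · obtain ⟨k, rfl, rfl, rfl⟩ := t.exists_position hℓ hd1 hd2 (by omega) (by omega)
      obtain ⟨v, rfl, rfl, rfl⟩ := t.exists_position hℓ hf1 hf2 (by omega) (by omega)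
      have hkv := t.lt_of_L_lt h1
      have hvk := t.lt_of_L_lt h2
      have hk : e k ∈ T := by
        by_contra hc
        rw [t.nxt_leaf hc] at hvk
        omega
      rw [← t.L_nxt_sub_one hk] at h2 h3
      -- Two crossing diagonals would be two subtrees whose leaf intervals overlap without being
      -- nested or complementary.
      rcases t.nested hk hkv (t.lt_of_L_lt h2) with h5 | ⟨w, hw1, hw2, hw3, hw4⟩
      · have := t.L_mono h5
        omega
      · have h7 := t.L_mono (show k + K * 1 ≤ nxt v by omega)
        rw [t.L_add] at h7
        omega
    · have := eq_of_intCast_eq (N := N) (a := x + N) (b := y + 1)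
        (by push_cast; rw [h']; simp) (by omega) (by omega)
      omega
    all_goals
      have := eq_of_intCast_eq (N := N) (a := i + N) (b := j + 1)
        (by push_cast; rw [h]; simp) (by omega) (by omega)
      omega
  apex := by
    -- The darts in positions q, `nxt q`, `nxt (nxt q)` at one vertex give the triangle with the
    -- three corresponding counter values as corners.
    have key : ∀ q, ∃ m : ℤ, L q < m ∧ m < L (nxt (nxt q)) ∧
        ((∃ d, ℓ d = (L q : ZMod N) ∧ ℓ (σ d) = (m : ZMod N)) ∨ (L q : ZMod N) = (m : ZMod N) + 1) ∧
        ((∃ d, ℓ d = (m : ZMod N) ∧ ℓ (σ d) = (L (nxt (nxt q)) : ZMod N)) ∨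
          (m : ZMod N) = (L (nxt (nxt q)) : ZMod N) + 1) := fun q =>
      ⟨L (nxt q), t.L_lt_nxt q, t.L_lt_nxt _, Or.inl ⟨e q, hℓ _, by rw [← t.e_nxt, hℓ]⟩,
        Or.inl ⟨e (nxt q), hℓ _, by rw [← t.e_nxt, hℓ]⟩⟩
    rintro i j h1 h2 (⟨d, hd1, hd2⟩ | h)
    · obtain ⟨k, rfl, rfl, rfl⟩ := t.exists_position hℓ hd1 hd2 (by omega) (by omega)
      have hk : e k ∈ T := by
        by_contra hc
        rw [t.nxt_leaf hc, t.L_leaf hc] at h1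
        omega
      have := key (k + 1)
      rwa [(t.split hk).2, t.L_nxt_sub_one hk, t.L_tree hk] at this
    · have h3 := eq_of_intCast_eq (N := N) (a := i + N) (b := j + 1)
        (by push_cast; rw [h]; simp) (by omega) (by omega)
      -- A side in negative direction: j = i + N - 1, so the triangle wanted is the one at the
      -- vertex of the leaf numbered i - 1, read from its next dart on.
      obtain ⟨k, hk, hki⟩ := t.exists_leaf (i - 1)
      have := key (nxt k)
      have h4 := t.L_add k 1
      rw [mul_one, mul_one, hki] at h4
      rw [t.nxt_nxt_nxt, t.nxt_leaf hk, t.L_leaf hk, h4, hki, sub_add_cancel] at this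
      rwa [show i - 1 + (N : ℤ) = j by omega] at this

theorem leaf_eq (t : TreeTour σ α T e L nxt K N) (hℓ : ∀ k, ℓ (e k) = L k) {d f : D} (hd : d ∉ T)
    (hf : f ∉ T) (h : ℓ d = ℓ f) : d = f :=
  t.label_inj hℓ h (by rw [(t.label_leaf hℓ).1 hd, (t.label_leaf hℓ).1 hf, h])

/-- The matching of the leaves. -/
noncomputable def matching (t : TreeTour σ α T e L nxt K N) (hℓ : ∀ k, ℓ (e k) = L k)
    (hα : ∀ d, α d ≠ d)
    (nc : ∀ {i j k l : ℤ}, i < j → j < k → k < l → l < i + K → e i ∉ T → e j ∉ T →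
      e k = α (e i) → e l = α (e j) → False) : NCMatching N where
  μ a := ℓ (α (t.exists_leaf_label hℓ a).choose)
  μ_μ a := by
    obtain ⟨h1, h2⟩ := (t.exists_leaf_label hℓ a).choose_spec
    set d := (t.exists_leaf_label hℓ a).choose
    obtain ⟨h3, h4⟩ := (t.exists_leaf_label hℓ (ℓ (α d))).choose_spec
    rw [t.leaf_eq hℓ h3 (by rwa [t.stable]) h4, t.α_α, h2]
  μ_ne a h := by
    obtain ⟨h1, h2⟩ := (t.exists_leaf_label hℓ a).choose_spec
    exact hα _ (t.leaf_eq hℓ (by rwa [t.stable]) h1 (h.trans h2.symm))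
  noncross i x j y h1 h2 h3 h4 h5 h6 := by
    obtain ⟨a, ha, rfl⟩ := t.exists_leaf i
    obtain ⟨b, hb, rfl⟩ := t.exists_leaf x
    obtain ⟨c, hc, rfl⟩ := t.exists_leaf j
    obtain ⟨d, hd, rfl⟩ := t.exists_leaf y
    obtain ⟨p1, p2⟩ := (t.exists_leaf_label hℓ (L a)).choose_spec
    obtain ⟨q1, q2⟩ := (t.exists_leaf_label hℓ (L b)).choose_spec
    rw [t.leaf_eq hℓ p1 ha (p2.trans (hℓ a).symm)] at h5
    rw [t.leaf_eq hℓ q1 hb (q2.trans (hℓ b).symm)] at h6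
    have h7 := t.L_add a 1
    rw [mul_one, mul_one] at h7
    refine nc (t.lt_of_L_lt h1) (t.lt_of_L_lt h2) (t.lt_of_L_lt h3)
      (t.lt_of_L_lt (by rw [h7]; exact h4)) ha hb ?_ ?_
    · exact t.leaf_eq hℓ hc (by rwa [t.stable]) ((hℓ c).trans h5.symm)
    · exact t.leaf_eq hℓ hd (by rwa [t.stable]) ((hℓ d).trans h6.symm)

theorem matching_μ (t : TreeTour σ α T e L nxt K N) (hℓ : ∀ k, ℓ (e k) = L k)
    (hα : ∀ d, α d ≠ d)
    (nc : ∀ {i j k l : ℤ}, i < j → j < k → k < l → l < i + K → e i ∉ T → e j ∉ T →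
      e k = α (e i) → e l = α (e j) → False) {d : D} (hd : d ∉ T) :
    (t.matching hℓ hα nc).μ (ℓ d) = ℓ (α d) := by
  obtain ⟨h1, h2⟩ := (t.exists_leaf_label hℓ (ℓ d)).choose_spec
  change ℓ (α _) = _
  rw [t.leaf_eq hℓ h1 hd h2]

end TreeTour

/-- The map has 6n darts, of which 4n - 2 are on the tree, leaving 2n + 2 leaves. A dart is labelled
by the value of the leaf counter at its position on the tour; tree pairs and other pairs are
noncrossing along the tour. -/
theorem exists_labels {n : ℕ} (hn : 1 ≤ n) (A : TreeRootedCubicMap (2 * n)) :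
    ∃ (S : Triangulation (2 * n + 2)) (μ : NCMatching (2 * n + 2)) (ℓ : _), Labels A S μ ℓ := by
  have := A.finite_dart
  have hcard := A.cubic.card_eq
  rw [A.card_vertex] at hcard
  have hne : Nonempty A.Dart := by
    by_contra hc
    rw [not_nonempty_iff] at hc
    rw [Nat.card_of_isEmpty] at hcard
    omega
  obtain ⟨b⟩ := hne
  have hne : Nonempty A.Dart := ⟨b⟩
  have h1 := A.spanning.card_dartsOf
  have h2 := CombMap.card_dartsOf_add_compl A.tree
  rw [A.card_vertex] at h1
  have hτ := A.spanning.sameCycle_tour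
  obtain ⟨L, -, hL1, hL2, hL3⟩ := exists_counter hτ b (A.map.dartsOf A.tree)ᶜ
  rw [show Nat.card ↥(A.map.dartsOf A.tree)ᶜ = 2 * n + 2 by omega] at hL3
  -- The position m is one past the mate of k: from the reversed dart the tour proceeds to the
  -- σ-successor of the dart at k.
  have hnxt : ∀ k : ℤ, ∃ m : ℤ, k < m - 1 ∧ m - 1 < k + Nat.card A.Dart ∧
      (A.map.tour A.tree ^ (m - 1)) b = A.map.α ((A.map.tour A.tree ^ k) b) := by
    intro k
    obtain ⟨j, hj⟩ := exists_zpow_apply_eq_of_ne hτ (A.map.α_ne ((A.map.tour A.tree ^ k) b))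
    exact ⟨j + 1, by simpa using hj⟩
  choose nx hnx using hnxt
  classical
  have t : TreeTour A.map.σ A.map.α (A.map.dartsOf A.tree) (fun k => (A.map.tour A.tree ^ k) b) L
      (fun k => if (A.map.tour A.tree ^ k) b ∈ A.map.dartsOf A.tree then nx k else k + 1)
      (Nat.card A.Dart) (2 * n + 2) :=
    { hN := by omega
      K_eq := by rw [hcard]; push_cast; ring
      e_surj := fun d => by
        obtain ⟨k, -, -, hk⟩ := exists_zpow_apply_eq hτ b d 0
        exact ⟨k, hk⟩
      e_eq := fun {k l} => by
        rw [zpow_apply_eq_zpow_apply_iff hτ]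
        constructor
        · rintro ⟨c, hc⟩
          exact ⟨-c, by linarith⟩
        · rintro ⟨c, hc⟩
          exact ⟨-c, by linarith⟩
      e_tree := fun {k} hk => by rw [zpow_add_one_apply, CombMap.tour_of_mem (T := A.tree) hk]
      e_leaf := fun {k} hk => by rw [zpow_add_one_apply, CombMap.tour_of_not_mem (T := A.tree) hk]
      stable := A.map.dartsOf_stable A.tree
      α_α := A.map.α_α
      σ_σ_σ := A.cubic.σ_σ_σ
      σ_ne := A.cubic.σ_ne
      σ_σ_ne := A.cubic.σ_σ_ne
      nc := fun {i j k l} a1 a2 a3 a4 a5 a6 a7 a8 =>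
        A.spanning.nonCrossing b i j k l a1 a2 a3 a4 a5 a6 a7 a8
      L_tree := fun {k} hk => hL2 k (fun hc => hc hk)
      L_leaf := fun {k} hk => hL1 k hk
      L_add := hL3
      nxt_leaf := fun {k} hk => if_neg hk
      nxt_tree := fun {k} hk => by
        rw [if_pos hk]
        exact hnx k }
  choose pos hpos using t.e_surj
  -- Positions of the same dart differ by whole periods, which change the counter by multiples of 2n
  -- + 2.
  obtain ⟨ℓ, hℓ⟩ : ∃ ℓ : A.Dart → ZMod (2 * n + 2),
      ∀ k : ℤ, ℓ ((A.map.tour A.tree ^ k) b) = L k := by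
    refine ⟨fun d => L (pos d), fun k => ?_⟩
    obtain ⟨c, hc⟩ := t.e_eq.1 (hpos ((A.map.tour A.tree ^ k) b))
    simp only
    rw [hc, t.L_add, intCast_add_mul]
  have nc := fun {i j k l : ℤ} => A.spanning.nonCrossing_compl A.planar b i j k l
  refine ⟨t.triangulation hℓ, t.matching hℓ A.map.α_ne nc, ℓ, ?_⟩
  exact
    { inj := fun d e => t.label_inj hℓ
      surj := fun a c hac hne => hac.resolve_right hne
      cyc := fun d => by
        obtain ⟨k, rfl⟩ := t.e_surj d
        refine ⟨_, _, _, t.L_lt_nxt k, t.L_lt_nxt _, t.L_nxt_nxt_lt k, hℓ k, ?_, ?_⟩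
        · rw [← hℓ, t.e_nxt]
        · rw [← hℓ, t.e_nxt, t.e_nxt]
      adj := fun d => Or.inl ⟨d, rfl, rfl⟩
      leaf := fun d => t.label_leaf hℓ
      tree := fun d hd => t.label_α hℓ hd
      matched := fun d hd => (t.matching_μ hℓ A.map.α_ne nc hd).symm }

/-! ### From a triangulation and a matching to a tree-rooted map -/

open Equiv Equiv.Perm

namespace Triangulation

variable {N : ℕ} (S : Triangulation N)

/-- `a, b, c` are the vertices of a triangle of `S`, in positive order. -/
def IsTriangle (a b c : ZMod N) : Prop :=
  S.Adj a b ∧ S.Adj b c ∧ S.Adj c a ∧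
    ∃ i j k : ℤ, i < j ∧ j < k ∧ k < i + N ∧ a = i ∧ b = j ∧ c = k

variable {S}

theorem IsTriangle.rotate {a b c : ZMod N} (h : S.IsTriangle a b c) : S.IsTriangle b c a := by
  obtain ⟨h1, h2, h3, i, j, k, h4, h5, h6, rfl, rfl, rfl⟩ := h
  exact ⟨h2, h3, h1, j, k, i + N, h5, h6, by omega, rfl, rfl, by simp⟩

theorem IsTriangle.unique {a b c c' : ZMod N} (h : S.IsTriangle a b c)
    (h' : S.IsTriangle a b c') : c = c' := by
  obtain ⟨h1, h2, h3, i, j, k, h4, h5, h6, rfl, rfl, rfl⟩ := h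
  obtain ⟨h1', h2', h3', i', j', k', h4', h5', h6', hi, hj, rfl⟩ := h'
  obtain ⟨c, rfl, rfl⟩ := exists_shift hi hj h4 (by omega) h4' (by omega)
  have hk : k = k' + N * c := by
    refine S.apex_unique (j := j' + N * c) (l := i' + N * c + N) h5 h6 (by linarith) (by linarith)
      (by linarith) h2 (by simpa using h3) ?_ ?_
    · rwa [intCast_add_mul k' c]
    · rw [intCast_add_mul k' c]
      simpa using h3'
  rw [hk, intCast_add_mul]

theorem exists_lift [NeZero N] {a b : ZMod N} (h : a ≠ b) :
    ∃ i j : ℤ, i < j ∧ j < i + N ∧ a = i ∧ b = j := by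
  refine ⟨a.val, a.val + (b - a).val, ?_, ?_, by simp, by simp⟩
  · have : (b - a).val ≠ 0 := by
      rw [Ne, ZMod.val_eq_zero, sub_eq_zero]
      exact h.symm
    omega
  · have := ZMod.val_lt (b - a)
    omega

/-- The apex is taken over the complementary arc from b round to a, which is longer than a side
precisely because `a ≠ b + 1`. -/
theorem exists_isTriangle [NeZero N] {a b : ZMod N} (h : S.Adj a b) (hab : a ≠ b + 1) :
    ∃ c, S.IsTriangle a b c := by
  have hne : a ≠ b := fun hc => S.irrefl b (by rwa [hc] at h)
  obtain ⟨i, j, h1, h2, rfl, rfl⟩ := exists_lift hne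
  have h3 : j + 1 ≠ i + N := fun hc => hab (by
    have := congrArg (Int.cast : ℤ → ZMod N) hc
    push_cast at this
    simpa using this.symm)
  obtain ⟨k, h4, h5, h6, h7⟩ := S.apex j (i + N) (by omega) (by omega) (by simpa using S.symm _ _ h)
  exact ⟨k, h, h6, by simpa using h7, i, j, k, h1, h4, h5, rfl, rfl, rfl⟩

theorem IsTriangle.ne {a b c : ZMod N} (h : S.IsTriangle a b c) : a ≠ b + 1 := by
  obtain ⟨h1, h2, h3, i, j, k, h4, h5, h6, rfl, rfl, rfl⟩ := h
  intro hc
  have := eq_of_intCast_eq (N := N) (a := i) (b := j + 1) (by push_cast; exact hc) (by omega)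
    (by omega)
  omega

variable (S)

/-- The sides and diagonals, oriented, without the sides in negative direction. -/
abbrev Arc : Type := {p : ZMod N × ZMod N // S.Adj p.1 p.2 ∧ p.1 ≠ p.2 + 1}

variable {S}

theorem arc_ext {d e : S.Arc} (h1 : d.1.1 = e.1.1) (h2 : d.1.2 = e.1.2) : d = e :=
  Subtype.ext (Prod.ext h1 h2)

section

variable [NeZero N]

/-- The next arc around the triangle to the outside of an arc. -/
noncomputable def arcNext (d : S.Arc) : S.Arc :=
  ⟨(d.1.2, (exists_isTriangle d.2.1 d.2.2).choose),
    (exists_isTriangle d.2.1 d.2.2).choose_spec.rotate.1,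
    (exists_isTriangle d.2.1 d.2.2).choose_spec.rotate.ne⟩

theorem arcNext_fst (d : S.Arc) : (arcNext d).1.1 = d.1.2 := rfl

theorem isTriangle_arcNext (d : S.Arc) : S.IsTriangle d.1.1 d.1.2 (arcNext d).1.2 :=
  (exists_isTriangle d.2.1 d.2.2).choose_spec

theorem arcNext_arcNext (d : S.Arc) : (arcNext (arcNext d)).1.2 = d.1.1 :=
  (isTriangle_arcNext (arcNext d)).unique (isTriangle_arcNext d).rotate

theorem arcNext_arcNext_arcNext (d : S.Arc) : arcNext (arcNext (arcNext d)) = d := by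
  refine arc_ext ?_ ?_
  · rw [arcNext_fst, arcNext_arcNext]
  · rw [arcNext_arcNext, arcNext_fst]

theorem arcNext_ne (d : S.Arc) : arcNext d ≠ d := fun h => by
  have := d.2.1
  rw [← arcNext_fst, h] at this
  exact S.irrefl _ this

end

theorem side_ne (hN : 3 ≤ N) (a : ZMod N) : a ≠ a + 1 + 1 := by
  intro ha
  have : ((2 : ℕ) : ZMod N) = 0 := by
    have : a + 2 = a := by rw [← one_add_one_eq_two, ← add_assoc, ← ha]
    simpa using this
  rw [ZMod.natCast_eq_zero_iff] at this
  exact absurd (Nat.le_of_dvd two_pos this) (by omega)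

/-- A side as an arc. -/
def sideArc (S : Triangulation N) (hN : 3 ≤ N) (a : ZMod N) : S.Arc :=
  ⟨(a, a + 1), S.side a, side_ne hN a⟩

open Classical in
/-- The reversal of diagonals and the gluing of sides. -/
noncomputable def arcFlip (hN : 3 ≤ N) (μ : NCMatching N) (d : S.Arc) : S.Arc :=
  if h : d.1.2 = d.1.1 + 1 then S.sideArc hN (μ.μ d.1.1)
  else ⟨(d.1.2, d.1.1), S.symm _ _ d.2.1, h⟩

theorem arcFlip_side {hN : 3 ≤ N} {μ : NCMatching N} {d : S.Arc} (h : d.1.2 = d.1.1 + 1) :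
    arcFlip hN μ d = S.sideArc hN (μ.μ d.1.1) := dif_pos h

theorem arcFlip_diag {hN : 3 ≤ N} {μ : NCMatching N} {d : S.Arc} (h : d.1.2 ≠ d.1.1 + 1) :
    (arcFlip hN μ d).1 = (d.1.2, d.1.1) := by
  rw [arcFlip, dif_neg h]

theorem arcFlip_arcFlip (hN : 3 ≤ N) (μ : NCMatching N) (d : S.Arc) :
    arcFlip hN μ (arcFlip hN μ d) = d := by
  by_cases h : d.1.2 = d.1.1 + 1
  · rw [arcFlip_side (d := arcFlip hN μ d) (by rw [arcFlip_side h]; rfl), arcFlip_side h]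
    refine arc_ext ?_ ?_
    · exact μ.μ_μ _
    · rw [h]; exact congrArg (· + 1) (μ.μ_μ _)
  · have h1 := arcFlip_diag (hN := hN) (μ := μ) h
    have h2 : (arcFlip hN μ d).1.2 ≠ (arcFlip hN μ d).1.1 + 1 := by
      rw [h1]; exact d.2.2
    refine Subtype.ext ?_
    rw [arcFlip_diag h2, h1]

theorem arcFlip_ne (hN : 3 ≤ N) (μ : NCMatching N) (d : S.Arc) : arcFlip hN μ d ≠ d := by
  intro hd
  by_cases h : d.1.2 = d.1.1 + 1
  · rw [arcFlip_side h] at hd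
    exact μ.μ_ne d.1.1 (congrArg (fun d => d.1.1) hd)
  · have h1 := arcFlip_diag (hN := hN) (μ := μ) h
    rw [hd] at h1
    have := d.2.1
    rw [(Prod.ext_iff.1 h1).1] at this
    exact S.irrefl _ this

/-- The map dual to a triangulation, its sides being glued according to a matching. -/
noncomputable def toMap [NeZero N] (S : Triangulation N) (hN : 3 ≤ N) (μ : NCMatching N) :
    CombMap S.Arc where
  σ := ⟨arcNext, fun d => arcNext (arcNext d), arcNext_arcNext_arcNext, arcNext_arcNext_arcNext⟩
  α := Function.Involutive.toPerm (arcFlip hN μ) (arcFlip_arcFlip hN μ)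
  α_α := arcFlip_arcFlip hN μ
  α_ne := arcFlip_ne hN μ

/-- The length of an arc. -/
def arcLen (d : S.Arc) : ℕ := (d.1.2 - d.1.1).val

theorem arcLen_pos (d : S.Arc) : 0 < arcLen d := by
  rw [arcLen, Nat.pos_iff_ne_zero, Ne, ZMod.val_eq_zero, sub_eq_zero]
  intro h
  have := d.2.1
  rw [h] at this
  exact S.irrefl _ this

section toMap

variable [NeZero N] {hN : 3 ≤ N} {μ : NCMatching N}

theorem toMap_σ (d : S.Arc) : (S.toMap hN μ).σ d = arcNext d := rfl

theorem toMap_α (d : S.Arc) : (S.toMap hN μ).α d = arcFlip hN μ d := rfl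

variable (S hN μ)

/-- The edges dual to diagonals. -/
def diagEdges : Set (S.toMap hN μ).Edge :=
  (S.toMap hN μ).edgeOf '' {d | d.1.2 ≠ d.1.1 + 1}

variable {S hN μ}

theorem mem_diagEdges {d : S.Arc} :
    (S.toMap hN μ).edgeOf d ∈ S.diagEdges hN μ ↔ d.1.2 ≠ d.1.1 + 1 := by
  constructor
  · rintro ⟨e, he, hed⟩
    rcases (S.toMap hN μ).edgeOf_eq_iff.1 hed with rfl | rfl
    · exact he
    · rw [toMap_α, arcFlip_diag he]
      exact e.2.2
  · exact fun h => ⟨d, h, rfl⟩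

theorem not_mem_diagEdges {d : S.Arc} :
    (S.toMap hN μ).edgeOf d ∉ S.diagEdges hN μ ↔ d.1.2 = d.1.1 + 1 := by
  rw [mem_diagEdges, not_not]

theorem arcLen_lt (d : S.Arc) : arcLen d < N := ZMod.val_lt _

theorem snd_eq (d : S.Arc) : d.1.2 = d.1.1 + arcLen d := by
  simp [arcLen]

theorem arcLen_eq {d : S.Arc} {i j : ℤ} (h1 : i < j) (h2 : j < i + N) (hi : d.1.1 = i)
    (hj : d.1.2 = j) : (arcLen d : ℤ) = j - i := by
  have h3 := snd_eq d
  have h4 := arcLen_lt d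
  refine eq_of_intCast_eq (N := N) ?_ (by omega) (by omega)
  rw [hj, hi] at h3
  push_cast
  rw [h3, add_sub_cancel_left]

theorem arcLen_arcFlip {d : S.Arc} (h : d.1.2 ≠ d.1.1 + 1) :
    arcLen (arcFlip hN μ d) + arcLen d = N := by
  have h1 : d.1.1 ≠ d.1.2 := fun hc => by
    have := d.2.1
    rw [hc] at this
    exact S.irrefl _ this
  obtain ⟨i, j, h2, h3, h4, h5⟩ := exists_lift h1
  have e1 := arcLen_eq h2 h3 h4 h5
  have e2 := arcLen_eq (d := arcFlip hN μ d) (i := j) (j := i + N) h3 (by omega)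
    (by rw [arcFlip_diag h]; exact h5) (by rw [arcFlip_diag h]; simpa using h4)
  omega

/-- Reversing a diagonal from a to b and turning gives the leg from a of the triangle on the side of
the arc between a and b. So the tour runs through the arcs that start at a in order of decreasing
length. -/
theorem tour_diag {d : S.Arc} (h : d.1.2 ≠ d.1.1 + 1) :
    ((S.toMap hN μ).tour (S.diagEdges hN μ) d).1.1 = d.1.1 ∧
      arcLen ((S.toMap hN μ).tour (S.diagEdges hN μ) d) < arcLen d := by
  rw [CombMap.tour_of_mem (mem_diagEdges.2 h), toMap_σ, toMap_α]
  have ht := isTriangle_arcNext (arcFlip hN μ d)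
  have hf : (arcNext (arcFlip hN μ d)).1.1 = d.1.1 := by rw [arcNext_fst, arcFlip_diag h]
  refine ⟨hf, ?_⟩
  rw [arcFlip_diag h] at ht
  obtain ⟨-, -, -, i, j, k, h1, h2, h3, h4, h5, h6⟩ := ht
  have e1 := arcLen_eq (d := d) (i := j) (j := i + N) (by omega) (by omega) h5 (by simpa using h4)
  have e2 := arcLen_eq (d := arcNext (arcFlip hN μ d)) h2 (by omega) (hf.trans h5) h6
  omega

theorem tour_side {d : S.Arc} (h : d.1.2 = d.1.1 + 1) :
    ((S.toMap hN μ).tour (S.diagEdges hN μ) d).1.1 = d.1.1 + 1 := by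
  rw [CombMap.tour_of_not_mem (not_mem_diagEdges.2 h), toMap_σ, arcNext_fst, h]

theorem sameCycle_sideArc (d : S.Arc) :
    SameCycle ((S.toMap hN μ).tour (S.diagEdges hN μ)) d (S.sideArc hN d.1.1) := by
  obtain ⟨m, hm⟩ : ∃ m, arcLen d = m := ⟨_, rfl⟩
  induction m using Nat.strong_induction_on generalizing d with
  | _ m ih =>
    by_cases h : d.1.2 = d.1.1 + 1
    · exact Eq.sameCycle (arc_ext (d := d) (e := S.sideArc hN d.1.1) rfl h) _
    · obtain ⟨h1, h2⟩ := tour_diag (hN := hN) (μ := μ) h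
      have := ih _ (by omega) ((S.toMap hN μ).tour (S.diagEdges hN μ) d) rfl
      rw [h1] at this
      exact sameCycle_apply_left.1 this

/-- From any arc the tour shrinks down to the side at the same starting point and then moves on to
the next starting point. -/
theorem sameCycle_tour (d e : S.Arc) :
    SameCycle ((S.toMap hN μ).tour (S.diagEdges hN μ)) d e := by
  have key : ∀ n : ℕ, SameCycle ((S.toMap hN μ).tour (S.diagEdges hN μ)) (S.sideArc hN 0)
      (S.sideArc hN n) := by
    intro n
    induction n with
    | zero => rw [Nat.cast_zero]
    | succ n ih =>
      have h1 := sameCycle_sideArc (hN := hN) (μ := μ)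
        ((S.toMap hN μ).tour (S.diagEdges hN μ) (S.sideArc hN n))
      rw [tour_side rfl] at h1
      push_cast
      exact ih.trans (sameCycle_apply_left.1 h1)
  have key' : ∀ d : S.Arc, SameCycle ((S.toMap hN μ).tour (S.diagEdges hN μ)) (S.sideArc hN 0) d :=
    fun d => by
      have := key d.1.1.val
      rw [ZMod.natCast_zmod_val] at this
      exact this.trans (sameCycle_sideArc d).symm
  exact (key' d).symm.trans (key' e)

theorem card_sides : Nat.card ↥((S.toMap hN μ).dartsOf (S.diagEdges hN μ))ᶜ = N := by
  refine Eq.trans (Nat.card_congr ⟨fun d => d.1.1.1, fun a => ⟨S.sideArc hN a, not_mem_diagEdges.2 rfl⟩, ?_,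
    fun a => rfl⟩) (Nat.card_zmod N)
  rintro ⟨d, hd⟩
  exact Subtype.ext (arc_ext rfl (not_mem_diagEdges.1 hd).symm)

/-- Lifts the starting points of the arcs on the tour to a monotone integer function. Ties are told
apart by arc length, which decreases strictly while the starting point stays the same. -/
theorem exists_toMap_counter : ∃ L : ℤ → ℤ,
    (∀ k l, k ≤ l → L k ≤ L l) ∧
    (∀ k, ((((S.toMap hN μ).tour (S.diagEdges hN μ)) ^ k) (S.sideArc hN 0)).1.1 = L k) ∧
    (∀ k l, k < l → (((S.toMap hN μ).tour (S.diagEdges hN μ)) ^ k) (S.sideArc hN 0) ∈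
      ((S.toMap hN μ).dartsOf (S.diagEdges hN μ))ᶜ → L k < L l) ∧
    (∀ k l, k < l → L k = L l →
      arcLen ((((S.toMap hN μ).tour (S.diagEdges hN μ)) ^ l) (S.sideArc hN 0)) <
        arcLen ((((S.toMap hN μ).tour (S.diagEdges hN μ)) ^ k) (S.sideArc hN 0))) ∧
    ∀ k, L (k + Nat.card S.Arc) = L k + N := by
  obtain ⟨L, h0, h1, h2, h3⟩ := exists_counter (sameCycle_tour (hN := hN) (μ := μ))
    (S.sideArc hN 0) ((S.toMap hN μ).dartsOf (S.diagEdges hN μ))ᶜ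
  set τ := (S.toMap hN μ).tour (S.diagEdges hN μ)
  set b := S.sideArc hN 0
  have hstep : ∀ k, ((τ ^ (k + 1)) b).1.1 = ((τ ^ k) b).1.1 + ((L (k + 1) - L k : ℤ) : ZMod N) := by
    intro k
    rw [zpow_add_one_apply]
    by_cases h : ((τ ^ k) b).1.2 = ((τ ^ k) b).1.1 + 1
    · rw [tour_side h, h1 k (not_mem_diagEdges.2 h)]
      simp
    · rw [(tour_diag h).1, h2 k (not_not.2 (mem_diagEdges.2 h))]
      simp
  have hmono : ∀ k l, k ≤ l → L k ≤ L l := by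
    intro k l hkl
    obtain ⟨m, rfl⟩ : ∃ m : ℕ, l = k + m := ⟨(l - k).toNat, by omega⟩
    clear hkl
    induction m with
    | zero => simp
    | succ m ih =>
      push_cast
      rw [← add_assoc]
      by_cases h : (τ ^ (k + m)) b ∈ ((S.toMap hN μ).dartsOf (S.diagEdges hN μ))ᶜ
      · rw [h1 _ h]; omega
      · rw [h2 _ h]; exact ih
  refine ⟨L, hmono, ?_, ?_, ?_, ?_⟩
  · intro k
    induction k using Int.induction_on with
    | zero => rw [h0, Int.cast_zero]; rfl
    | succ k ih => rw [hstep, ih]; push_cast; ring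
    | pred k ih =>
      have := hstep (-k - 1)
      rw [sub_add_cancel, ih] at this
      push_cast at this
      rw [← sub_eq_iff_eq_add] at this
      rw [← this]; ring
  · intro k l hkl hk
    have := hmono (k + 1) l (by omega)
    rw [h1 k hk] at this
    omega
  · intro k l hkl
    obtain ⟨m, rfl⟩ : ∃ m : ℕ, l = k + m + 1 := ⟨(l - k - 1).toNat, by omega⟩
    clear hkl
    have tree : ∀ j, k ≤ j → j < k + m + 1 → L k = L (k + m + 1) →
        ((τ ^ j) b).1.2 ≠ ((τ ^ j) b).1.1 + 1 := by
      intro j hj1 hj2 hL hc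
      have := hmono k j hj1
      have := hmono (j + 1) (k + m + 1) (by omega)
      rw [h1 j (not_mem_diagEdges.2 hc)] at this
      omega
    induction m with
    | zero =>
      intro hL
      have := tour_diag (hN := hN) (μ := μ) (tree k le_rfl (by omega) hL)
      rw [Nat.cast_zero, add_zero, zpow_add_one_apply]
      exact this.2
    | succ m ih =>
      intro hL
      have := tour_diag (hN := hN) (μ := μ) (tree (k + m + 1) (by omega) (by push_cast; omega) hL)
      push_cast
      rw [← add_assoc, zpow_add_one_apply]
      have hmid : L k = L (k + m + 1) := by
        have e1 := hmono k (k + m + 1) (by omega)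
        have e2 := hmono (k + m + 1) (k + (m + 1 : ℕ) + 1) (by push_cast; omega)
        omega
      refine lt_trans this.2 (ih (fun j hj1 hj2 _ => tree j hj1 (by push_cast; omega) hL) hmid)
  · intro k
    have := h3 k 1
    rwa [mul_one, mul_one, card_sides] at this

/-- When the four lifted end points are distinct, crossing pairs on the tour are crossing diagonals.
Coinciding end points are excluded by comparing lengths, a diagonal and its reverse having lengths
that add up to N. -/
theorem nonCrossing_diagEdges : NonCrossing ((S.toMap hN μ).tour (S.diagEdges hN μ))
    (S.toMap hN μ).α (S.sideArc hN 0) ((S.toMap hN μ).dartsOf (S.diagEdges hN μ)) := by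
  obtain ⟨L, h1, h2, h3, h4, h5⟩ := exists_toMap_counter (S := S) (hN := hN) (μ := μ)
  intro i j k l hij hjk hkl hli hi hj hk hl
  set τ := (S.toMap hN μ).tour (S.diagEdges hN μ)
  set b := S.sideArc hN 0
  rw [toMap_α] at hk hl
  have hi' : ((τ ^ i) b).1.2 ≠ ((τ ^ i) b).1.1 + 1 := mem_diagEdges.1 hi
  have hj' : ((τ ^ j) b).1.2 ≠ ((τ ^ j) b).1.1 + 1 := mem_diagEdges.1 hj
  have li := arcLen_lt ((τ ^ i) b)
  have lj := arcLen_lt ((τ ^ j) b)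
  have pi := arcLen_pos ((τ ^ i) b)
  have pj := arcLen_pos ((τ ^ j) b)
  have fi := arcLen_arcFlip (hN := hN) (μ := μ) hi'
  have fj := arcLen_arcFlip (hN := hN) (μ := μ) hj'
  rw [← hk] at fi
  rw [← hl] at fj
  have a1 := h1 i j (by omega)
  have a2 := h1 j k (by omega)
  have a3 := h1 k l (by omega)
  have a4 := h1 l (i + Nat.card S.Arc) (by omega)
  have a5 := h1 (j) (i + Nat.card S.Arc) (by omega)
  have a6 := h1 (i + Nat.card S.Arc) (j + Nat.card S.Arc) (by omega)
  rw [h5] at a4 a5 a6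
  rw [h5] at a6
  have bi : ((τ ^ i) b).1.2 = L k := by
    rw [← h2 k, hk, arcFlip_diag hi']
  have bj : ((τ ^ j) b).1.2 = L l := by
    rw [← h2 l, hl, arcFlip_diag hj']
  have ei : L k = L i + arcLen ((τ ^ i) b) := by
    refine eq_of_intCast_eq (N := N) ?_ (by omega) (by omega)
    rw [← bi, snd_eq, h2]; push_cast; rfl
  have ej : L l = L j + arcLen ((τ ^ j) b) := by
    refine eq_of_intCast_eq (N := N) ?_ (by omega) (by omega)
    rw [← bj, snd_eq, h2]; push_cast; rfl
  rcases eq_or_lt_of_le a1 with c1 | c1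
  · have := h4 i j hij c1
    omega
  rcases eq_or_lt_of_le a2 with c2 | c2
  · have := h4 j k hjk c2
    omega
  rcases eq_or_lt_of_le a3 with c3 | c3
  · have := h4 k l hkl c3
    omega
  rcases eq_or_lt_of_le a4 with c4 | c4
  · have := h4 l (i + Nat.card S.Arc) hli (by rw [h5]; exact c4)
    have e : (τ ^ (i + Nat.card S.Arc : ℤ)) b = (τ ^ i) b := by
      rw [zpow_apply_eq_zpow_apply_iff sameCycle_tour]
      exact ⟨-1, by ring⟩
    rw [e] at this
    omega
  refine S.noncross _ _ _ _ c1 c2 c3 c4 ?_ ?_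
  · rw [← h2 i, ← bi]; exact ((τ ^ i) b).2.1
  · rw [← h2 j, ← bj]; exact ((τ ^ j) b).2.1

theorem nonCrossing_diagEdges_compl : NonCrossing ((S.toMap hN μ).tour (S.diagEdges hN μ))
    (S.toMap hN μ).α (S.sideArc hN 0) ((S.toMap hN μ).dartsOf (S.diagEdges hN μ))ᶜ := by
  obtain ⟨L, h1, h2, h3, h4, h5⟩ := exists_toMap_counter (S := S) (hN := hN) (μ := μ)
  intro i j k l hij hjk hkl hli hi hj hk hl
  have hi' := not_mem_diagEdges.1 hi
  have hj' := not_mem_diagEdges.1 hj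
  rw [toMap_α, arcFlip_side hi'] at hk
  rw [toMap_α, arcFlip_side hj'] at hl
  refine μ.noncross (L i) (L j) (L k) (L l) (h3 _ _ hij hi) (h3 _ _ hjk hj) (h3 _ _ hkl ?_) ?_ ?_ ?_
  · rw [hk]; exact not_mem_diagEdges.2 rfl
  · rw [← h5]
    refine h3 _ _ hli ?_
    rw [hl]; exact not_mem_diagEdges.2 rfl
  · rw [← h2 i, ← h2 k, hk]; rfl
  · rw [← h2 j, ← h2 l, hl]; rfl

end toMap

end Triangulation

open Triangulation in
theorem exists_map {n : ℕ} (hn : 1 ≤ n) (S : Triangulation (2 * n + 2))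
    (μ : NCMatching (2 * n + 2)) :
    ∃ (A : TreeRootedCubicMap (2 * n)) (ℓ : _), Labels A S μ ℓ := by
  have hN : 3 ≤ 2 * n + 2 := by omega
  have : Nonempty S.Arc := ⟨S.sideArc hN 0⟩
  have hcub : (S.toMap hN μ).IsCubic :=
    CombMap.isCubic_of_σ arcNext_arcNext_arcNext arcNext_ne
  -- This gives 2V = (number of oriented diagonals) + 2. Together with 3V = (number of oriented
  -- diagonals) + N it yields V = N - 2 = 2n.
  have h1 := (nonCrossing_diagEdges (S := S) (hN := hN) (μ := μ)).numCycles_eq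
    (S.toMap hN μ).α_α (S.toMap hN μ).α_ne (CombMap.dartsOf_stable _ _) sameCycle_tour
  rw [CombMap.tour_mul_restrInv] at h1
  have h2 : (S.toMap hN μ).σ.numCycles = Nat.card (S.toMap hN μ).Vertex := rfl
  have h3 := CombMap.card_dartsOf_add_compl (S.diagEdges hN μ)
  rw [card_sides] at h3
  have h4 := hcub.card_eq
  let A : TreeRootedCubicMap (2 * n) :=
    { Dart := S.Arc
      finite_dart := inferInstance
      map := S.toMap hN μ
      planar := CombMap.isPlanar_of_tour sameCycle_tour (by omega) nonCrossing_diagEdges_compl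
      cubic := hcub
      card_vertex := by omega
      tree := S.diagEdges hN μ
      spanning := CombMap.isSpanningTree_of_tour sameCycle_tour (by omega) }
  refine ⟨A, fun d : S.Arc => d.1.1, ?_⟩
  exact
    { inj := fun d e => arc_ext
      surj := fun a b hab hne => ⟨⟨(a, b), hab, hne⟩, rfl, rfl⟩
      cyc := fun d => by
        obtain ⟨-, -, -, i, j, k, h⟩ := isTriangle_arcNext d
        exact ⟨i, j, k, h⟩
      adj := fun d => d.2.1
      leaf := fun d => not_mem_diagEdges
      tree := fun d hd => by
        change (arcFlip hN μ d).1.1 = d.1.2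
        rw [arcFlip_diag (mem_diagEdges.1 hd)]
      matched := fun d hd => by
        change (arcFlip hN μ d).1.1 = _
        rw [arcFlip_side (not_mem_diagEdges.1 hd)]
        rfl }

/-! ### Triangulated polygons from binary trees -/

namespace BinaryTree

/-- The sides and diagonals `(x, y)`, `x < y`, of the triangulation of the polygon with vertices
`o, o + 1, …, o + t.numLeaves` that corresponds to the binary tree `t`. -/
def InTree : BinaryTree Unit → ℤ → ℤ → ℤ → Prop
  | nil, o, x, y => x = o ∧ y = o + 1
  | node _ l r, o, x, y => (x = o ∧ y = o + l.numLeaves + r.numLeaves) ∨ InTree l o x y ∨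
      InTree r (o + l.numLeaves) x y

variable {t : BinaryTree Unit} {o x y : ℤ}

theorem InTree.bounds (h : InTree t o x y) : o ≤ x ∧ x < y ∧ y ≤ o + t.numLeaves := by
  induction t generalizing o x y with
  | nil => obtain ⟨rfl, rfl⟩ := h; simp
  | node v l r hl hr =>
    have := l.numLeaves_pos
    have := r.numLeaves_pos
    simp only [numLeaves]
    push_cast
    rcases h with ⟨rfl, rfl⟩ | h | h
    · omega
    · have := hl h; omega
    · have := hr h; omega

theorem inTree_root (t : BinaryTree Unit) (o : ℤ) : InTree t o o (o + t.numLeaves) := by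
  cases t with
  | nil => simp [InTree]
  | node v l r => left; simp [add_assoc]

theorem inTree_side (h1 : o ≤ x) (h2 : x < o + t.numLeaves) : InTree t o x (x + 1) := by
  induction t generalizing o x with
  | nil => simp only [numLeaves] at h2; push_cast at h2; exact ⟨by omega, by omega⟩
  | node v l r hl hr =>
    simp only [numLeaves] at h2
    push_cast at h2
    by_cases h : x < o + l.numLeaves
    · exact Or.inr (Or.inl (hl h1 h))
    · exact Or.inr (Or.inr (hr (by omega) (by omega)))

theorem InTree.noncross {x' y' : ℤ} (h : InTree t o x y) (h' : InTree t o x' y') (h1 : x < x')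
    (h2 : x' < y) (h3 : y < y') : False := by
  induction t generalizing o x y x' y' with
  | nil => obtain ⟨rfl, rfl⟩ := h; obtain ⟨rfl, rfl⟩ := h'; omega
  | node v l r hl hr =>
    have b1 := h.bounds
    have b2 := h'.bounds
    simp only [numLeaves] at b1 b2
    push_cast at b1 b2
    rcases h with ⟨rfl, rfl⟩ | h | h
    · omega
    · rcases h' with ⟨rfl, rfl⟩ | h' | h'
      · omega
      · exact hl h h' h1 h2 h3
      · have := h.bounds; have := h'.bounds; omega
    · rcases h' with ⟨rfl, rfl⟩ | h' | h'
      · omega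
      · have := h.bounds; have := h'.bounds; omega
      · exact hr h h' h1 h2 h3

theorem InTree.apex (h : InTree t o x y) (h1 : x + 1 < y) :
    ∃ k, x < k ∧ k < y ∧ InTree t o x k ∧ InTree t o k y := by
  induction t generalizing o x y with
  | nil => obtain ⟨rfl, rfl⟩ := h; omega
  | node v l r hl hr =>
    rcases h with ⟨rfl, rfl⟩ | h | h
    · have := l.numLeaves_pos
      have := r.numLeaves_pos
      exact ⟨x + l.numLeaves, by omega, by omega, Or.inr (Or.inl (inTree_root l x)),
        Or.inr (Or.inr (inTree_root r _))⟩
    · obtain ⟨k, h2, h3, h4, h5⟩ := hl h h1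
      exact ⟨k, h2, h3, Or.inr (Or.inl h4), Or.inr (Or.inl h5)⟩
    · obtain ⟨k, h2, h3, h4, h5⟩ := hr h h1
      exact ⟨k, h2, h3, Or.inr (Or.inr h4), Or.inr (Or.inr h5)⟩

/-- An arc other than the root is a child of some node. The triangle of that node provides the third
vertex, to the right of a left child and to the left of a right child. -/
theorem InTree.outer (h : InTree t o x y) (h1 : x ≠ o ∨ y ≠ o + t.numLeaves) :
    ∃ k, (k < x ∧ InTree t o k x ∧ InTree t o k y) ∨ (y < k ∧ InTree t o x k ∧ InTree t o y k) := by
  induction t generalizing o x y with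
  | nil => obtain ⟨rfl, rfl⟩ := h; simp at h1
  | node v l r hl hr =>
    simp only [numLeaves] at h1
    push_cast at h1
    have := l.numLeaves_pos
    have := r.numLeaves_pos
    have e1 : InTree (node v l r) o o (o + l.numLeaves) := Or.inr (Or.inl (inTree_root l o))
    have e2 : InTree (node v l r) o (o + l.numLeaves) (o + l.numLeaves + r.numLeaves) :=
      Or.inr (Or.inr (inTree_root r _))
    have e3 : InTree (node v l r) o o (o + l.numLeaves + r.numLeaves) := Or.inl ⟨rfl, rfl⟩
    rcases h with ⟨rfl, rfl⟩ | h | h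
    · omega
    · by_cases hr' : x ≠ o ∨ y ≠ o + l.numLeaves
      · obtain ⟨k, ⟨a, b, c⟩ | ⟨a, b, c⟩⟩ := hl h hr'
        · exact ⟨k, Or.inl ⟨a, Or.inr (Or.inl b), Or.inr (Or.inl c)⟩⟩
        · exact ⟨k, Or.inr ⟨a, Or.inr (Or.inl b), Or.inr (Or.inl c)⟩⟩
      · push Not at hr'
        obtain ⟨rfl, rfl⟩ := hr'
        exact ⟨_, Or.inr ⟨by omega, e3, e2⟩⟩
    · by_cases hr' : x ≠ o + l.numLeaves ∨ y ≠ o + l.numLeaves + r.numLeaves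
      · obtain ⟨k, ⟨a, b, c⟩ | ⟨a, b, c⟩⟩ := hr h hr'
        · exact ⟨k, Or.inl ⟨a, Or.inr (Or.inr b), Or.inr (Or.inr c)⟩⟩
        · exact ⟨k, Or.inr ⟨a, Or.inr (Or.inr b), Or.inr (Or.inr c)⟩⟩
      · push Not at hr'
        obtain ⟨rfl, rfl⟩ := hr'
        exact ⟨o, Or.inl ⟨by omega, e1, e3⟩⟩

theorem inTree_add (t : BinaryTree Unit) (o x y c : ℤ) :
    InTree t (o + c) (x + c) (y + c) ↔ InTree t o x y := by
  induction t generalizing o x y with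
  | nil => simp only [InTree]; omega
  | node v l r hl hr =>
    simp only [InTree]
    rw [hl, add_right_comm o c, hr]
    refine or_congr ?_ Iff.rfl
    omega

theorem InTree.left_iff {v : Unit} {l r : BinaryTree Unit} (hy : y ≤ o + l.numLeaves) :
    InTree (node v l r) o x y ↔ InTree l o x y := by
  have := r.numLeaves_pos
  refine ⟨?_, fun h => Or.inr (Or.inl h)⟩
  rintro (⟨-, rfl⟩ | h | h)
  · omega
  · exact h
  · have := h.bounds; omega

theorem InTree.right_iff {v : Unit} {l r : BinaryTree Unit} (hx : o + l.numLeaves ≤ x) :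
    InTree (node v l r) o x y ↔ InTree r (o + l.numLeaves) x y := by
  have := l.numLeaves_pos
  refine ⟨?_, fun h => Or.inr (Or.inr h)⟩
  rintro (⟨rfl, -⟩ | h | h)
  · omega
  · have := h.bounds; omega
  · exact h

/-- Inclusion is enough because triangulations are maximal: different split points at the root would
produce crossing arcs, and the branches follow by induction. -/
theorem eq_of_inTree {t t' : BinaryTree Unit} {o : ℤ} (hl : t.numLeaves = t'.numLeaves)
    (h : ∀ x y, InTree t o x y → InTree t' o x y) : t = t' := by
  induction t generalizing t' o with
  | nil =>
    cases t' with
    | nil => rfl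
    | node v l r =>
      have := l.numLeaves_pos
      have := r.numLeaves_pos
      simp only [numLeaves] at hl
      omega
  | node v l r ihl ihr =>
    cases t' with
    | nil =>
      have := l.numLeaves_pos
      have := r.numLeaves_pos
      simp only [numLeaves] at hl
      omega
    | node v' l' r' =>
      simp only [numLeaves] at hl
      have := l.numLeaves_pos
      have := r.numLeaves_pos
      have := l'.numLeaves_pos
      have := r'.numLeaves_pos
      have e1 : InTree (node v' l' r') o o (o + l.numLeaves) :=
        h _ _ (Or.inr (Or.inl (inTree_root l o)))
      have e2 : InTree (node v' l' r') o (o + l.numLeaves) (o + l.numLeaves + r.numLeaves) :=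
        h _ _ (Or.inr (Or.inr (inTree_root r _)))
      have e3 : InTree (node v' l' r') o o (o + l'.numLeaves) := Or.inr (Or.inl (inTree_root l' o))
      have e4 : InTree (node v' l' r') o (o + l'.numLeaves) (o + l'.numLeaves + r'.numLeaves) :=
        Or.inr (Or.inr (inTree_root r' _))
      have hll : l.numLeaves = l'.numLeaves := by
        rcases lt_trichotomy l.numLeaves l'.numLeaves with hlt | heq | hlt
        · exact (e3.noncross e2 (by omega) (by omega) (by omega)).elim
        · exact heq
        · exact (e1.noncross e4 (by omega) (by omega) (by omega)).elim
      have hl' : l = l' := ihl (o := o) hll fun x y hxy => by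
        have hb := hxy.bounds
        exact (InTree.left_iff (by omega)).1 (h _ _ (Or.inr (Or.inl hxy)))
      have hr' : r = r' := ihr (o := o + l.numLeaves) (by omega) fun x y hxy => by
        have hb := hxy.bounds
        have := (InTree.right_iff (by omega)).1 (h _ _ (Or.inr (Or.inr hxy)))
        rwa [← hll] at this
      rw [hl', hr']

theorem card_numNodes (n : ℕ) :
    Nat.card {t : BinaryTree Unit // t.numNodes = n} = catalan n := by
  rw [← treesOfNumNodesEq_card_eq_catalan, ← Fintype.card_coe, ← Nat.card_eq_fintype_card]
  exact Nat.card_congr (Equiv.subtypeEquivRight fun t => mem_treesOfNumNodesEq.symm)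

theorem card_numLeaves (n : ℕ) :
    Nat.card {t : BinaryTree Unit // t.numLeaves = n + 1} = catalan n := by
  rw [← card_numNodes]
  exact Nat.card_congr (Equiv.subtypeEquivRight fun t => by
    rw [numLeaves_eq_numNodes_succ, Nat.succ_inj])

end BinaryTree

open BinaryTree

/-! ### Gluing two triangulated polygons along an arc -/

namespace Triangulation

variable {N : ℕ}

/-- Split at the apex over (i, j); its two legs bound smaller polygons. Any other arc that straddles
the apex would cross a leg. -/
theorem exists_tree (S : Triangulation N) {i j : ℤ} (hij : i < j) (hj : j < i + N)
    (h : S.Adj i j) : ∃ t : BinaryTree Unit, (t.numLeaves : ℤ) = j - i ∧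
      ∀ x y : ℤ, i ≤ x → x < y → y ≤ j → (S.Adj x y ↔ InTree t i x y) := by
  obtain ⟨m, hm⟩ : ∃ m : ℕ, j - i = m := ⟨(j - i).toNat, by omega⟩
  induction m using Nat.strong_induction_on generalizing i j with
  | _ m ih =>
    by_cases h1 : j = i + 1
    · subst h1
      refine ⟨nil, by simp, fun x y hx hxy hy => ?_⟩
      obtain rfl : x = i := by omega
      obtain rfl : y = x + 1 := by omega
      exact iff_of_true h ⟨rfl, rfl⟩
    · obtain ⟨k, h2, h3, h4, h5⟩ := S.apex i j (by omega) hj h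
      obtain ⟨l, hl1, hl2⟩ := ih (k - i).toNat (by omega) h2 (by omega) h4 (by omega)
      obtain ⟨r, hr1, hr2⟩ := ih (j - k).toNat (by omega) h3 (by omega) h5 (by omega)
      refine ⟨node () l r, by simp only [numLeaves]; push_cast; omega, fun x y hx hxy hy => ?_⟩
      have hk : i + (l.numLeaves : ℤ) = k := by omega
      by_cases c1 : y ≤ k
      · rw [InTree.left_iff (by omega)]
        exact hl2 x y hx hxy c1
      · by_cases c2 : k ≤ x
        · rw [InTree.right_iff (by omega), hk]
          exact hr2 x y c2 hxy hy
        · by_cases c3 : x = i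
          · by_cases c4 : y = j
            · subst c3 c4
              exact iff_of_true h (Or.inl ⟨rfl, by omega⟩)
            · refine iff_of_false (fun hc => ?_) ?_
              · exact S.noncross x k y j (by omega) (by omega) (by omega) (by omega) hc h5
              · rintro (⟨-, hc⟩ | hc | hc)
                · omega
                · have := hc.bounds; omega
                · have := hc.bounds; omega
          · refine iff_of_false (fun hc => ?_) ?_
            · exact S.noncross i x k y (by omega) (by omega) (by omega) (by omega) h4 hc
            · rintro (⟨hc, -⟩ | hc | hc)
              · omega
              · have := hc.bounds; omega
              · have := hc.bounds; omega

/-- No arc crosses (0, a), so the arcs on its two sides are all there are. -/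
theorem ext_of_arc [NeZero N] {S S' : Triangulation N} {a : ℤ}
    (hS : S.Adj (0 : ℤ) a) (hS' : S'.Adj (0 : ℤ) a)
    (h1 : ∀ x y : ℤ, 0 ≤ x → x < y → y ≤ a → (S.Adj x y ↔ S'.Adj x y))
    (h2 : ∀ x y : ℤ, a ≤ x → x < y → y ≤ N → (S.Adj x y ↔ S'.Adj x y)) : S = S' := by
  have key : ∀ x y : ℤ, 0 ≤ x → x < y → y < N → (S.Adj x y ↔ S'.Adj x y) := by
    intro x y hx hxy hy
    by_cases c1 : y ≤ a
    · exact h1 x y hx hxy c1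
    by_cases c2 : a ≤ x
    · exact h2 x y c2 hxy hy.le
    by_cases c3 : x = 0
    · subst c3
      have := h2 y N (by omega) hy le_rfl
      have e : ((N : ℤ) : ZMod N) = ((0 : ℤ) : ZMod N) := by simp
      rw [e] at this
      exact ⟨fun h => S'.symm _ _ (this.1 (S.symm _ _ h)),
        fun h => S.symm _ _ (this.2 (S'.symm _ _ h))⟩
    · exact iff_of_false
        (fun hc => S.noncross 0 x a y (by omega) (by omega) (by omega) (by omega) hS hc)
        (fun hc => S'.noncross 0 x a y (by omega) (by omega) (by omega) (by omega) hS' hc)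
  ext p q
  obtain ⟨x, hx, hx', rfl⟩ : ∃ x : ℤ, 0 ≤ x ∧ x < N ∧ (x : ZMod N) = p :=
    ⟨p.val, by positivity, by exact_mod_cast ZMod.val_lt p, by simp⟩
  obtain ⟨y, hy, hy', rfl⟩ : ∃ y : ℤ, 0 ≤ y ∧ y < N ∧ (y : ZMod N) = q :=
    ⟨q.val, by positivity, by exact_mod_cast ZMod.val_lt q, by simp⟩
  rcases lt_trichotomy x y with h | h | h
  · exact key x y hx h hy'
  · subst h
    exact iff_of_false (S.irrefl _) (S'.irrefl _)
  · have := key y x hy h hx'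
    exact ⟨fun h => S'.symm _ _ (this.1 (S.symm _ _ h)),
        fun h => S.symm _ _ (this.2 (S'.symm _ _ h))⟩

section Glue

variable (t₁ t₂ : BinaryTree Unit)

/-- The sides and diagonals of the triangulations, given by `t₁` and `t₂`, of two polygons with
vertices `0, …, a` and `a, …, N`. -/
def GlueArc (x y : ℤ) : Prop := InTree t₁ 0 x y ∨ InTree t₂ t₁.numLeaves x y

variable {t₁ t₂} (h : t₁.numLeaves + t₂.numLeaves = N)

theorem GlueArc.bounds (h : t₁.numLeaves + t₂.numLeaves = N) {x y : ℤ} (hxy : GlueArc t₁ t₂ x y) :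
    0 ≤ x ∧ x < y ∧ y ≤ N ∧ y < x + N := by
  have := t₁.numLeaves_pos
  have := t₂.numLeaves_pos
  rcases hxy with hxy | hxy
  · have := hxy.bounds; omega
  · have := hxy.bounds; omega

theorem GlueArc.noncross {x y x' y' : ℤ} (hxy : GlueArc t₁ t₂ x y) (hxy' : GlueArc t₁ t₂ x' y')
    (h1 : x < x') (h2 : x' < y) (h3 : y < y') : False := by
  rcases hxy with hxy | hxy <;> rcases hxy' with hxy' | hxy'
  · exact hxy.noncross hxy' h1 h2 h3
  · have := hxy.bounds; have := hxy'.bounds; omega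
  · have := hxy.bounds; have := hxy'.bounds; omega
  · exact hxy.noncross hxy' h1 h2 h3

theorem GlueArc.exists_shift (h : t₁.numLeaves + t₂.numLeaves = N) {p q : ℤ} (h1 : p < q)
    (h2 : q < p + N)
    (hpq : ∃ x y : ℤ, GlueArc t₁ t₂ x y ∧
      (((p : ZMod N) = x ∧ (q : ZMod N) = y) ∨ ((p : ZMod N) = y ∧ (q : ZMod N) = x))) :
    ∃ x y c : ℤ, GlueArc t₁ t₂ x y ∧
      ((p = x + N * c ∧ q = y + N * c) ∨ (p = y + N * c ∧ q = x + N + N * c)) := by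
  obtain ⟨x, y, hxy, hc⟩ := hpq
  have hb := hxy.bounds h
  rcases hc with ⟨e1, e2⟩ | ⟨e1, e2⟩
  · obtain ⟨c, hc⟩ := _root_.exists_shift e1 e2 h1 h2 (by omega) (by omega)
    exact ⟨x, y, c, hxy, Or.inl hc⟩
  · obtain ⟨c, hc⟩ := _root_.exists_shift (j' := x + N) e1 (by simpa using e2) h1 h2 (by omega)
      (by omega)
    exact ⟨x, y, c, hxy, Or.inr hc⟩

/-- The triangle on the other side of an arc lies in the same tree, unless the arc is its root; then
it is the top triangle of the other tree. The several alternatives come from the vertex 0 being also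
the vertex N. -/
theorem GlueArc.outer (h : t₁.numLeaves + t₂.numLeaves = N) {x y : ℤ} (hxy : GlueArc t₁ t₂ x y)
    (h1 : y + 1 < x + N) : ∃ k : ℤ, y < k ∧ k < x + N ∧
      (GlueArc t₁ t₂ y k ∨ GlueArc t₁ t₂ (k - N) y ∨ (y = N ∧ GlueArc t₁ t₂ 0 (k - N))) ∧
      (GlueArc t₁ t₂ x k ∨ GlueArc t₁ t₂ (k - N) x ∨ (x = 0 ∧ GlueArc t₁ t₂ k N)) := by
  have p1 := t₁.numLeaves_pos
  have p2 := t₂.numLeaves_pos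
  rcases hxy with hxy | hxy
  · by_cases hr : x ≠ 0 ∨ y ≠ 0 + t₁.numLeaves
    · obtain ⟨k, ⟨a, b, c⟩ | ⟨a, b, c⟩⟩ := hxy.outer hr
      · have := c.bounds
        have := b.bounds
        exact ⟨k + N, by omega, by omega, Or.inr (Or.inl (Or.inl (by simpa using c))),
          Or.inr (Or.inl (Or.inl (by simpa using b)))⟩
      · have := c.bounds
        have := b.bounds
        exact ⟨k, by omega, by omega, Or.inl (Or.inl c), Or.inl (Or.inl b)⟩
    · push Not at hr
      obtain ⟨rfl, rfl⟩ := hr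
      obtain ⟨k, h2, h3, h4, h5⟩ := (inTree_root t₂ t₁.numLeaves).apex (by omega)
      refine ⟨k, by omega, by omega, Or.inl (Or.inr (by simpa using h4)),
        Or.inr (Or.inr ⟨rfl, Or.inr ?_⟩)⟩
      rwa [show (t₁.numLeaves : ℤ) + t₂.numLeaves = N by omega] at h5
  · by_cases hr : x ≠ t₁.numLeaves ∨ y ≠ t₁.numLeaves + t₂.numLeaves
    · obtain ⟨k, ⟨a, b, c⟩ | ⟨a, b, c⟩⟩ := hxy.outer hr
      · have := c.bounds
        have := b.bounds
        exact ⟨k + N, by omega, by omega, Or.inr (Or.inl (Or.inr (by simpa using c))),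
          Or.inr (Or.inl (Or.inr (by simpa using b)))⟩
      · have := c.bounds
        have := b.bounds
        exact ⟨k, by omega, by omega, Or.inl (Or.inr c), Or.inl (Or.inr b)⟩
    · push Not at hr
      obtain ⟨rfl, rfl⟩ := hr
      obtain ⟨k, h2, h3, h4, h5⟩ := (inTree_root t₁ 0).apex (by omega)
      refine ⟨k + N, by omega, by omega, Or.inr (Or.inr ⟨by omega, Or.inl (by simpa using h4)⟩),
        Or.inr (Or.inl (Or.inl ?_))⟩
      rw [zero_add] at h5
      simpa using h5

/-- The triangulation obtained by gluing two triangulated polygons, with vertices `0, …, a` and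
`a, …, N`, along the arc `(0, a)`. -/
def glue : Triangulation N where
  Adj p q := ∃ x y : ℤ, GlueArc t₁ t₂ x y ∧ ((p = x ∧ q = y) ∨ (p = y ∧ q = x))
  irrefl := by
    rintro p ⟨x, y, hxy, h'⟩
    have hb := hxy.bounds h
    have : (x : ZMod N) = y := by rcases h' with ⟨rfl, h'⟩ | ⟨rfl, h'⟩ <;> simp [h']
    have := eq_of_intCast_eq this (by omega) (by omega)
    omega
  symm := by
    rintro p q ⟨x, y, hxy, h'⟩
    exact ⟨x, y, hxy, h'.symm.imp And.symm And.symm⟩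
  side := by
    intro p
    have : NeZero N := ⟨by have := t₁.numLeaves_pos; omega⟩
    have hp : (p.val : ℤ) < N := by exact_mod_cast ZMod.val_lt p
    refine ⟨p.val, p.val + 1, ?_, Or.inl ⟨by simp, by simp⟩⟩
    by_cases hc : (p.val : ℤ) < t₁.numLeaves
    · exact Or.inl (inTree_side (by omega) (by omega))
    · exact Or.inr (inTree_side (by omega) (by omega))
  noncross := by
    intro i x j y h1 h2 h3 h4 h5 h6
    obtain ⟨u, v, c, huv, hc⟩ := GlueArc.exists_shift h (by omega) (by omega) h5
    obtain ⟨u', v', c', huv', hc'⟩ := GlueArc.exists_shift h (by omega) (by omega) h6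
    have b := huv.bounds h
    have b' := huv'.bounds h
    obtain ⟨d, rfl⟩ : ∃ d, c' = c + d := ⟨c' - c, by ring⟩
    rw [mul_add] at hc'
    have hN : (0 : ℤ) < N := by omega
    -- The two crossing pairs start less than one turn apart, so their lifts differ by at most one
    -- period.
    have hd : d < 2 := by
      by_contra hd
      have : (N : ℤ) * d ≥ N * 2 := mul_le_mul_of_nonneg_left (by omega) hN.le
      omega
    have hd' : -1 < d := by
      by_contra hd
      have : (N : ℤ) * d ≤ N * (-1) := mul_le_mul_of_nonneg_left (by omega) hN.le
      omega
    have hd2 : d = 0 ∨ d = 1 := by omega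
    rcases hd2 with rfl | rfl <;> rcases hc with ⟨rfl, rfl⟩ | ⟨rfl, rfl⟩ <;>
      rcases hc' with ⟨rfl, rfl⟩ | ⟨rfl, rfl⟩ <;>
      first
      | omega
      | exact huv.noncross huv' (by omega) (by omega) (by omega)
      | exact huv'.noncross huv (by omega) (by omega) (by omega)
  apex := by
    intro i j h1 h2 h3
    obtain ⟨x, y, c, hxy, ⟨rfl, rfl⟩ | ⟨rfl, rfl⟩⟩ := GlueArc.exists_shift h (by omega) (by omega) h3
    · have : ∃ k, x < k ∧ k < y ∧ GlueArc t₁ t₂ x k ∧ GlueArc t₁ t₂ k y := by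
        rcases hxy with hxy | hxy
        · obtain ⟨k, h4, h5, h6, h7⟩ := hxy.apex (by omega)
          exact ⟨k, h4, h5, Or.inl h6, Or.inl h7⟩
        · obtain ⟨k, h4, h5, h6, h7⟩ := hxy.apex (by omega)
          exact ⟨k, h4, h5, Or.inr h6, Or.inr h7⟩
      obtain ⟨k, h4, h5, h6, h7⟩ := this
      exact ⟨k + N * c, by omega, by omega, ⟨x, k, h6, Or.inl ⟨by simp, by simp⟩⟩,
        ⟨k, y, h7, Or.inl ⟨by simp, by simp⟩⟩⟩
    · obtain ⟨k, h4, h5, h6, h7⟩ := hxy.outer h (by omega)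
      refine ⟨k + N * c, by omega, by omega, ?_, ?_⟩
      · rcases h6 with h6 | h6 | ⟨rfl, h6⟩
        · exact ⟨y, k, h6, Or.inl ⟨by simp, by simp⟩⟩
        · exact ⟨k - N, y, h6, Or.inr ⟨by simp, by simp⟩⟩
        · exact ⟨0, k - N, h6, Or.inl ⟨by simp, by simp⟩⟩
      · rcases h7 with h7 | h7 | ⟨rfl, h7⟩
        · exact ⟨x, k, h7, Or.inr ⟨by simp, by simp⟩⟩
        · exact ⟨k - N, x, h7, Or.inl ⟨by simp, by simp⟩⟩
        · exact ⟨k, N, h7, Or.inl ⟨by simp, by simp⟩⟩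

theorem glue_adj (h : t₁.numLeaves + t₂.numLeaves = N) {x y : ℤ} (hxy : GlueArc t₁ t₂ x y) :
    (glue h).Adj x y := ⟨x, y, hxy, Or.inl ⟨rfl, rfl⟩⟩

theorem glue_adj_zero : (glue h).Adj (0 : ℤ) (t₁.numLeaves : ℤ) :=
  glue_adj h (Or.inl (by simpa using inTree_root t₁ 0))

theorem glue_adj_left {x y : ℤ} (hx : 0 ≤ x) (hxy : x < y) (hy : y ≤ t₁.numLeaves) :
    (glue h).Adj x y ↔ InTree t₁ 0 x y := by
  refine ⟨fun hG => ?_, fun hG => glue_adj h (Or.inl hG)⟩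
  have p1 := t₁.numLeaves_pos
  have p2 := t₂.numLeaves_pos
  obtain ⟨u, v, c, huv, hc⟩ := GlueArc.exists_shift h hxy (by omega) hG
  have b := huv.bounds h
  have hN : (0 : ℤ) < N := by omega
  have hc1 : c < 1 := by
    by_contra hd
    have : (N : ℤ) * c ≥ N * 1 := mul_le_mul_of_nonneg_left (by omega) hN.le
    omega
  have hc2 : -2 < c := by
    by_contra hd
    have : (N : ℤ) * c ≤ N * (-2) := mul_le_mul_of_nonneg_left (by omega) hN.le
    omega
  have hc3 : c = 0 ∨ c = -1 := by omega
  rcases hc3 with rfl | rfl <;> rcases hc with ⟨rfl, rfl⟩ | ⟨rfl, rfl⟩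
  · rcases huv with huv | huv
    · simpa using huv
    · have := huv.bounds; omega
  · omega
  · omega
  -- The one case that wraps around: the arc (a, N) of the second polygon, reversed, is the common
  -- arc (0, a).
  · have hv : v = N := by omega
    rcases huv with huv | huv
    · have := huv.bounds; omega
    · have := huv.bounds
      have hu : u = t₁.numLeaves := by omega
      have := inTree_root t₁ 0
      rw [zero_add] at this
      rw [show v + (N : ℤ) * -1 = 0 by omega, show u + N + (N : ℤ) * -1 = t₁.numLeaves by omega]
      exact this

theorem glue_adj_right {x y : ℤ} (hx : t₁.numLeaves ≤ x) (hxy : x < y) (hy : y ≤ N) :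
    (glue h).Adj x y ↔ InTree t₂ t₁.numLeaves x y := by
  refine ⟨fun hG => ?_, fun hG => glue_adj h (Or.inr hG)⟩
  have p1 := t₁.numLeaves_pos
  have p2 := t₂.numLeaves_pos
  obtain ⟨u, v, c, huv, hc⟩ := GlueArc.exists_shift h hxy (by omega) hG
  have b := huv.bounds h
  have hN : (0 : ℤ) < N := by omega
  have hc1 : c < 1 := by
    by_contra hd
    have : (N : ℤ) * c ≥ N * 1 := mul_le_mul_of_nonneg_left (by omega) hN.le
    omega
  have hc2 : -1 < c := by
    by_contra hd
    have : (N : ℤ) * c ≤ N * (-1) := mul_le_mul_of_nonneg_left (by omega) hN.le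
    omega
  obtain rfl : c = 0 := by omega
  rcases hc with ⟨rfl, rfl⟩ | ⟨rfl, rfl⟩
  · rcases huv with huv | huv
    · have := huv.bounds; omega
    · simpa using huv
  · have hu : u = 0 := by omega
    rcases huv with huv | huv
    · have := huv.bounds
      have := inTree_root t₂ t₁.numLeaves
      rw [show v + (N : ℤ) * 0 = t₁.numLeaves by omega,
        show u + N + (N : ℤ) * 0 = t₁.numLeaves + t₂.numLeaves by omega]
      exact this
    · have := huv.bounds; omega

theorem exists_eq_glue [NeZero N] (S : Triangulation N) {a : ℕ} (h0 : 0 < a) (ha : a < N)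
    (hS : S.Adj (0 : ℤ) (a : ℤ)) : ∃ (t₁ t₂ : BinaryTree Unit) (h : t₁.numLeaves + t₂.numLeaves = N),
      t₁.numLeaves = a ∧ S = glue h := by
  obtain ⟨t₁, h1, h2⟩ := S.exists_tree (i := 0) (j := a) (by omega) (by omega) hS
  obtain ⟨t₂, h3, h4⟩ := S.exists_tree (i := a) (j := N) (by omega) (by omega)
    (by simpa using S.symm _ _ hS)
  have h : t₁.numLeaves + t₂.numLeaves = N := by omega
  have e : t₁.numLeaves = a := by omega
  refine ⟨t₁, t₂, h, e, ?_⟩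
  refine ext_of_arc (a := a) hS (by rw [← e]; exact glue_adj_zero h) ?_ ?_
  · intro x y hx hxy hy
    rw [glue_adj_left h hx hxy (by omega)]
    exact h2 x y hx hxy hy
  · intro x y hx hxy hy
    rw [glue_adj_right h (by omega) hxy hy, e]
    exact h4 x y hx hxy hy

theorem glue_inj {t₁' t₂' : BinaryTree Unit} (h : t₁.numLeaves + t₂.numLeaves = N)
    (h' : t₁'.numLeaves + t₂'.numLeaves = N) (h1 : t₁.numLeaves = t₁'.numLeaves)
    (hg : glue h = glue h') : t₁ = t₁' ∧ t₂ = t₂' := by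
  constructor
  · refine eq_of_inTree (o := 0) h1 fun x y hxy => ?_
    have := hxy.bounds
    rwa [← glue_adj_left h', ← hg, glue_adj_left h] <;> omega
  · refine eq_of_inTree (o := t₁.numLeaves) (by omega) fun x y hxy => ?_
    have := hxy.bounds
    rw [h1]
    rwa [← glue_adj_right h', ← hg, glue_adj_right h] <;> omega

end Glue

end Triangulation

/-! ### Counting triangulations fixed by a rotation -/

open BinaryTree

/-- A set `F` with an action of the integers by rotation is `L` times as large as its subset of
elements with a marked position at `0`, if each element has exactly one mark modulo `L`. -/
theorem card_eq_mul_card_base {F : Type*} (L : ℕ) (r : ℤ → F → F)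
    (hr0 : ∀ S, r 0 S = S) (hr : ∀ a b S, r (a + b) S = r a (r b S)) (Q : F → ℤ → Prop)
    (hQ : ∀ a S i, Q (r a S) (i + a) ↔ Q S i) (hex : ∀ S, ∃ i : ℤ, 0 ≤ i ∧ i < L ∧ Q S i)
    (huniq : ∀ S (i j : ℤ), 0 ≤ i → i < j → j < L → Q S i → ¬ Q S j) :
    Nat.card F = L * Nat.card {S // Q S 0} := by
  have hb : Function.Bijective (fun p : Fin L × {S // Q S 0} => r (p.1 : ℕ) p.2.1) := by
    constructor
    · rintro ⟨i, S, hS⟩ ⟨j, S', hS'⟩ h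
      simp only at h
      have h1 : Q (r (i : ℕ) S) ((i : ℕ) : ℤ) := by
        have := (hQ (i : ℕ) S 0).2 hS
        rwa [zero_add] at this
      have h2 : Q (r (i : ℕ) S) ((j : ℕ) : ℤ) := by
        have := (hQ (j : ℕ) S' 0).2 hS'
        rwa [zero_add, ← h] at this
      have hij : i = j := by
        rcases lt_trichotomy (i : ℕ) (j : ℕ) with hlt | heq | hlt
        · exact (huniq _ _ _ (by omega) (by omega) (by omega) h1 h2).elim
        · exact Fin.ext heq
        · exact (huniq _ _ _ (by omega) (by omega) (by omega) h2 h1).elim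
      subst hij
      have : S = S' := by
        have := congrArg (r (-(i : ℕ))) h
        rwa [← hr, ← hr, neg_add_cancel, hr0, hr0] at this
      subst this
      rfl
    · intro S
      obtain ⟨i, h1, h2, h3⟩ := hex S
      obtain ⟨i, rfl⟩ := Int.eq_ofNat_of_zero_le h1
      refine ⟨⟨⟨i, by omega⟩, r (-i) S, ?_⟩, ?_⟩
      · rw [← hQ i, ← hr, add_neg_cancel, hr0, zero_add]
        exact h3
      · change r i (r (-i) S) = S
        rw [← hr, add_neg_cancel, hr0]
  rw [← Nat.card_congr (Equiv.ofBijective _ hb), Nat.card_prod, Nat.card_fin]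

namespace Triangulation

variable {N : ℕ}

instance [NeZero N] : Finite (Triangulation N) :=
  Finite.of_injective (fun S => S.Adj) fun _ _ h => Triangulation.ext h

/-- Cutting along the side (0, 1) leaves the trivial tree on one side and an arbitrary tree with n +
1 leaves on the other. -/
theorem card_eq_catalan {n : ℕ} : Nat.card (Triangulation (n + 2)) = catalan n := by
  rw [← card_numLeaves]
  refine (Nat.card_congr (Equiv.ofBijective
    (fun t : {t : BinaryTree Unit // t.numLeaves = n + 1} =>
      glue (N := n + 2) (t₁ := nil) (t₂ := t.1) (by rw [t.2, numLeaves]; ring)) ⟨?_, ?_⟩)).symm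
  · intro t t' h
    exact Subtype.ext (glue_inj _ _ rfl h).2
  · intro S
    obtain ⟨t₁, t₂, h, h1, rfl⟩ := S.exists_eq_glue (a := 1) one_pos (by omega)
      (by simpa using S.side 0)
    have : t₁ = nil := by
      cases t₁ with
      | nil => rfl
      | node v l r =>
        have := l.numLeaves_pos
        have := r.numLeaves_pos
        simp only [numLeaves] at h1
        omega
    subst this
    exact ⟨⟨t₂, by omega⟩, rfl⟩

/-- Take a shortest arc of length at least N/2. Either it is a diameter, or the apex over it splits
it into two arcs shorter than N/2, and the complementary arc is also shorter than N/2. -/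
theorem exists_center (S : Triangulation N) (hN : 3 ≤ N) :
    (∃ i L : ℤ, 2 * L = N ∧ S.Adj i (i + L : ℤ)) ∨
    ∃ i j k : ℤ, i < j ∧ j < k ∧ k < i + N ∧ S.Adj i j ∧ S.Adj j k ∧ S.Adj k i ∧
      2 * (j - i) < N ∧ 2 * (k - j) < N ∧ 2 * (i + N - k) < N := by
  classical
  have hex : ∃ m : ℕ, N ≤ 2 * m ∧ m < N ∧ ∃ p : ℤ, S.Adj p (p + m : ℤ) := by
    -- The reverse of a side is an arc of length N - 1.
    refine ⟨N - 1, by omega, by omega, 0, ?_⟩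
    have := S.symm _ _ (S.side (-1))
    rw [Nat.cast_sub (by omega)]
    simpa using this
  obtain ⟨h1, h2, p, h3⟩ := Nat.find_spec hex
  have hmin := fun m (hm : m < Nat.find hex) => Nat.find_min hex hm
  set m := Nat.find hex
  by_cases hm : 2 * m = N
  · exact Or.inl ⟨p, m, by exact_mod_cast hm, h3⟩
  · right
    obtain ⟨k, h4, h5, h6, h7⟩ := S.apex p (p + m) (by omega) (by omega) h3
    refine ⟨p, k, p + m, h4, h5, by omega, h6, h7, S.symm _ _ h3, ?_, ?_, by omega⟩
    · by_contra hc
      refine hmin (k - p).toNat (by omega) ⟨by omega, by omega, p, ?_⟩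
      rwa [show p + ((k - p).toNat : ℤ) = k by omega]
    · by_contra hc
      refine hmin (p + m - k).toNat (by omega) ⟨by omega, by omega, k, ?_⟩
      rwa [show k + ((p + m - k).toNat : ℤ) = p + m by omega]

/-- The rotated centre must not cross the centre. A diameter is then mapped to itself, and a central
triangle is permuted cyclically, which makes the rotation a half turn or a third of a turn in either
direction. -/
theorem rotation_of_fixed (S : Triangulation N) (hN : 3 ≤ N) {g : ℤ} (h0 : 0 < g) (hg : g < N)
    (hfix : ∀ x y : ℤ, S.Adj x y → S.Adj (x + g : ℤ) (y + g : ℤ)) :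
    ∃ i L : ℤ, S.Adj i (i + L : ℤ) ∧
      ((2 * L = N ∧ g = L) ∨ (3 * L = N ∧ (g = L ∨ g = 2 * L))) := by
  have eN : ∀ x : ℤ, ((x + N : ℤ) : ZMod N) = x := fun x => by simp
  have eN' : ∀ x : ℤ, ((x - N : ℤ) : ZMod N) = x := fun x => by simp
  rcases S.exists_center hN with ⟨i, L, hL, h1⟩ | ⟨i, j, k, h1, h2, h3, h4, h5, h6, h7, h8, h9⟩
  · refine ⟨i, L, h1, Or.inl ⟨hL, ?_⟩⟩
    have h2 := hfix _ _ h1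
    rcases lt_trichotomy g L with hlt | heq | hlt
    · exact (S.noncross i (i + g) (i + L) (i + L + g) (by omega) (by omega) (by omega) (by omega)
        h1 h2).elim
    · exact heq
    · refine (S.noncross i (i + L + g - N) (i + L) (i + g) (by omega) (by omega) (by omega) (by omega)
        h1 ?_).elim
      rw [eN']
      exact S.symm _ _ h2
  · have r1 := hfix _ _ h4
    have r2 := hfix _ _ h5
    have r3 := hfix _ _ h6
    have c3 : S.Adj k (i + N : ℤ) := by rwa [eN]
    have c1 : S.Adj (i + N : ℤ) (j + N : ℤ) := by rwa [eN, eN]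
    have c2 : S.Adj (j + N : ℤ) (k + N : ℤ) := by rwa [eN, eN]
    have r3' : S.Adj (k + g : ℤ) (i + g + N : ℤ) := by rwa [eN]
    -- The cases record where the corners fall after rotation; every position in which the triangle
    -- does not map to itself makes one of its sides cross a rotated side.
    rcases lt_trichotomy (i + g) j with hA | hB | hC
    · exact (S.noncross i (i + g) j (j + g) (by omega) (by omega) (by omega) (by omega) h4 r1).elim
    · rcases lt_trichotomy (j + g) k with hB1 | hB3 | hB2
      · exact (S.noncross j (j + g) k (k + g) (by omega) (by omega) (by omega) (by omega)
          h5 r2).elim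
      · rcases lt_trichotomy (k + g) (i + N) with hx | hx | hx
        · exact (S.noncross k (k + g) (i + N) (i + g + N) (by omega) (by omega) (by omega) (by omega)
            c3 r3').elim
        · exact ⟨i, g, by rwa [hB], Or.inr ⟨by omega, Or.inl rfl⟩⟩
        · rw [hB3] at r2
          exact (S.noncross k (i + N) (k + g) (j + N) (by omega) (by omega) (by omega) (by omega)
            r2 c1).elim
      · rw [hB] at r1
        exact (S.noncross j k (j + g) (i + N) (by omega) (by omega) (by omega) (by omega)
          r1 c3).elim
    · rcases lt_trichotomy (i + g) k with hC | hD | hE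
      · by_cases hx : k < j + g
        · exact (S.noncross j (i + g) k (j + g) (by omega) (by omega) (by omega) (by omega)
            h5 r1).elim
        · exact (S.noncross j (i + g) k (k + g) (by omega) (by omega) (by omega) (by omega)
            h5 (S.symm _ _ r3)).elim
      · rcases lt_trichotomy (j + g) (i + N) with hx | hx | hx
        · exact (S.noncross k (j + g) (i + N) (k + g) (by omega) (by omega) (by omega) (by omega)
            c3 r2).elim
        · rcases lt_trichotomy (k + g) (j + N) with hy | hy | hy
          · exact (S.noncross (i + N) (k + g) (j + N) (i + g + N) (by omega) (by omega) (by omega)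
              (by omega) c1 r3').elim
          · refine ⟨i, j - i, by rwa [add_sub_cancel], Or.inr ⟨by omega, Or.inr (by omega)⟩⟩
          · rw [hx] at r2
            exact (S.noncross (i + N) (j + N) (k + g) (k + N) (by omega) (by omega) (by omega)
              (by omega) r2 c2).elim
        · rw [hD] at r1
          exact (S.noncross k (i + N) (j + g) (j + N) (by omega) (by omega) (by omega) (by omega)
            r1 c1).elim
      · by_cases hx : i + N < j + g
        · exact (S.noncross k (i + g) (i + N) (j + g) (by omega) (by omega) (by omega) (by omega)
            c3 r1).elim
        · exact (S.noncross k (i + g) (i + N) (k + g) (by omega) (by omega) (by omega) (by omega)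
            c3 (S.symm _ _ r3)).elim

theorem vadd_eq_iff_adj {S : Triangulation N} {g : ℤ} :
    (g : ZMod N) +ᵥ S = S ↔ ∀ x y : ℤ, S.Adj (x + g : ℤ) (y + g : ℤ) ↔ S.Adj x y := by
  constructor
  · intro h x y
    conv_lhs => rw [← h]
    rw [vadd_adj]
    simp
  · intro h
    ext a b
    obtain ⟨x, rfl⟩ := ZMod.intCast_surjective a
    obtain ⟨y, rfl⟩ := ZMod.intCast_surjective b
    rw [vadd_adj, ← Int.cast_sub, ← Int.cast_sub, ← h, sub_add_cancel, sub_add_cancel]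

theorem adj_add_mul {S : Triangulation N} {L : ℤ} (h : (L : ZMod N) +ᵥ S = S) (c x y : ℤ) :
    S.Adj (x + L * c : ℤ) (y + L * c : ℤ) ↔ S.Adj x y := by
  have h1 : (L : ZMod N) ∈ AddAction.stabilizer (ZMod N) S := h
  have h2 : c • (L : ZMod N) ∈ AddAction.stabilizer (ZMod N) S := zsmul_mem h1 c
  have h3 : ((L * c : ℤ) : ZMod N) +ᵥ S = S := by
    have : ((L * c : ℤ) : ZMod N) = c • (L : ZMod N) := by
      rw [zsmul_eq_mul]; push_cast; ring
    rw [this]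
    exact h2
  exact vadd_eq_iff_adj.1 h3 x y

/-- Arcs of length `L` mark the centre. They exist by hypothesis, repeat with period `L`, and two of
them starting less than `L` apart would cross. -/
theorem card_fixed_eq_mul [NeZero N] {L q : ℕ} (hq : 2 ≤ q) (hL : 1 ≤ L) (hN : N = q * L)
    (hex : ∀ S : Triangulation N, ((L : ℤ) : ZMod N) +ᵥ S = S → ∃ i : ℤ, S.Adj i (i + L : ℤ)) :
    Nat.card {S : Triangulation N // ((L : ℤ) : ZMod N) +ᵥ S = S} =
      L * Nat.card {S : Triangulation N // ((L : ℤ) : ZMod N) +ᵥ S = S ∧ S.Adj (0 : ℤ) (L : ℤ)} := by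
  have h2 : 2 * L ≤ N := by rw [hN]; exact Nat.mul_le_mul_right L hq
  rw [card_eq_mul_card_base L
    (fun a (S : {S : Triangulation N // ((L : ℤ) : ZMod N) +ᵥ S = S}) =>
      (⟨(a : ZMod N) +ᵥ S.1, by rw [vadd_vadd, add_comm, ← vadd_vadd, S.2]⟩ :
        {S : Triangulation N // ((L : ℤ) : ZMod N) +ᵥ S = S}))
    ?_ ?_ (fun S i => S.1.Adj i (i + L : ℤ)) ?_ ?_ ?_]
  · congr 1
    refine Nat.card_congr ⟨fun S => ⟨S.1.1, S.1.2, by simpa using S.2⟩,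
      fun S => ⟨⟨S.1, S.2.1⟩, by simpa using S.2.2⟩, fun _ => rfl, fun _ => rfl⟩
  · intro S
    exact Subtype.ext (by simp)
  · intro a b S
    exact Subtype.ext (by simp [vadd_vadd])
  · intro a S i
    simp only [vadd_adj, ← Int.cast_sub]
    rw [add_sub_cancel_right, add_right_comm, add_sub_cancel_right]
  · rintro ⟨S, hS⟩
    obtain ⟨i, hi⟩ := hex S hS
    refine ⟨i % L, Int.emod_nonneg _ (by omega), Int.emod_lt_of_pos _ (by omega), ?_⟩
    have := adj_add_mul hS (i / L) (i % L) (i % L + L)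
    rw [add_right_comm, Int.emod_add_mul_ediv] at this
    exact this.1 hi
  · rintro ⟨S, hS⟩ i j h0 hij hj h1 h3
    exact S.noncross i j (i + L) (j + L) hij (by omega) (by omega) (by omega) h1 h3

theorem inTree_sub (t : BinaryTree Unit) (o x y c : ℤ) :
    InTree t o (x - c) (y - c) ↔ InTree t (o + c) x y := by
  rw [← inTree_add t o _ _ c, sub_add_cancel, sub_add_cancel]

theorem glue_adj_of_numLeaves {L : ℕ} {t₁ t₂ : BinaryTree Unit}
    (h : t₁.numLeaves + t₂.numLeaves = N) (h1 : t₁.numLeaves = L) :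
    (glue h).Adj (0 : ℤ) (L : ℤ) := by
  subst h1
  exact glue_adj_zero h

theorem glue_self_fixed [NeZero N] {L : ℕ} {t : BinaryTree Unit} (ht : t.numLeaves = L)
    (h : t.numLeaves + t.numLeaves = N) : ((L : ℤ) : ZMod N) +ᵥ glue h = glue h := by
  have eN : ∀ x : ℤ, ((x - L : ℤ) : ZMod N) = (x + L : ℤ) := fun x =>
    intCast_eq_iff.2 ⟨-1, by omega⟩
  have h0 := glue_adj_of_numLeaves h ht
  symm
  refine ext_of_arc (a := L) h0 ?_ ?_ ?_
  · rw [vadd_adj, ← Int.cast_sub, ← Int.cast_sub, eN, sub_self, zero_add]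
    exact (glue h).symm _ _ h0
  · intro x y hx hxy hy
    rw [vadd_adj, ← Int.cast_sub, ← Int.cast_sub, eN, eN, glue_adj_left h hx hxy (by omega),
      glue_adj_right h (by omega) (by omega) (by omega), ← inTree_add t 0 x y L, zero_add, ht]
  · intro x y hx hxy hy
    rw [vadd_adj, ← Int.cast_sub, ← Int.cast_sub,
      glue_adj_left h (x := x - L) (y := y - L) (by omega) (by omega) (by omega),
      glue_adj_right h (by omega) (by omega) (by omega), inTree_sub, zero_add, ht]

theorem eq_of_glue_fixed_half [NeZero N] {L : ℕ} {t₁ t₂ : BinaryTree Unit}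
    (h : t₁.numLeaves + t₂.numLeaves = N) (h1 : t₁.numLeaves = L) (h2 : t₂.numLeaves = L)
    (hfix : ((L : ℤ) : ZMod N) +ᵥ glue h = glue h) : t₁ = t₂ := by
  refine eq_of_inTree (o := L) (by omega) fun x y hxy => ?_
  have hb := hxy.bounds
  rw [← zero_add (L : ℤ), ← inTree_sub, ← glue_adj_left h (by omega) (by omega) (by omega),
    ← vadd_eq_iff_adj.1 hfix, sub_add_cancel, sub_add_cancel,
    glue_adj_right h (by omega) (by omega) (by omega), h1] at hxy
  exact hxy

/-- Once the diameter is (0, L), the half turn exchanges the two halves, so both carry the same tree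
with `L` leaves. -/
theorem card_fixed_half {L : ℕ} (hL : 2 ≤ L) (hN : N = 2 * L) :
    Nat.card {S : Triangulation N // ((L : ℤ) : ZMod N) +ᵥ S = S} = L * catalan (L - 1) := by
  have : NeZero N := ⟨by omega⟩
  rw [card_fixed_eq_mul le_rfl (by omega) hN]
  · congr 1
    rw [← card_numLeaves, Nat.sub_add_cancel (by omega)]
    symm
    refine Nat.card_congr (Equiv.ofBijective (fun t => ⟨glue (t₁ := t.1) (t₂ := t.1)
      (by have := t.2; omega), glue_self_fixed t.2 _, ?_⟩) ⟨?_, ?_⟩)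
    · exact glue_adj_of_numLeaves _ t.2
    · intro t t' h
      have h2 := congrArg Subtype.val h
      simp only at h2
      exact Subtype.ext (glue_inj _ _ (t.2.trans t'.2.symm) h2).1
    · rintro ⟨S, hS, h0⟩
      obtain ⟨t₁, t₂, h, h1, rfl⟩ := S.exists_eq_glue (by omega) (by omega) h0
      obtain rfl := eq_of_glue_fixed_half h h1 (by omega) hS
      exact ⟨⟨t₁, h1⟩, rfl⟩
  · intro S hS
    obtain ⟨i, M, h1, h2⟩ := S.rotation_of_fixed (by omega) (g := L) (by omega) (by omega)
      (fun x y h => (vadd_eq_iff_adj.1 hS x y).2 h)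
    obtain rfl : M = L := by omega
    exact ⟨i, h1⟩

/-- The second tree has the central triangle 0, L, 2L at its root, with a copy of `t` on each of its
other two sides. -/
theorem glue_node_fixed [NeZero N] {L : ℕ} {t : BinaryTree Unit} (ht : t.numLeaves = L)
    (h : t.numLeaves + (node () t t).numLeaves = N) :
    ((L : ℤ) : ZMod N) +ᵥ glue h = glue h := by
  have hp := t.numLeaves_pos
  have hu : (node () t t).numLeaves = L + L := by rw [numLeaves, ht]
  have eN : ∀ x : ℤ, ((x - L : ℤ) : ZMod N) = (x + L + L : ℤ) := fun x =>
    intCast_eq_iff.2 ⟨-1, by omega⟩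
  have h0 := glue_adj_of_numLeaves h ht
  have h2 : (glue h).Adj (L + L : ℤ) (L + L + L : ℤ) := by
    rw [glue_adj_right h (by omega) (by omega) (by omega), InTree.right_iff (by omega), ht]
    simpa [ht] using inTree_root t (L + L)
  have h3 : (glue h).Adj (L : ℤ) (L + L : ℤ) := by
    rw [glue_adj_right h (by omega) (by omega) (by omega), InTree.left_iff (by omega), ht]
    simpa [ht] using inTree_root t L
  have e0 : ((L + L + L : ℤ) : ZMod N) = (0 : ℤ) := intCast_eq_iff.2 ⟨1, by omega⟩
  symm
  refine ext_of_arc (a := L) h0 ?_ ?_ ?_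
  · rw [vadd_adj, ← Int.cast_sub, ← Int.cast_sub, eN, sub_self, zero_add, ← e0]
    exact h2
  · intro x y hx hxy hy
    rw [vadd_adj, ← Int.cast_sub, ← Int.cast_sub, eN, eN, glue_adj_left h hx hxy (by omega),
      glue_adj_right h (by omega) (by omega) (by omega), InTree.right_iff (by omega), ht,
      ← inTree_add t 0 x y L, ← inTree_add t _ _ _ L, zero_add]
  · intro x y hx hxy hy
    rw [vadd_adj, ← Int.cast_sub, ← Int.cast_sub]
    by_cases c1 : y ≤ L + L
    · rw [glue_adj_left h (x := x - L) (y := y - L) (by omega) (by omega) (by omega),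
        glue_adj_right h (by omega) (by omega) (by omega), InTree.left_iff (by omega), inTree_sub,
        zero_add, ht]
    by_cases c2 : (L + L : ℤ) ≤ x
    · rw [glue_adj_right h (x := x - L) (y := y - L) (by omega) (by omega) (by omega),
        glue_adj_right h (by omega) (by omega) (by omega), InTree.right_iff (by omega),
        InTree.left_iff (by omega), inTree_sub, ht]
    rcases eq_or_ne x L with rfl | c3
    · rcases eq_or_ne y (L + L + L) with rfl | c4
      · refine iff_of_true ?_ ?_
        · rw [e0]
          exact (glue h).symm _ _ h0
        · rw [sub_self, add_sub_cancel_right, ← e0]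
          exact (glue h).symm _ _ h2
      · refine iff_of_false (fun hc => ?_) (fun hc => ?_)
        · exact (glue h).noncross L (L + L) y (L + L + L) (by omega) (by omega) (by omega) (by omega)
            hc h2
        · rw [sub_self] at hc
          exact (glue h).noncross 0 L (y - L) (L + L) (by omega) (by omega) (by omega) (by omega)
            hc h3
    · refine iff_of_false (fun hc => ?_) (fun hc => ?_)
      · exact (glue h).noncross L x (L + L) y (by omega) (by omega) (by omega) (by omega) h3 hc
      · exact (glue h).noncross 0 (x - L) L (y - L) (by omega) (by omega) (by omega) (by omega)
          h0 hc

theorem eq_of_glue_fixed_third [NeZero N] {L : ℕ} {t₁ t₂ : BinaryTree Unit}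
    (h : t₁.numLeaves + t₂.numLeaves = N) (h1 : t₁.numLeaves = L) (h2 : t₂.numLeaves = L + L)
    (hfix : ((L : ℤ) : ZMod N) +ᵥ glue h = glue h) : node () t₁ t₁ = t₂ := by
  refine eq_of_inTree (o := L) (by rw [numLeaves]; omega) fun x y hxy => ?_
  have hp := t₁.numLeaves_pos
  rcases hxy with ⟨rfl, rfl⟩ | hxy | hxy
  · rw [h1]
    have := inTree_root t₂ L
    rwa [h2, Nat.cast_add, ← add_assoc] at this
  · have hb := hxy.bounds
    rw [← zero_add (L : ℤ), ← inTree_sub, ← glue_adj_left h (by omega) (by omega) (by omega),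
      ← vadd_eq_iff_adj.1 hfix, sub_add_cancel, sub_add_cancel,
      glue_adj_right h (by omega) (by omega) (by omega), h1] at hxy
    exact hxy
  · have hb := hxy.bounds
    rw [h1, ← zero_add ((L : ℤ) + L), ← inTree_sub,
      ← glue_adj_left h (by omega) (by omega) (by omega),
      ← vadd_eq_iff_adj.1 hfix, ← vadd_eq_iff_adj.1 hfix, add_assoc, add_assoc, sub_add_cancel,
      sub_add_cancel, glue_adj_right h (by omega) (by omega) (by omega), h1] at hxy
    exact hxy

/-- Once (0, L) is a side of the central triangle, the rotation carries the tree beyond this side to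
the other two sides. -/
theorem card_fixed_third {L : ℕ} (hL : 1 ≤ L) (hN : N = 3 * L) :
    Nat.card {S : Triangulation N // ((L : ℤ) : ZMod N) +ᵥ S = S} = L * catalan (L - 1) := by
  have : NeZero N := ⟨by omega⟩
  rw [card_fixed_eq_mul (by omega) (by omega) hN]
  · congr 1
    rw [← card_numLeaves, Nat.sub_add_cancel (by omega)]
    symm
    refine Nat.card_congr (Equiv.ofBijective (fun t => ⟨glue (t₁ := t.1) (t₂ := node () t.1 t.1)
      (by have := t.2; simp only [numLeaves]; omega), glue_node_fixed t.2 _, ?_⟩) ⟨?_, ?_⟩)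
    · exact glue_adj_of_numLeaves _ t.2
    · intro t t' h
      have h2 := congrArg Subtype.val h
      simp only at h2
      exact Subtype.ext (glue_inj _ _ (t.2.trans t'.2.symm) h2).1
    · rintro ⟨S, hS, h0⟩
      obtain ⟨t₁, t₂, h, h1, rfl⟩ := S.exists_eq_glue (by omega) (by omega) h0
      obtain rfl := eq_of_glue_fixed_third h h1 (by omega) hS
      exact ⟨⟨t₁, h1⟩, rfl⟩
  · intro S hS
    obtain ⟨i, M, h1, h2⟩ := S.rotation_of_fixed (by omega) (g := L) (by omega) (by omega)
      (fun x y h => (vadd_eq_iff_adj.1 hS x y).2 h)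
    obtain rfl : M = L := by omega
    exact ⟨i, h1⟩

end Triangulation

/-! ### Noncrossing matchings from binary trees -/

namespace BinaryTree

/-- The noncrossing perfect matching of the integers `o ≤ x < o + 2 * t.numNodes` that corresponds
to the binary tree `t`. -/
def matching : BinaryTree Unit → ℤ → ℤ → ℤ
  | nil, _, x => x
  | node _ l r, o, x =>
    if x = o then o + 2 * l.numNodes + 1
    else if x = o + 2 * l.numNodes + 1 then o
    else if x < o + 2 * l.numNodes + 1 then matching l (o + 1) x
    else matching r (o + 2 * l.numNodes + 2) x

section Node

variable {v : Unit} {l r : BinaryTree Unit} {o x : ℤ}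

theorem matching_node_self : matching (node v l r) o o = o + 2 * l.numNodes + 1 := by
  simp [matching]

theorem matching_node_mate : matching (node v l r) o (o + 2 * l.numNodes + 1) = o := by
  rw [matching, if_neg (by omega), if_pos rfl]

theorem matching_node_left (h1 : o < x) (h2 : x < o + 2 * l.numNodes + 1) :
    matching (node v l r) o x = matching l (o + 1) x := by
  rw [matching, if_neg (by omega), if_neg (by omega), if_pos h2]

theorem matching_node_right (h : o + 2 * l.numNodes + 1 < x) :
    matching (node v l r) o x = matching r (o + 2 * l.numNodes + 2) x := by
  rw [matching, if_neg (by omega), if_neg (by omega), if_neg (by omega)]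

end Node

theorem matching_add (t : BinaryTree Unit) (o x c : ℤ) :
    matching t (o + c) (x + c) = matching t o x + c := by
  induction t generalizing o x with
  | nil => rfl
  | node v l r hl hr =>
    simp only [matching]
    rw [add_right_comm o c 1, hl, show o + c + 2 * (l.numNodes : ℤ) + 2 = o + 2 * l.numNodes + 2 + c
      by ring, hr]
    split_ifs <;> omega

theorem matching_bounds {t : BinaryTree Unit} {o x : ℤ} (h1 : o ≤ x)
    (h2 : x < o + 2 * t.numNodes) :
    o ≤ matching t o x ∧ matching t o x < o + 2 * t.numNodes := by
  induction t generalizing o x with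
  | nil => simp only [numNodes] at h2; omega
  | node v l r hl hr =>
    simp only [numNodes] at h2 ⊢
    push_cast at h2 ⊢
    rcases eq_or_ne x o with rfl | c1
    · rw [matching_node_self]; omega
    rcases lt_trichotomy x (o + 2 * l.numNodes + 1) with c2 | rfl | c2
    · rw [matching_node_left (by omega) c2]
      have := hl (o := o + 1) (x := x) (by omega) (by omega)
      omega
    · rw [matching_node_mate]; omega
    · rw [matching_node_right c2]
      have := hr (o := o + 2 * l.numNodes + 2) (x := x) (by omega) (by omega)
      omega

theorem matching_matching {t : BinaryTree Unit} {o x : ℤ} (h1 : o ≤ x)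
    (h2 : x < o + 2 * t.numNodes) : matching t o (matching t o x) = x := by
  induction t generalizing o x with
  | nil => rfl
  | node v l r hl hr =>
    simp only [numNodes] at h2
    push_cast at h2
    rcases eq_or_ne x o with rfl | c1
    · rw [matching_node_self, matching_node_mate]
    rcases lt_trichotomy x (o + 2 * l.numNodes + 1) with c2 | rfl | c2
    · have := matching_bounds (t := l) (o := o + 1) (x := x) (by omega) (by omega)
      rw [matching_node_left (by omega) c2, matching_node_left (by omega) (by omega),
        hl (by omega) (by omega)]
    · rw [matching_node_mate, matching_node_self]
    · have := matching_bounds (t := r) (o := o + 2 * l.numNodes + 2) (x := x) (by omega) (by omega)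
      rw [matching_node_right c2, matching_node_right (by omega), hr (by omega) (by omega)]

theorem matching_ne {t : BinaryTree Unit} {o x : ℤ} (h1 : o ≤ x)
    (h2 : x < o + 2 * t.numNodes) : matching t o x ≠ x := by
  induction t generalizing o x with
  | nil => simp only [numNodes] at h2; omega
  | node v l r hl hr =>
    simp only [numNodes] at h2
    push_cast at h2
    rcases eq_or_ne x o with rfl | c1
    · rw [matching_node_self]; omega
    rcases lt_trichotomy x (o + 2 * l.numNodes + 1) with c2 | rfl | c2
    · rw [matching_node_left (by omega) c2]
      exact hl (by omega) (by omega)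
    · rw [matching_node_mate]; omega
    · rw [matching_node_right c2]
      exact hr (by omega) (by omega)

theorem matching_noncross {t : BinaryTree Unit} {o i x : ℤ} (h1 : o ≤ i) (h2 : i < x)
    (h3 : x < matching t o i) (h4 : matching t o i < matching t o x)
    (h5 : matching t o x < o + 2 * t.numNodes) : False := by
  induction t generalizing o i x with
  | nil => simp only [matching] at h3; omega
  | node v l r hl hr =>
    have b2 := matching_bounds (t := node v l r) (o := o) (x := i) (by omega) (by omega)
    simp only [numNodes] at h5
    push_cast at h5
    rcases eq_or_ne i o with rfl | c1
    · rw [matching_node_self] at h3 h4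
      rw [matching_node_left h2 h3] at h4
      have := matching_bounds (t := l) (o := i + 1) (x := x) (by omega) (by omega)
      omega
    rcases lt_trichotomy i (o + 2 * l.numNodes + 1) with c2 | rfl | c2
    · rw [matching_node_left (by omega) c2] at h3 h4
      have := matching_bounds (t := l) (o := o + 1) (x := i) (by omega) (by omega)
      rw [matching_node_left (by omega) (by omega)] at h4
      have := matching_bounds (t := l) (o := o + 1) (x := x) (by omega) (by omega)
      exact hl (by omega) h2 h3 h4 (by omega)
    · rw [matching_node_mate] at h3; omega
    · rw [matching_node_right c2] at h3 h4
      rw [matching_node_right (by omega)] at h4 h5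
      exact hr (by omega) h2 h3 h4 (by omega)

theorem eq_of_matching {t t' : BinaryTree Unit} {o : ℤ} (hn : t.numNodes = t'.numNodes)
    (h : ∀ x, o ≤ x → x < o + 2 * t.numNodes → matching t o x = matching t' o x) : t = t' := by
  induction t generalizing t' o with
  | nil =>
    cases t' with
    | nil => rfl
    | node v l r => simp [numNodes] at hn
  | node v l r hl hr =>
    cases t' with
    | nil => simp [numNodes] at hn
    | node v' l' r' =>
      simp only [numNodes] at hn h
      push_cast at h
      have h0 := h o (by omega) (by omega)
      rw [matching_node_self, matching_node_self] at h0
      have h1 : l = l' := hl (o := o + 1) (by omega) fun x hx hx' => by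
        rw [← matching_node_left (v := v) (r := r) (by omega) (by omega),
          ← matching_node_left (v := v) (r := r') (by omega) (by omega), h x (by omega) (by omega)]
      subst h1
      have h2 : r = r' := hr (o := o + 2 * l.numNodes + 2) (by omega) fun x hx hx' => by
        rw [← matching_node_right (v := v) (l := l) (by omega),
          ← matching_node_right (v := v) (l := l) (by omega), h x (by omega) (by omega)]
      rw [h2]

/-- Every noncrossing perfect matching of an interval comes from a binary tree. -/
theorem exists_matching {f : ℤ → ℤ} {a b : ℤ} (hab : a ≤ b)
    (hf : ∀ x, a ≤ x → x < b → a ≤ f x ∧ f x < b) (hff : ∀ x, a ≤ x → x < b → f (f x) = x)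
    (hne : ∀ x, a ≤ x → x < b → f x ≠ x)
    (hnc : ∀ i x, a ≤ i → i < x → x < f i → f i < f x → f x < b → False) :
    ∃ t : BinaryTree Unit, a + 2 * t.numNodes = b ∧
      ∀ x, a ≤ x → x < b → f x = matching t a x := by
  obtain ⟨m, hm⟩ : ∃ m : ℕ, b - a = m := ⟨(b - a).toNat, by omega⟩
  induction m using Nat.strong_induction_on generalizing a b with
  | _ m ih =>
    rcases hab.eq_or_lt with rfl | hlt
    · exact ⟨nil, by simp, fun x h1 h2 => by omega⟩
    obtain ⟨p1, p2⟩ := hf a le_rfl hlt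
    have p3 := hne a le_rfl hlt
    have p4 := hff a le_rfl hlt
    -- The mate of the first point separates the interval: by noncrossing, the points before it and
    -- the points after it are matched among themselves. These two parts become the two branches.
    have hin : ∀ x, a < x → x < f a → a < f x ∧ f x < f a := by
      intro x h1 h2
      have q1 := hf x (by omega) (by omega)
      have q2 := hff x (by omega) (by omega)
      have q3 : f x ≠ a := fun hc => by rw [hc] at q2; omega
      have q4 : f x ≠ f a := fun hc => by rw [hc] at q2; omega
      refine ⟨by omega, ?_⟩
      by_contra hc
      exact hnc a x le_rfl h1 h2 (by omega) q1.2
    have hout : ∀ x, f a < x → x < b → f a < f x := by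
      intro x h1 h2
      have q1 := hf x (by omega) (by omega)
      have q2 := hff x (by omega) (by omega)
      by_contra hc
      have q3 : f x ≠ a := fun hc => by rw [hc] at q2; omega
      have q4 : f x ≠ f a := fun hc => by rw [hc] at q2; omega
      have := hin (f x) (by omega) (by omega)
      omega
    obtain ⟨l, hl1, hl2⟩ := ih (f a - (a + 1)).toNat (by omega) (a := a + 1) (b := f a) (by omega)
      (fun x h1 h2 => by have := hin x (by omega) h2; omega)
      (fun x h1 h2 => hff x (by omega) (by omega)) (fun x h1 h2 => hne x (by omega) (by omega))
      (fun i x h1 h2 h3 h4 h5 => hnc i x (by omega) h2 h3 h4 (by omega)) (by omega)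
    obtain ⟨r, hr1, hr2⟩ := ih (b - (f a + 1)).toNat (by omega) (a := f a + 1) (b := b) (by omega)
      (fun x h1 h2 => by have := hout x (by omega) h2; have := hf x (by omega) h2; omega)
      (fun x h1 h2 => hff x (by omega) (by omega)) (fun x h1 h2 => hne x (by omega) (by omega))
      (fun i x h1 h2 h3 h4 h5 => hnc i x (by omega) h2 h3 h4 (by omega)) (by omega)
    have e1 : f a = a + 2 * l.numNodes + 1 := by omega
    refine ⟨node () l r, by simp only [numNodes]; push_cast; omega, fun x h1 h2 => ?_⟩
    rcases eq_or_ne x a with rfl | c1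
    · rw [matching_node_self, e1]
    rcases lt_trichotomy x (f a) with c2 | rfl | c2
    · rw [matching_node_left (by omega) (by omega), hl2 x (by omega) c2]
    · rw [p4, e1, matching_node_mate]
    · rw [matching_node_right (by omega), hr2 x (by omega) h2,
        show f a + 1 = a + 2 * l.numNodes + 2 by omega]

end BinaryTree

open BinaryTree

/-! ### Noncrossing matchings of the circle, and half turns with an odd step -/

namespace NCMatching

variable {N : ℕ}

/-- A crossing remains one when its four points are permuted cyclically, so it can be moved into the
standard interval of representatives. -/
theorem noncross_of_interval [NeZero N] {μ : ZMod N → ZMod N} (hμ : ∀ a, μ (μ a) = a)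
    (h : ∀ i x j y : ℤ, 0 ≤ i → i < x → x < j → j < y → y < N → μ i = j → μ x = y → False)
    (i x j y : ℤ) (h1 : i < x) (h2 : x < j) (h3 : j < y) (h4 : y < i + N) (h5 : μ i = j)
    (h6 : μ x = y) : False := by
  have hN : (0 : ℤ) < N := by exact_mod_cast Nat.pos_of_ne_zero (NeZero.ne N)
  have a1 := Int.emod_nonneg i hN.ne'
  have a2 := Int.emod_lt_of_pos i hN
  have a3 := Int.emod_add_mul_ediv i N
  have e : ∀ z : ℤ, ((z - N * (i / N) : ℤ) : ZMod N) = z := fun z => by simp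
  have e' : ∀ z : ℤ, ((z - N * (i / N) - N : ℤ) : ZMod N) = z := fun z => by simp
  have h5' : μ j = i := by rw [← h5, hμ]
  have h6' : μ y = x := by rw [← h6, hμ]
  set c := N * (i / N)
  by_cases c1 : y - c < N
  · exact h (i - c) (x - c) (j - c) (y - c) (by omega) (by omega) (by omega) (by omega) c1
      (by rwa [e, e]) (by rwa [e, e])
  by_cases c2 : j - c < N
  · exact h (y - c - N) (i - c) (x - c) (j - c) (by omega) (by omega) (by omega) (by omega)
      (by omega) (by rwa [e', e]) (by rwa [e, e])
  by_cases c3 : x - c < N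
  · exact h (j - c - N) (y - c - N) (i - c) (x - c) (by omega) (by omega) (by omega) (by omega)
      (by omega) (by rwa [e', e]) (by rwa [e', e])
  · exact h (x - c - N) (j - c - N) (y - c - N) (i - c) (by omega) (by omega) (by omega)
      (by omega) (by omega) (by rwa [e', e']) (by rwa [e', e])

instance [NeZero N] : Finite (NCMatching N) :=
  Finite.of_injective (fun m => m.μ) fun _ _ h => NCMatching.ext h

theorem μ_eq_comm (m : NCMatching N) {a b : ZMod N} (h : m.μ a = b) : m.μ b = a := by
  rw [← h, m.μ_μ]

theorem exists_lt_cast [NeZero N] (a : ZMod N) : ∃ x : ℤ, 0 ≤ x ∧ x < N ∧ (x : ZMod N) = a :=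
  ⟨a.val, by positivity, by exact_mod_cast a.val_lt, by simp⟩

theorem val_intCast_of_lt [NeZero N] {x : ℤ} (h0 : 0 ≤ x) (h1 : x < N) :
    ((x : ZMod N).val : ℤ) = x := by
  rw [ZMod.val_intCast, Int.emod_eq_of_lt h0 h1]

/-- The noncrossing matching of the circle that corresponds to a binary tree. -/
def ofTree [NeZero N] {t : BinaryTree Unit} (h : 2 * t.numNodes = N) : NCMatching N where
  μ a := (matching t 0 (a.val : ℤ) : ℤ)
  μ_μ a := by
    have h1 := a.val_lt
    have h2 := matching_bounds (t := t) (o := 0) (x := a.val) (by omega) (by omega)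
    rw [val_intCast_of_lt h2.1 (by omega), matching_matching (by omega) (by omega)]
    simp
  μ_ne a ha := by
    have h1 := a.val_lt
    have h2 := matching_bounds (t := t) (o := 0) (x := a.val) (by omega) (by omega)
    refine matching_ne (t := t) (o := 0) (x := a.val) (by omega) (by omega)
      (eq_of_intCast_eq (N := N) ?_ (by omega) (by omega))
    rw [ha]
    simp
  noncross := by
    refine noncross_of_interval (μ := fun a : ZMod N => ((matching t 0 (a.val : ℤ) : ℤ) : ZMod N)) ?_ ?_
    · intro a
      have h1 := a.val_lt
      have h2 := matching_bounds (t := t) (o := 0) (x := a.val) (by omega) (by omega)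
      rw [val_intCast_of_lt h2.1 (by omega), matching_matching (by omega) (by omega)]
      simp
    · intro i x j y h0 h1 h2 h3 h4 h5 h6
      rw [val_intCast_of_lt (by omega) (by omega)] at h5 h6
      have b1 := matching_bounds (t := t) (o := 0) (x := i) (by omega) (by omega)
      have b2 := matching_bounds (t := t) (o := 0) (x := x) (by omega) (by omega)
      have e1 := eq_of_intCast_eq h5 (by omega) (by omega)
      have e2 := eq_of_intCast_eq h6 (by omega) (by omega)
      exact matching_noncross (t := t) (o := 0) (i := i) (x := x) h0 h1 (by omega) (by omega)
        (by omega)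

theorem ofTree_μ [NeZero N] {t : BinaryTree Unit} (h : 2 * t.numNodes = N) {x : ℤ} (h0 : 0 ≤ x)
    (h1 : x < N) : (ofTree h).μ x = (matching t 0 x : ℤ) := by
  change (matching t 0 ((x : ZMod N).val : ℤ) : ZMod N) = _
  rw [val_intCast_of_lt h0 h1]

theorem exists_eq_ofTree [NeZero N] (m : NCMatching N) :
    ∃ (t : BinaryTree Unit) (h : 2 * t.numNodes = N), m = ofTree h := by
  have hlt : ∀ a : ZMod N, (a.val : ℤ) < N := fun a => by exact_mod_cast a.val_lt
  obtain ⟨t, h1, h2⟩ := exists_matching (f := fun x => ((m.μ x).val : ℤ)) (a := 0) (b := N)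
    (by omega) (fun x _ _ => ⟨by omega, hlt _⟩)
    (fun x h0 h1 => by simp [m.μ_μ, val_intCast_of_lt h0 h1])
    (fun x h0 h1 hx => m.μ_ne x (by
      have := congrArg (fun z : ℤ => (z : ZMod N)) hx
      simpa using this))
    (fun i x h0 h1 h2 h3 h4 => m.noncross i x _ _ h1 h2 h3 (by omega) (by simp) (by simp))
  have h : 2 * t.numNodes = N := by omega
  refine ⟨t, h, NCMatching.ext (funext fun a => ?_)⟩
  obtain ⟨x, hx0, hx1, rfl⟩ := exists_lt_cast a
  rw [ofTree_μ h hx0 hx1, ← h2 x hx0 hx1]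
  simp

theorem ofTree_inj [NeZero N] {t t' : BinaryTree Unit} (h : 2 * t.numNodes = N)
    (h' : 2 * t'.numNodes = N) (he : ofTree h = ofTree h') : t = t' := by
  refine eq_of_matching (o := 0) (by omega) fun x h0 h1 => ?_
  have b1 := matching_bounds (t := t) h0 h1
  have b2 := matching_bounds (t := t') (o := 0) (x := x) h0 (by omega)
  refine eq_of_intCast_eq (N := N) ?_ (by omega) (by omega)
  rw [← ofTree_μ h h0 (by omega), ← ofTree_μ h' h0 (by omega), he]

theorem card_eq_catalan {m : ℕ} (hm : 1 ≤ m) (hN : N = 2 * m) :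
    Nat.card (NCMatching N) = catalan m := by
  have : NeZero N := ⟨by omega⟩
  rw [← card_numNodes]
  refine (Nat.card_congr (Equiv.ofBijective
    (fun t : {t : BinaryTree Unit // t.numNodes = m} =>
      ofTree (N := N) (t := t.1) (by rw [t.2, hN])) ⟨?_, ?_⟩)).symm
  · intro t t' h
    exact Subtype.ext (ofTree_inj _ _ h)
  · intro M
    obtain ⟨t, h, rfl⟩ := M.exists_eq_ofTree
    exact ⟨⟨t, by omega⟩, rfl⟩

theorem vadd_eq_iff {m : NCMatching N} {g : ℤ} :
    (g : ZMod N) +ᵥ m = m ↔ ∀ x : ℤ, m.μ (x + g : ℤ) = m.μ x + g := by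
  constructor
  · intro h x
    conv_lhs => rw [← h]
    rw [vadd_μ]
    simp
  · intro h
    ext a
    obtain ⟨x, rfl⟩ := ZMod.intCast_surjective a
    rw [vadd_μ, ← Int.cast_sub, ← h, sub_add_cancel]

theorem μ_add_mul {m : NCMatching N} {L : ℤ} (h : (L : ZMod N) +ᵥ m = m) (c x : ℤ) :
    m.μ (x + L * c : ℤ) = m.μ x + (L * c : ℤ) := by
  have h1 : (L : ZMod N) ∈ AddAction.stabilizer (ZMod N) m := h
  have h2 : c • (L : ZMod N) ∈ AddAction.stabilizer (ZMod N) m := zsmul_mem h1 c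
  have h3 : ((L * c : ℤ) : ZMod N) +ᵥ m = m := by
    have : ((L * c : ℤ) : ZMod N) = c • (L : ZMod N) := by
      rw [zsmul_eq_mul]; push_cast; ring
    rw [this]
    exact h2
  exact vadd_eq_iff.1 h3 x

/-- A matched pair cuts off an even number of points. -/
theorem even_of_μ_eq (m : NCMatching N) {i j : ℤ} (h1 : i < j) (h2 : j < i + N)
    (h : m.μ i = j) : Even (j - i - 1) := by
  have hN : (0 : ℤ) < N := by omega
  have : NeZero N := ⟨by omega⟩
  -- `f x + i` is the representative of the mate of x in the turn that starts at i.
  choose f hf0 hf1 hf2 using fun x : ℤ => exists_lt_cast (N := N) (m.μ x - i)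
  have hg : ∀ x : ℤ, ((f x + i : ℤ) : ZMod N) = m.μ x := fun x => by
    push_cast; rw [hf2]; ring
  have hj : m.μ j = i := m.μ_eq_comm h
  have key : ∀ x : ℤ, i < x → x < j → i < f x + i ∧ f x + i < j := by
    intro x h3 h4
    have e0 := hf0 x
    have e1 := hf1 x
    have n1 : f x + i ≠ i := fun hc => by
      have := hg x
      rw [hc] at this
      have := m.μ_eq_comm this.symm
      rw [h] at this
      have := eq_of_intCast_eq this (by omega) (by omega)
      omega
    have n2 : f x + i ≠ j := fun hc => by
      have := hg x
      rw [hc] at this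
      have := m.μ_eq_comm this.symm
      rw [hj] at this
      have := eq_of_intCast_eq this (by omega) (by omega)
      omega
    refine ⟨by omega, ?_⟩
    by_contra hc
    exact m.noncross i x j (f x + i) h3 h4 (by omega) (by omega) h (hg x).symm
  obtain ⟨t, ht, -⟩ := exists_matching (f := fun x => f x + i) (a := i + 1) (b := j) (by omega)
    (fun x h3 h4 => by have := key x (by omega) h4; omega)
    (fun x h3 h4 => by
      have k1 := key x (by omega) h4
      have k2 := key (f x + i) k1.1 k1.2
      refine eq_of_intCast_eq (N := N) ?_ (by omega) (by omega)
      rw [hg, hg, m.μ_μ])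
    (fun x h3 h4 hx => m.μ_ne x (by rw [← hg, hx]))
    (fun a x h3 h4 h5 h6 h7 => m.noncross a x (f a + i) (f x + i) h4 h5 h6 (by omega) (hg a).symm
      (hg x).symm)
  exact ⟨t.numNodes, by omega⟩

/-- Without fixed points the involution would pair off the ones in a sum over `ZMod 2`. -/
theorem _root_.exists_fixed_of_odd_card {α : Type*} [Fintype α] (h : Odd (Fintype.card α))
    (f : α → α) (hf : ∀ a, f (f a) = a) : ∃ a, f a = a := by
  by_contra! hc
  have h1 : ∑ _a : α, (1 : ZMod 2) = 0 :=
    Finset.sum_involution (fun a _ => f a) (fun _ _ => by decide) (fun a _ _ => hc a) (fun _ _ => by simp)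
      (fun a _ => hf a)
  rw [Finset.sum_const, Finset.card_univ, nsmul_one, ZMod.natCast_eq_zero_iff_even] at h1
  exact (Nat.not_even_iff_odd.2 h) h1

/-- The matching descends to an involution of `ZMod d`, which has a fixed point as d is odd. There
the mate is congruent to the point modulo d but different from it, so it is the antipode. -/
theorem exists_diameter {d : ℕ} (hd : Odd d) (hN : N = 2 * d) {m : NCMatching N}
    (hm : ((d : ℤ) : ZMod N) +ᵥ m = m) : ∃ i : ℤ, m.μ i = (i + d : ℤ) := by
  have : NeZero d := ⟨by rintro rfl; simp at hd⟩
  choose g hg using fun x : ℤ => ZMod.intCast_surjective (m.μ x)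
  have key : ∀ x y : ℤ, (x : ZMod d) = y → ((g x : ℤ) : ZMod d) = g y := by
    intro x y hxy
    obtain ⟨c, rfl⟩ := intCast_eq_iff.1 hxy
    have := μ_add_mul hm c y
    rw [← hg, ← hg, ← Int.cast_add] at this
    obtain ⟨c', hc'⟩ := intCast_eq_iff.1 this
    refine intCast_eq_iff.2 ⟨c + 2 * c', ?_⟩
    rw [hc', hN]
    push_cast
    ring
  obtain ⟨a, ha⟩ := exists_fixed_of_odd_card (α := ZMod d) (by rwa [ZMod.card])
    (fun a => g a.val) (fun a => by
      have h1 : ((g a.val : ℤ) : ZMod d) = (((g a.val : ZMod d).val : ℤ) : ZMod d) := by simp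
      rw [← key _ _ h1]
      have h2 : ((g (g a.val) : ℤ) : ZMod N) = ((a.val : ℤ) : ZMod N) := by
        rw [hg, hg, m.μ_μ]
      obtain ⟨c, hc⟩ := intCast_eq_iff.1 h2
      rw [hc, hN]
      push_cast
      simp)
  refine ⟨a.val, ?_⟩
  have h1 : ((g a.val : ℤ) : ZMod d) = ((a.val : ℤ) : ZMod d) := by rw [ha]; simp
  obtain ⟨c, hc⟩ := intCast_eq_iff.1 h1
  rw [← hg]
  rcases Int.even_or_odd' c with ⟨b, rfl | rfl⟩
  · exfalso
    refine m.μ_ne ((a.val : ℤ) : ZMod N) ?_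
    rw [← hg]
    exact intCast_eq_iff.2 ⟨b, by rw [hc, hN]; push_cast; ring⟩
  · exact intCast_eq_iff.2 ⟨b, by rw [hc, hN]; push_cast; ring⟩

theorem ofTree_node_fixed [NeZero N] {d : ℕ} {t : BinaryTree Unit} (ht : 2 * t.numNodes + 1 = d)
    (h : 2 * (node () t t).numNodes = N) : ((d : ℤ) : ZMod N) +ᵥ ofTree h = ofTree h := by
  have hn : N = 2 * d := by rw [← h, numNodes]; omega
  have eN : ∀ x : ℤ, ((x + d + d : ℤ) : ZMod N) = x := fun x =>
    intCast_eq_iff.2 ⟨1, by omega⟩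
  have key : ∀ x : ℤ, 0 ≤ x → x < d → (ofTree h).μ (x + d : ℤ) = (ofTree h).μ x + (d : ℤ) := by
    intro x h0 h1
    rw [ofTree_μ h (x := x + d) (by omega) (by omega), ofTree_μ h h0 (by omega), ← Int.cast_add]
    rcases eq_or_ne x 0 with rfl | hx
    · rw [matching_node_self, show 0 + (d : ℤ) = 0 + 2 * t.numNodes + 1 by omega,
        matching_node_mate, ← eN 0]
      congr 1
      omega
    · rw [matching_node_right (by omega), matching_node_left (by omega) (by omega),
        show (0 + 2 * t.numNodes + 2 : ℤ) = 0 + 1 + d by omega, matching_add]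
  rw [vadd_eq_iff]
  intro x
  obtain ⟨z, hz0, hz1, hz⟩ := exists_lt_cast (x : ZMod N)
  rw [Int.cast_add, ← hz, ← Int.cast_add]
  by_cases c : z < d
  · exact key z hz0 c
  · have := key (z - d) (by omega) (by omega)
    rw [sub_add_cancel] at this
    rw [this, add_assoc, ← Int.cast_add, show ((d + d : ℤ) : ZMod N) = 0 by simpa using eN 0,
      add_zero]
    congr 1
    rw [← eN (z - d), sub_add_cancel]

/-- The diameter from 0 to d is the root pair, and the half turn carries the matching enclosed by it
to the one outside. -/
theorem eq_node_of_fixed [NeZero N] {d : ℕ} {t : BinaryTree Unit} (h : 2 * t.numNodes = N)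
    (hd : N = 2 * d) (hfix : ((d : ℤ) : ZMod N) +ᵥ ofTree h = ofTree h)
    (h0 : (ofTree h).μ (0 : ℤ) = (d : ℤ)) :
    ∃ l : BinaryTree Unit, 2 * l.numNodes + 1 = d ∧ t = node () l l := by
  have hN := NeZero.ne N
  cases t with
  | nil => simp [numNodes] at h; omega
  | node v l r =>
    have hn := h
    simp only [numNodes] at hn
    rw [ofTree_μ h le_rfl (by omega), matching_node_self] at h0
    have e := eq_of_intCast_eq h0 (by omega) (by omega)
    refine ⟨l, by omega, ?_⟩
    congr 1
    symm
    refine eq_of_matching (o := 0 + 1) (by omega) fun x hx hx' => ?_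
    have := vadd_eq_iff.1 hfix x
    rw [ofTree_μ h (by omega) (by omega), ofTree_μ h (by omega) (by omega),
      matching_node_right (by omega), matching_node_left (by omega) (by omega),
      show (0 + 2 * l.numNodes + 2 : ℤ) = 0 + 1 + d by omega, matching_add, ← Int.cast_add] at this
    have b1 := matching_bounds (t := l) (o := 0 + 1) (x := x) hx hx'
    have b2 := matching_bounds (t := r) (o := 0 + 1) (x := x) hx (by omega)
    have := eq_of_intCast_eq this (by omega) (by omega)
    omega

/-- The diameter has d possible positions, since two diameters cross; what remains is a free choice
of matching on the 2k points on one side. -/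
theorem card_fixed_odd {d k : ℕ} (hd : d = 2 * k + 1) (hN : N = 2 * d) :
    Nat.card {m : NCMatching N // ((d : ℤ) : ZMod N) +ᵥ m = m} = d * catalan k := by
  have : NeZero N := ⟨by omega⟩
  rw [card_eq_mul_card_base d
    (fun a (S : {m : NCMatching N // ((d : ℤ) : ZMod N) +ᵥ m = m}) =>
      (⟨(a : ZMod N) +ᵥ S.1, by rw [vadd_vadd, add_comm, ← vadd_vadd, S.2]⟩ :
        {m : NCMatching N // ((d : ℤ) : ZMod N) +ᵥ m = m}))
    ?_ ?_ (fun S i => S.1.μ i = (i + d : ℤ)) ?_ ?_ ?_]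
  · congr 1
    rw [← card_numNodes]
    symm
    refine Nat.card_congr (Equiv.ofBijective (fun t : {t : BinaryTree Unit // t.numNodes = k} =>
      ⟨⟨ofTree (t := node () t.1 t.1) (by have := t.2; simp only [numNodes]; omega),
        ofTree_node_fixed (by have := t.2; omega) _⟩, ?_⟩) ⟨?_, ?_⟩)
    · simp only
      rw [ofTree_μ _ le_rfl (by omega), matching_node_self]
      have := t.2
      congr 1
      omega
    · intro t t' h
      have h2 := congrArg (fun S => S.1.1) h
      simp only at h2
      have := ofTree_inj _ _ h2
      simp only [node.injEq] at this
      exact Subtype.ext this.2.1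
    · rintro ⟨⟨S, hS⟩, h0⟩
      obtain ⟨t, h, rfl⟩ := S.exists_eq_ofTree
      obtain ⟨l, h1, rfl⟩ := eq_node_of_fixed h hN hS (by simpa using h0)
      exact ⟨⟨l, by omega⟩, rfl⟩
  · intro S
    exact Subtype.ext (by simp)
  · intro a b S
    exact Subtype.ext (by simp [vadd_vadd])
  · intro a S i
    simp only [vadd_μ, ← Int.cast_sub]
    rw [add_sub_cancel_right, ← eq_sub_iff_add_eq, ← Int.cast_sub, add_right_comm,
      add_sub_cancel_right]
  · rintro ⟨S, hS⟩
    obtain ⟨i, hi⟩ := exists_diameter ⟨k, hd⟩ hN hS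
    refine ⟨i % d, Int.emod_nonneg _ (by omega), Int.emod_lt_of_pos _ (by omega), ?_⟩
    have := μ_add_mul hS (i / d) (i % d)
    rw [Int.emod_add_mul_ediv, hi, ← sub_eq_iff_eq_add, ← Int.cast_sub] at this
    simp only
    rw [← this]
    congr 1
    have := Int.emod_add_mul_ediv i d
    omega
  · rintro ⟨S, hS⟩ i j h0 hij hj h1 h3
    exact S.noncross i j (i + d) (j + d) hij (by omega) (by omega) (by omega) h1 h3

end NCMatching

/-! ### Periodic matchings of the integers and lattice paths -/

/-- The noncrossing perfect matchings of the integers that have period `d` and match each integer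
at a distance less than `d`. -/
structure IsPeriodicMatching (d : ℕ) (f : ℤ → ℤ) : Prop where
  sub_lt : ∀ i, i - d < f i
  lt_add : ∀ i, f i < i + d
  ne : ∀ i, f i ≠ i
  inv : ∀ i, f (f i) = i
  add : ∀ i, f (i + d) = f i + d
  noncross : ∀ i x, i < x → x < f i → f i < f x → False

/-- `Matched h i j` says that `j` is the first down step after `i` by which the path `h` returns to
its height at `i`. -/
def Matched (h : ℤ → ℤ) (i j : ℤ) : Prop :=
  i < j ∧ h (j + 1) = h i ∧ ∀ k, i < k → k ≤ j → h i < h k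

namespace Matched

variable {h : ℤ → ℤ} {i j i' j' : ℤ}

theorem right_unique (h1 : Matched h i j) (h2 : Matched h i j') : j = j' := by
  rcases lt_trichotomy j j' with c | c | c
  · have := h2.2.2 (j + 1) (by have := h1.1; omega) (by omega)
    have := h1.2.1
    omega
  · exact c
  · have := h1.2.2 (j' + 1) (by have := h2.1; omega) (by omega)
    have := h2.2.1
    omega

theorem left_unique (h1 : Matched h i j) (h2 : Matched h i' j) : i = i' := by
  have a1 := h1.2.1
  have a2 := h2.2.1
  rcases lt_trichotomy i i' with c | c | c
  · have := h1.2.2 i' c h2.1.le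
    omega
  · exact c
  · have := h2.2.2 i c h1.1.le
    omega

theorem not_cross (h1 : Matched h i j) (h2 : Matched h i' j') (a1 : i < i') (a2 : i' < j)
    (a3 : j < j') : False := by
  have b1 := h1.2.2 i' a1 a2.le
  have b2 := h2.2.2 (j + 1) (by omega) (by omega)
  have b3 := h1.2.1
  omega

theorem add_period {d : ℤ} (hd : ∀ k, h (k + d) = h k) (h1 : Matched h i j) :
    Matched h (i + d) (j + d) := by
  refine ⟨by have := h1.1; omega, ?_, fun k hk hk' => ?_⟩
  · rw [add_right_comm, hd, hd, h1.2.1]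
  · rw [hd, ← sub_add_cancel k d, hd]
    exact h1.2.2 _ (by omega) (by omega)

/-- By periodicity the path is back at height h i at time i + d at the latest, so a first return
exists. -/
theorem exists_right {d : ℕ} (hstep : ∀ k, h (k + 1) = h k + 1 ∨ h (k + 1) = h k - 1)
    (hd : ∀ k, h (k + d) = h k) (hd0 : 1 ≤ d) (hi : h (i + 1) = h i + 1) :
    ∃ j, Matched h i j ∧ j < i + d := by
  classical
  have hex : ∃ n : ℕ, h (i + 1 + n) ≤ h i := ⟨d - 1, by
    rw [show i + 1 + ((d - 1 : ℕ) : ℤ) = i + d by omega, hd]⟩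
  have h1 := Nat.find_spec hex
  have h2 := fun m (hm : m < Nat.find hex) => Nat.find_min hex hm
  have h3 : Nat.find hex ≤ d - 1 := Nat.find_min' hex (by
    rw [show i + 1 + ((d - 1 : ℕ) : ℤ) = i + d by omega, hd])
  set n := Nat.find hex
  have h0 : n ≠ 0 := fun hc => by
    rw [hc] at h1
    simp only [Nat.cast_zero, add_zero] at h1
    omega
  have h4 : ∀ k, i < k → k ≤ i + n → h i < h k := by
    intro k hk hk'
    have := h2 (k - i - 1).toNat (by omega)
    rw [show i + 1 + ((k - i - 1).toNat : ℤ) = k by omega] at this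
    omega
  refine ⟨i + n, ⟨by omega, ?_, h4⟩, by omega⟩
  have h5 := h4 (i + n) (by omega) le_rfl
  have h6 := hstep (i + n)
  rw [add_right_comm] at h1
  omega

/-- The reflection k ↦ -k of the path exchanges up and down steps. -/
theorem exists_left {d : ℕ} (hstep : ∀ k, h (k + 1) = h k + 1 ∨ h (k + 1) = h k - 1)
    (hd : ∀ k, h (k + d) = h k) (hd0 : 1 ≤ d) (hj : h (j + 1) = h j - 1) :
    ∃ i, Matched h i j ∧ j - d < i := by
  obtain ⟨j', ⟨h1, h2, h3⟩, h4⟩ := exists_right (h := fun k => h (-k)) (i := -(j + 1)) (d := d)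
    (fun k => by
      have := hstep (-(k + 1))
      rw [show -(k + 1) + 1 = -k by ring] at this
      omega)
    (fun k => by
      have := hd (-(k + d))
      rw [show -(k + (d : ℤ)) + d = -k by ring] at this
      exact this.symm)
    hd0 (by
      simp only [neg_add_rev, neg_neg]
      rw [show -1 + (j + 1) = j by ring]
      omega)
  simp only [neg_neg] at h2 h3
  refine ⟨-(j' + 1), ⟨by omega, h2.symm, fun k hk hk' => ?_⟩, by omega⟩
  have := h3 (-k) (by omega) (by omega)
  rwa [neg_neg, ← h2] at this

end Matched

open Classical in
/-- The step of the path with set of up steps `O`. -/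
def stepOf {d : ℕ} (O : Finset (ZMod d)) (k : ℤ) : ℤ := if (k : ZMod d) ∈ O then 1 else -1

/-- `h` is a path with set of up steps `O`. -/
def IsPath {d : ℕ} (O : Finset (ZMod d)) (h : ℤ → ℤ) : Prop := ∀ k, h (k + 1) = h k + stepOf O k

namespace IsPath

variable {d : ℕ} {O : Finset (ZMod d)} {h : ℤ → ℤ}

theorem up (hp : IsPath O h) {k : ℤ} (hk : (k : ZMod d) ∈ O) : h (k + 1) = h k + 1 := by
  rw [hp, stepOf, if_pos hk]

theorem down (hp : IsPath O h) {k : ℤ} (hk : (k : ZMod d) ∉ O) : h (k + 1) = h k - 1 := by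
  rw [hp, stepOf, if_neg hk, sub_eq_add_neg]

theorem up_or_down (hp : IsPath O h) (k : ℤ) : h (k + 1) = h k + 1 ∨ h (k + 1) = h k - 1 := by
  by_cases hk : (k : ZMod d) ∈ O
  · exact Or.inl (hp.up hk)
  · exact Or.inr (hp.down hk)

theorem left_mem (hp : IsPath O h) {i j : ℤ} (hm : Matched h i j) : (i : ZMod d) ∈ O := by
  by_contra hc
  have := hp.down hc
  have := hm.2.2 (i + 1) (by omega) (by have := hm.1; omega)
  omega

theorem right_notMem (hp : IsPath O h) {i j : ℤ} (hm : Matched h i j) : (j : ZMod d) ∉ O := by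
  intro hc
  have := hp.up hc
  have := hm.2.2 j hm.1 le_rfl
  have := hm.2.1
  omega

/-- Equally many up and down steps per period make the total displacement zero. -/
theorem exists_of_card (hd : 1 ≤ d) (hO : 2 * O.card = d) :
    ∃ h, IsPath O h ∧ ∀ k, h (k + d) = h k := by
  classical
  have : NeZero d := ⟨by omega⟩
  obtain ⟨h, h0, h1, h2⟩ := exists_int_sum (stepOf O)
  refine ⟨h, h1, ?_⟩
  have hper : ∀ k : ℤ, stepOf O (k + d) = stepOf O k := fun k => by simp [stepOf]
  have hsum : h d = 0 := by
    rw [h2]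
    have e1 : ∑ k ∈ Finset.range d, stepOf O k = ∑ a : ZMod d, stepOf O a.val := by
      refine Finset.sum_bij' (fun k _ => (k : ZMod d)) (fun a _ => a.val) (by simp)
        (fun a _ => by simpa using a.val_lt) (fun k hk => ?_) (fun a _ => by simp) (fun k hk => ?_)
      · exact ZMod.val_natCast_of_lt (by simpa using hk)
      · rw [ZMod.val_natCast_of_lt (by simpa using hk)]
    rw [e1]
    have e2 : ∀ a : ZMod d, stepOf O a.val = 2 * (if a ∈ O then 1 else 0) - 1 := fun a => by
      rw [stepOf, Int.cast_natCast, ZMod.natCast_zmod_val]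
      split_ifs <;> norm_num
    simp only [e2]
    rw [Finset.sum_sub_distrib, ← Finset.mul_sum, Finset.sum_ite_mem]
    simp only [Finset.univ_inter, Finset.sum_const, Finset.card_univ, ZMod.card]
    simp only [nsmul_eq_mul, mul_one]
    omega
  intro k
  induction k using Int.induction_on with
  | zero => rw [zero_add, hsum, h0]
  | succ k ih => rw [add_right_comm, h1, h1, ih, hper]
  | pred k ih =>
    have a1 := h1 (-(k : ℤ) - 1 + d)
    have a2 := h1 (-(k : ℤ) - 1)
    rw [hper, show -(k : ℤ) - 1 + d + 1 = -k + d by ring, ih] at a1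
    rw [sub_add_cancel] at a2
    omega

end IsPath

namespace IsPeriodicMatching

variable {d : ℕ} {f g : ℤ → ℤ}

theorem add_mul (hf : IsPeriodicMatching d f) (x c : ℤ) : f (x + d * c) = f x + d * c :=
  int_mul_add_of_add hf.add x c

theorem pos (hf : IsPeriodicMatching d f) : 1 ≤ d := by
  have := hf.sub_lt 0
  have := hf.lt_add 0
  have := hf.ne 0
  omega

open Classical in
/-- The residues of the left ends of the matched pairs. -/
def openers (d : ℕ) [NeZero d] (f : ℤ → ℤ) : Finset (ZMod d) :=
  Finset.univ.filter fun a => (a.val : ℤ) < f a.val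

theorem mem_openers [NeZero d] (hf : IsPeriodicMatching d f) (x : ℤ) :
    (x : ZMod d) ∈ openers d f ↔ x < f x := by
  simp only [openers, Finset.mem_filter, Finset.mem_univ, true_and, ZMod.val_intCast]
  have h1 := hf.add_mul (x % d) (x / d)
  have h2 := Int.emod_add_mul_ediv x d
  rw [h2] at h1
  omega

/-- Taking mates exchanges left ends and right ends. -/
theorem card_openers [NeZero d] (hf : IsPeriodicMatching d f) :
    2 * (openers d f).card = d := by
  classical
  have key : ∀ a : ZMod d, ((f ((f a.val : ℤ) : ZMod d).val : ℤ) : ZMod d) = a := by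
    intro a
    rw [ZMod.val_intCast]
    have h1 := hf.add_mul (f a.val % d) (f a.val / d)
    rw [Int.emod_add_mul_ediv, hf.inv] at h1
    have h2 : f (f a.val % d) = a.val - d * (f a.val / d) := by omega
    rw [h2]
    simp
  have hmem : ∀ a : ZMod d, ((f a.val : ℤ) : ZMod d) ∈ openers d f ↔ a ∉ openers d f := by
    intro a
    have h0 : ((a.val : ℤ) : ZMod d) = a := by simp
    rw [hf.mem_openers, hf.inv, ← h0, hf.mem_openers, h0]
    have := hf.ne a.val
    omega
  have hc : (openers d f).card = (openers d f)ᶜ.card := by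
    refine Finset.card_bij' (fun a _ => ((f a.val : ℤ) : ZMod d))
      (fun a _ => ((f a.val : ℤ) : ZMod d)) ?_ ?_ (fun a _ => key a) (fun a _ => key a)
    · intro a ha
      rw [Finset.mem_compl, hmem, not_not]
      exact ha
    · intro a ha
      rw [hmem]
      exact Finset.mem_compl.1 ha
  have := Finset.card_add_card_compl (openers d f)
  rw [ZMod.card] at this
  omega

theorem closed_inside (hf : IsPeriodicMatching d f) {i x : ℤ} (h1 : i < x) (h2 : x < f i) :
    i < f x ∧ f x < f i := by
  have q2 := hf.inv x
  have q5 := hf.inv i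
  have q3 : f x ≠ i := fun hc => by rw [hc] at q2; omega
  have q4 : f x ≠ f i := fun hc => by rw [hc] at q2; omega
  constructor
  · by_contra hc
    exact hf.noncross (f x) i (by omega) (by omega) (by omega)
  · by_contra hc
    exact hf.noncross i x h1 h2 (by omega)

/-- An interval closed under `f` is an up step, a closed interval, a down step and a further closed
interval; induction shows that the path returns to its initial height without going below it. -/
theorem height_of_closed [NeZero d] (hf : IsPeriodicMatching d f) {h : ℤ → ℤ}
    (hp : IsPath (openers d f) h) {a b : ℤ} (hab : a ≤ b)
    (hcl : ∀ x, a ≤ x → x < b → a ≤ f x ∧ f x < b) :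
    h b = h a ∧ ∀ k, a ≤ k → k ≤ b → h a ≤ h k := by
  obtain ⟨m, hm⟩ : ∃ m : ℕ, b - a = m := ⟨(b - a).toNat, by omega⟩
  induction m using Nat.strong_induction_on generalizing a b with
  | _ m ih =>
    rcases hab.eq_or_lt with rfl | hlt
    · exact ⟨rfl, fun k h1 h2 => by rw [le_antisymm h1 h2]⟩
    obtain ⟨p1, p2⟩ := hcl a le_rfl hlt
    have p3 := hf.ne a
    have p4 := hf.inv a
    obtain ⟨l1, l2⟩ := ih (f a - (a + 1)).toNat (by omega) (a := a + 1) (b := f a) (by omega)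
      (fun x h1 h2 => by have := hf.closed_inside (i := a) (x := x) (by omega) h2; omega) (by omega)
    obtain ⟨r1, r2⟩ := ih (b - (f a + 1)).toNat (by omega) (a := f a + 1) (b := b) (by omega)
      (fun x h1 h2 => by
        have q1 := hcl x (by omega) h2
        have q2 := hf.inv x
        refine ⟨?_, q1.2⟩
        by_contra hc
        have q3 : f x ≠ a := fun hc => by rw [hc] at q2; omega
        have q4 : f x ≠ f a := fun hc => by rw [hc] at q2; omega
        have := hf.closed_inside (i := a) (x := f x) (by omega) (by omega)
        omega) (by omega)
    have u1 := hp.up ((hf.mem_openers a).2 (by omega))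
    have u2 := hp.down (k := f a) (by rw [hf.mem_openers]; omega)
    refine ⟨by omega, fun k h1 h2 => ?_⟩
    rcases eq_or_ne k a with rfl | c1
    · exact le_rfl
    by_cases c2 : k ≤ f a
    · have := l2 k (by omega) c2; omega
    · have := r2 k (by omega) h2; omega

theorem matched [NeZero d] (hf : IsPeriodicMatching d f) {h : ℤ → ℤ}
    (hp : IsPath (openers d f) h) {i : ℤ} (hi : i < f i) : Matched h i (f i) := by
  obtain ⟨h1, h2⟩ := hf.height_of_closed hp (a := i + 1) (b := f i) (by omega)
    (fun x h1 h2 => by have := hf.closed_inside (i := i) (x := x) (by omega) h2; omega)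
  have u1 := hp.up ((hf.mem_openers i).2 hi)
  have u2 := hp.down (k := f i) (by rw [hf.mem_openers, hf.inv]; omega)
  exact ⟨hi, by omega, fun k hk hk' => by have := h2 k (by omega) hk'; omega⟩

/-- The left ends determine the path, and the path determines each mate as the first return to the
initial height. -/
theorem eq_of_openers [NeZero d] (hf : IsPeriodicMatching d f) (hg : IsPeriodicMatching d g)
    (h : openers d f = openers d g) : f = g := by
  obtain ⟨H, hp, -⟩ := IsPath.exists_of_card hf.pos hf.card_openers
  have hp' := hp
  rw [h] at hp'
  have key : ∀ i, i < f i → f i = g i := fun i hi =>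
    (hf.matched hp hi).right_unique
      (hg.matched hp' ((hg.mem_openers i).1 (h ▸ (hf.mem_openers i).2 hi)))
  funext i
  rcases lt_or_gt_of_ne (hf.ne i) with hi | hi
  · have := key (f i) (by rw [hf.inv]; exact hi)
    rw [hf.inv] at this
    rw [this, hg.inv, ← this]
  · exact key i hi

/-- This is matching of brackets around a cycle: an up step is closed by the first return of the
path, and each down step is reached in this way. -/
theorem exists_of_openers [NeZero d] {O : Finset (ZMod d)} (hO : 2 * O.card = d) :
    ∃ f, IsPeriodicMatching d f ∧ openers d f = O := by
  have hd : 1 ≤ d := Nat.one_le_iff_ne_zero.2 (NeZero.ne d)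
  obtain ⟨h, hp, hper⟩ := IsPath.exists_of_card hd hO
  have hex : ∀ i : ℤ, ∃ j, ((i : ZMod d) ∈ O → Matched h i j ∧ j < i + d) ∧
      ((i : ZMod d) ∉ O → Matched h j i ∧ i - d < j) := by
    intro i
    by_cases hi : (i : ZMod d) ∈ O
    · obtain ⟨j, hj⟩ := Matched.exists_right hp.up_or_down hper hd (hp.up hi)
      exact ⟨j, fun _ => hj, fun hc => (hc hi).elim⟩
    · obtain ⟨j, hj⟩ := Matched.exists_left hp.up_or_down hper hd (hp.down hi)
      exact ⟨j, fun hc => (hi hc).elim, fun _ => hj⟩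
  choose f h1 h2 using hex
  have hopen : ∀ i, i < f i ↔ (i : ZMod d) ∈ O := by
    intro i
    constructor
    · intro hi
      by_contra hc
      have := (h2 i hc).1.1
      omega
    · exact fun hi => (h1 i hi).1.1
  have hadd : ∀ i : ℤ, ((i + d : ℤ) : ZMod d) = i := fun i => by simp
  have hf : IsPeriodicMatching d f := by
    refine ⟨fun i => ?_, fun i => ?_, fun i => ?_, fun i => ?_, fun i => ?_, fun i x a1 a2 a3 => ?_⟩
    · by_cases hi : (i : ZMod d) ∈ O
      · have := (h1 i hi).1.1; omega
      · exact (h2 i hi).2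
    · by_cases hi : (i : ZMod d) ∈ O
      · exact (h1 i hi).2
      · have := (h2 i hi).1.1; omega
    · by_cases hi : (i : ZMod d) ∈ O
      · exact (h1 i hi).1.1.ne'
      · exact (h2 i hi).1.1.ne
    · by_cases hi : (i : ZMod d) ∈ O
      · have m1 := (h1 i hi).1
        exact (h2 (f i) (hp.right_notMem m1)).1.left_unique m1
      · have m1 := (h2 i hi).1
        exact (h1 (f i) (hp.left_mem m1)).1.right_unique m1
    · by_cases hi : (i : ZMod d) ∈ O
      · exact (h1 (i + d) (by rwa [hadd])).1.right_unique ((h1 i hi).1.add_period hper)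
      · exact (h2 (i + d) (by rwa [hadd])).1.left_unique ((h2 i hi).1.add_period hper)
    · exact (h1 i ((hopen i).1 (by omega))).1.not_cross (h1 x ((hopen x).1 (by omega))).1 a1 a2 a3
  refine ⟨f, hf, Finset.ext fun a => ?_⟩
  obtain ⟨x, rfl⟩ := ZMod.intCast_surjective a
  rw [hf.mem_openers, hopen]

theorem card_eq_choose (hd : 1 ≤ d) (he : Even d) :
    Nat.card {f // IsPeriodicMatching d f} = d.choose (d / 2) := by
  have : NeZero d := ⟨by omega⟩
  have h2 := Nat.two_mul_div_two_of_even he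
  have : Nat.card {O : Finset (ZMod d) // O.card = d / 2} = d.choose (d / 2) := by
    rw [Nat.card_eq_fintype_card, Fintype.card_finset_len, ZMod.card]
  rw [← this]
  refine Nat.card_congr (Equiv.ofBijective
    (fun f => ⟨openers d f.1, by have := f.2.card_openers; omega⟩) ⟨?_, ?_⟩)
  · intro f g h
    exact Subtype.ext (f.2.eq_of_openers g.2 (congrArg Subtype.val h))
  · rintro ⟨O, hO⟩
    obtain ⟨f, hf, rfl⟩ := exists_of_openers (O := O) (by omega)
    exact ⟨⟨f, hf⟩, rfl⟩

end IsPeriodicMatching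

/-! ### Matchings of the circle fixed by a rotation with an even step -/

namespace NCMatching

open IsPeriodicMatching

variable {N d e : ℕ} {f : ℤ → ℤ}

theorem _root_.IsPeriodicMatching.add_circumference (hf : IsPeriodicMatching d f) (hN : N = e * d)
    (x c : ℤ) : f (x + N * c) = f x + N * c := by
  have := hf.add_mul x (e * c)
  rw [hN]
  push_cast
  rw [show (e : ℤ) * d * c = d * (e * c) by ring]
  exact this

/-- The matching of a circle that is covered by a periodic matching of the integers. -/
def ofPeriodic [NeZero N] (hf : IsPeriodicMatching d f) (he : 2 ≤ e) (hN : N = e * d) :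
    NCMatching N :=
  have h2 : 2 * d ≤ N := by rw [hN]; exact Nat.mul_le_mul_right d he
  have hμ : ∀ x : ℤ, ((f ((x : ZMod N).val) : ℤ) : ZMod N) = f x := by
    intro x
    have := hf.add_circumference hN (x % N) (x / N)
    rw [Int.emod_add_mul_ediv] at this
    rw [ZMod.val_intCast, this]
    simp
  { μ := fun a => (f a.val : ℤ)
    μ_μ := fun a => by
      obtain ⟨x, rfl⟩ := ZMod.intCast_surjective a
      rw [hμ x, hμ (f x), hf.inv]
    μ_ne := fun a ha => by
      obtain ⟨x, rfl⟩ := ZMod.intCast_surjective a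
      rw [hμ] at ha
      have a1 := hf.sub_lt x
      have a2 := hf.lt_add x
      exact hf.ne x (eq_of_intCast_eq ha (by omega) (by omega))
    noncross := fun i x j y h1 h2 h3 h4 h5 h6 => by
      rw [hμ] at h5 h6
      have hsh : ∀ z, f (z + N) = f z + N := fun z => by simpa using hf.add_circumference hN z 1
      -- A mate met within the next turn is either the mate on the line or its translate by one
      -- turn; in the latter case the pair starts one turn earlier.
      have lift : ∀ z w : ℤ, z < w → w < z + N → ((f z : ℤ) : ZMod N) = w →
          f w = z ∨ f w = z + N := by
        intro z w a1 a2 a3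
        have a4 := hf.sub_lt z
        have a5 := hf.lt_add z
        by_cases c : z < f z
        · left
          rw [← eq_of_intCast_eq a3 (by omega) (by omega), hf.inv]
        · right
          have : f z + N = w := eq_of_intCast_eq (N := N) (by simpa using a3) (by omega) (by omega)
          rw [← this, hsh, hf.inv]
      rcases lift i j (by omega) (by omega) h5 with c1 | c1 <;>
        rcases lift x y (by omega) (by omega) h6 with c2 | c2
      · have b1 : f i = j := by rw [← c1, hf.inv]
        have b2 : f x = y := by rw [← c2, hf.inv]
        exact hf.noncross i x (by omega) (by omega) (by omega)
      · have b1 : f i = j := by rw [← c1, hf.inv]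
        have b2 := hsh (y - N)
        rw [sub_add_cancel, c2] at b2
        exact hf.noncross (y - N) i (by omega) (by omega) (by omega)
      · have b2 : f x = y := by rw [← c2, hf.inv]
        exact hf.noncross x j (by omega) (by omega) (by omega)
      · exact hf.noncross j y (by omega) (by omega) (by omega) }

theorem ofPeriodic_μ [NeZero N] (hf : IsPeriodicMatching d f) (he : 2 ≤ e) (hN : N = e * d)
    (x : ℤ) : (ofPeriodic hf he hN).μ x = f x := by
  change ((f ((x : ZMod N).val) : ℤ) : ZMod N) = f x
  have := hf.add_circumference hN (x % N) (x / N)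
  rw [Int.emod_add_mul_ediv] at this
  rw [ZMod.val_intCast, this]
  simp

theorem ofPeriodic_fixed [NeZero N] (hf : IsPeriodicMatching d f) (he : 2 ≤ e) (hN : N = e * d) :
    ((d : ℤ) : ZMod N) +ᵥ ofPeriodic hf he hN = ofPeriodic hf he hN := by
  rw [vadd_eq_iff]
  intro x
  rw [ofPeriodic_μ, ofPeriodic_μ, hf.add, Int.cast_add]

/-- A pair at distance strictly between d and N - d would cross its own rotation by d. At distance
exactly d, two cases arise: if N > 2d, the point x + d would be matched both to x and to x + 2d; if
N = 2d, the pair would cut off d - 1 points, an odd number. -/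
theorem exists_near_mate {m : NCMatching N} (hd : 1 ≤ d) (hev : Even d) (h2 : 2 * d ≤ N)
    (hm : ((d : ℤ) : ZMod N) +ᵥ m = m) (x : ℤ) :
    ∃ z : ℤ, x - d < z ∧ z < x + d ∧ (z : ZMod N) = m.μ x := by
  have : NeZero N := ⟨by omega⟩
  have hfix := vadd_eq_iff.1 hm
  have hdiam : ∀ x : ℤ, m.μ x ≠ (x + d : ℤ) := by
    intro x hx
    have h3 := hfix x
    rw [m.μ_eq_comm hx, hx, ← Int.cast_add] at h3
    by_cases c : 2 * d = N
    · have := m.even_of_μ_eq (i := x) (j := x + d) (by omega) (by omega) hx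
      rw [Nat.even_iff] at hev
      rw [Int.even_iff] at this
      omega
    · have := eq_of_intCast_eq h3 (by omega) (by omega)
      omega
  obtain ⟨l, h0, h1, hl⟩ := exists_lt_cast (N := N) (m.μ x - x)
  have hl' : ((x + l : ℤ) : ZMod N) = m.μ x := by push_cast; rw [hl]; ring
  by_cases c1 : l < d
  · exact ⟨x + l, by omega, by omega, hl'⟩
  by_cases c2 : N - d < l
  · exact ⟨x + l - N, by omega, by omega, by simpa using hl'⟩
  exfalso
  rcases eq_or_ne l d with rfl | c3
  · exact hdiam x hl'.symm
  rcases eq_or_ne l (N - d) with rfl | c4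
  · refine hdiam (x - d) ?_
    rw [sub_add_cancel]
    refine m.μ_eq_comm ?_
    rw [← hl']
    exact intCast_eq_iff.2 ⟨1, by omega⟩
  · refine m.noncross x (x + d) (x + l) (x + l + d) (by omega) (by omega) (by omega) (by omega)
      hl'.symm ?_
    rw [hfix, ← hl', ← Int.cast_add]

theorem exists_eq_ofPeriodic [NeZero N] (hd : 1 ≤ d) (hev : Even d) (he : 2 ≤ e) (hN : N = e * d)
    {m : NCMatching N} (hm : ((d : ℤ) : ZMod N) +ᵥ m = m) :
    ∃ (f : ℤ → ℤ) (hf : IsPeriodicMatching d f), ofPeriodic hf he hN = m := by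
  have h2 : 2 * d ≤ N := by rw [hN]; exact Nat.mul_le_mul_right d he
  have hfix := vadd_eq_iff.1 hm
  choose f h3 h4 h5 using exists_near_mate hd hev h2 hm
  have hf : IsPeriodicMatching d f := by
    refine ⟨h3, h4, fun i hi => ?_, fun i => ?_, fun i => ?_, fun i x a1 a2 a3 => ?_⟩
    · refine m.μ_ne i ?_
      rw [← h5, hi]
    · have := h3 i; have := h4 i; have := h3 (f i); have := h4 (f i)
      refine eq_of_intCast_eq (N := N) ?_ (by omega) (by omega)
      rw [h5, h5, m.μ_μ]
    · have := h3 i; have := h4 i; have := h3 (i + d); have := h4 (i + d)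
      refine eq_of_intCast_eq (N := N) ?_ (by omega) (by omega)
      rw [h5, hfix, Int.cast_add, h5]
    · have := h4 i
      have := h4 x
      exact m.noncross i x (f i) (f x) a1 a2 a3 (by omega) (h5 i).symm (h5 x).symm
  refine ⟨f, hf, NCMatching.ext (funext fun a => ?_)⟩
  obtain ⟨x, rfl⟩ := ZMod.intCast_surjective a
  rw [ofPeriodic_μ, h5]

/-- As all mates are at distance less than d, a fixed matching lifts uniquely to a d-periodic
matching of the line. -/
theorem card_fixed_even (hd : 1 ≤ d) (hev : Even d) (he : 2 ≤ e) (hN : N = e * d) :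
    Nat.card {m : NCMatching N // ((d : ℤ) : ZMod N) +ᵥ m = m} = d.choose (d / 2) := by
  have h2 : 2 * d ≤ N := by rw [hN]; exact Nat.mul_le_mul_right d he
  have : NeZero N := ⟨by omega⟩
  rw [← card_eq_choose hd hev]
  symm
  refine Nat.card_congr (Equiv.ofBijective
    (fun f => ⟨ofPeriodic f.2 he hN, ofPeriodic_fixed f.2 he hN⟩) ⟨?_, ?_⟩)
  · intro f g h
    have h' := congrArg Subtype.val h
    simp only at h'
    refine Subtype.ext (funext fun x => ?_)
    have := f.2.sub_lt x; have := f.2.lt_add x; have := g.2.sub_lt x; have := g.2.lt_add x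
    refine eq_of_intCast_eq (N := N) ?_ (by omega) (by omega)
    rw [← ofPeriodic_μ f.2 he hN, ← ofPeriodic_μ g.2 he hN, h']
  · rintro ⟨m, hm⟩
    obtain ⟨f, hf, rfl⟩ := exists_eq_ofPeriodic hd hev he hN hm
    exact ⟨⟨f, hf⟩, rfl⟩

end NCMatching

/-! ### Burnside's lemma and the final formula -/

open Triangulation NCMatching

/-- The number of pairs of a triangulation and a noncrossing matching fixed by a rotation. -/
noncomputable def numFixed (N : ℕ) (g : ZMod N) : ℕ :=
  Nat.card {S : Triangulation N // g +ᵥ S = S} * Nat.card {m : NCMatching N // g +ᵥ m = m}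

/-- Burnside's lemma for rotations acting on pairs: a pair is fixed exactly when both components
are, so the fixed counts multiply. -/
theorem sum_numFixed {n : ℕ} (hn : 1 ≤ n) :
    ∑ k ∈ Finset.range (2 * n + 2), numFixed (2 * n + 2) k =
      numTreeRootedCubicMaps (2 * n) * (2 * n + 2) := by
  classical
  have e1 : ∑ k ∈ Finset.range (2 * n + 2), numFixed (2 * n + 2) k =
      ∑ a : ZMod (2 * n + 2), numFixed (2 * n + 2) a :=
    Finset.sum_bij' (fun k _ => (k : ZMod (2 * n + 2))) (fun a _ => a.val) (by simp)
      (fun a _ => by simpa using a.val_lt)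
      (fun k hk => ZMod.val_natCast_of_lt (by simpa using hk)) (fun a _ => by simp)
      (fun k _ => rfl)
  let _ := Fintype.ofFinite (Triangulation (2 * n + 2) × NCMatching (2 * n + 2))
  let _ := Fintype.ofFinite (AddAction.orbitRel.Quotient (ZMod (2 * n + 2))
    (Triangulation (2 * n + 2) × NCMatching (2 * n + 2)))
  have h := AddAction.sum_card_fixedBy_eq_card_orbits_mul_card_addGroup (ZMod (2 * n + 2))
    (Triangulation (2 * n + 2) × NCMatching (2 * n + 2))
  rw [e1, numTreeRootedCubicMaps_eq (by omega) (exists_labels hn) (exists_map hn),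
    Nat.card_eq_fintype_card]
  rw [ZMod.card] at h
  rw [← h]
  refine Finset.sum_congr rfl fun g _ => ?_
  rw [numFixed, ← Nat.card_prod, ← Nat.card_eq_fintype_card]
  refine Nat.card_congr ⟨fun p => ⟨(p.1.1, p.2.1), Prod.ext p.1.2 p.2.2⟩,
    fun p => (⟨p.1.1, congrArg Prod.fst p.2⟩, ⟨p.1.2, congrArg Prod.snd p.2⟩),
    fun _ => rfl, fun _ => rfl⟩

theorem numFixed_zero {n : ℕ} : numFixed (2 * n + 2) 0 = catalan (n + 1) * catalan (2 * n) := by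
  have h1 : Nat.card {S : Triangulation (2 * n + 2) // (0 : ZMod (2 * n + 2)) +ᵥ S = S} =
      catalan (2 * n) := by
    rw [← Triangulation.card_eq_catalan]
    exact Nat.card_congr (Equiv.subtypeUnivEquiv fun S => zero_vadd _ S)
  have h2 : Nat.card {m : NCMatching (2 * n + 2) // (0 : ZMod (2 * n + 2)) +ᵥ m = m} =
      catalan (n + 1) := by
    rw [← NCMatching.card_eq_catalan (N := 2 * n + 2) (m := n + 1) (by omega) (by ring)]
    exact Nat.card_congr (Equiv.subtypeUnivEquiv fun S => zero_vadd _ S)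
  rw [numFixed, h1, h2, mul_comm]

theorem numFixed_neg {N : ℕ} (g : ZMod N) : numFixed N (-g) = numFixed N g := by
  rw [numFixed, numFixed]
  congr 1
  · exact Nat.card_congr (Equiv.subtypeEquivRight fun S =>
      neg_mem_iff (H := AddAction.stabilizer (ZMod N) S))
  · exact Nat.card_congr (Equiv.subtypeEquivRight fun m =>
      neg_mem_iff (H := AddAction.stabilizer (ZMod N) m))

theorem numFixed_eq_zero {N k : ℕ} (hN : 3 ≤ N) (h0 : k ≠ 0) (hk : k < N) (h2 : 2 * k ≠ N)
    (h3 : 3 * k ≠ N) (h4 : 3 * k ≠ 2 * N) : numFixed N k = 0 := by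
  have : IsEmpty {S : Triangulation N // (k : ZMod N) +ᵥ S = S} := by
    refine ⟨fun ⟨S, hS⟩ => ?_⟩
    rw [← Int.cast_natCast] at hS
    obtain ⟨i, L, -, hL⟩ := S.rotation_of_fixed hN (g := k) (by omega) (by omega)
      (fun x y h => (vadd_eq_iff_adj.1 hS x y).2 h)
    omega
  rw [numFixed, Nat.card_of_isEmpty, zero_mul]

/-- The number (2j + 1)·C_j of fixed matchings equals half the central binomial coefficient of j +
1, which explains the factor 1/2 in the statement. -/
theorem numFixed_half_odd {n j : ℕ} (hn : 1 ≤ n) (hj : n + 1 = 2 * j + 1) :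
    (numFixed (2 * n + 2) (n + 1 : ℕ) : ℚ) =
      1 / 2 * (n + 1) * catalan n * (2 * (j + 1)).choose (j + 1) := by
  have h1 := Triangulation.card_fixed_half (N := 2 * n + 2) (L := n + 1) (by omega) (by ring)
  have h2 := NCMatching.card_fixed_odd (N := 2 * n + 2) hj (by ring)
  rw [Int.cast_natCast] at h1 h2
  have h3 := Nat.succ_mul_centralBinom_succ j
  have h4 := succ_mul_catalan_eq_centralBinom j
  rw [← h4, Nat.centralBinom_eq_two_mul_choose] at h3
  have h5 : (2 * (j + 1)).choose (j + 1) = 2 * ((2 * j + 1) * catalan j) := by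
    refine Nat.eq_of_mul_eq_mul_left (show 0 < j + 1 by omega) ?_
    rw [h3]
    ring
  rw [numFixed, h1, h2, h5, hj, Nat.add_sub_cancel]
  obtain rfl : n = 2 * j := by omega
  push_cast
  ring

theorem numFixed_half_even {n k : ℕ} (hn : 1 ≤ n) (hk : n + 1 = 2 * k) :
    numFixed (2 * n + 2) (n + 1 : ℕ) = (n + 1) * catalan n * (2 * k).choose k := by
  have h1 := Triangulation.card_fixed_half (N := 2 * n + 2) (L := n + 1) (by omega) (by ring)
  have h2 := NCMatching.card_fixed_even (N := 2 * n + 2) (d := n + 1) (e := 2) (by omega)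
    ⟨k, by omega⟩ le_rfl (by ring)
  rw [Int.cast_natCast] at h1 h2
  rw [numFixed, h1, h2, Nat.add_sub_cancel, hk, Nat.mul_div_cancel_left _ two_pos]

theorem numFixed_third {N K : ℕ} (hK : 1 ≤ K) (hN : N = 3 * (2 * K)) :
    numFixed N (2 * K : ℕ) = 2 * K * catalan (2 * K - 1) * (2 * K).choose K := by
  have h1 := Triangulation.card_fixed_third (N := N) (L := 2 * K) (by omega) hN
  have h2 := NCMatching.card_fixed_even (N := N) (d := 2 * K) (e := 3) (by omega)
    ⟨K, by omega⟩ (by omega) hN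
  rw [Int.cast_natCast] at h1 h2
  rw [numFixed, h1, h2, Nat.mul_div_cancel_left _ two_pos]

/-- The two rotations of order three are inverse to each other, and inverse rotations fix the same
objects. -/
theorem numFixed_two_thirds {N L : ℕ} (hN : N = 3 * L) :
    numFixed N (2 * L : ℕ) = numFixed N L := by
  rw [← numFixed_neg]
  congr 1
  have : ((3 * L : ℕ) : ZMod N) = 0 := by rw [← hN]; simp
  push_cast at this ⊢
  linear_combination -this

theorem mul_numTreeRootedCubicMaps_of_not_dvd {n : ℕ} (hn : 1 ≤ n) (h : ¬ 3 ∣ n + 1) :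
    (2 * n + 2) * numTreeRootedCubicMaps (2 * n) =
      catalan (n + 1) * catalan (2 * n) + numFixed (2 * n + 2) (n + 1 : ℕ) := by
  rw [mul_comm, ← sum_numFixed hn, ← numFixed_zero]
  have hs : ({0, n + 1} : Finset ℕ) ⊆ Finset.range (2 * n + 2) := by
    intro k hk
    simp only [Finset.mem_insert, Finset.mem_singleton] at hk
    rw [Finset.mem_range]
    omega
  rw [← Finset.sum_subset hs fun k hk hk' => ?_, Finset.sum_pair (by omega), Nat.cast_zero]
  simp only [Finset.mem_insert, Finset.mem_singleton, not_or] at hk'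
  rw [Finset.mem_range] at hk
  exact numFixed_eq_zero (by omega) hk'.1 hk (by omega) (by omega) (by omega)

theorem mul_numTreeRootedCubicMaps_of_eq {n K : ℕ} (hn : 1 ≤ n) (h : n + 1 = 3 * K) :
    (2 * n + 2) * numTreeRootedCubicMaps (2 * n) =
      catalan (n + 1) * catalan (2 * n) +
        2 * (2 * K * catalan (2 * K - 1) * (2 * K).choose K) +
        numFixed (2 * n + 2) (n + 1 : ℕ) := by
  rw [mul_comm, ← sum_numFixed hn, ← numFixed_zero,
    ← numFixed_third (N := 2 * n + 2) (by omega) (by omega)]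
  have hs : ({0, n + 1, 2 * K, 2 * (2 * K)} : Finset ℕ) ⊆ Finset.range (2 * n + 2) := by
    intro k hk
    simp only [Finset.mem_insert, Finset.mem_singleton] at hk
    rw [Finset.mem_range]
    omega
  rw [← Finset.sum_subset hs fun k hk hk' => ?_]
  · rw [Finset.sum_insert, Finset.sum_insert, Finset.sum_pair (by omega), Nat.cast_zero,
      numFixed_two_thirds (L := 2 * K) (by omega)]
    · ring
    · simp only [Finset.mem_insert, Finset.mem_singleton]
      omega
    · simp only [Finset.mem_insert, Finset.mem_singleton]
      omega
  · simp only [Finset.mem_insert, Finset.mem_singleton, not_or] at hk'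
    rw [Finset.mem_range] at hk
    exact numFixed_eq_zero (by omega) hk'.1 hk (by omega) (by omega) (by omega)

theorem theorem4p1 (n : ℕ) (hn : 1 ≤ n) :
    (∀ k : ℕ, n + 1 = 2 * k - 1 → ¬ 3 ∣ n + 1 →
      (2 * n + 2 : ℚ) * numTreeRootedCubicMaps (2 * n) =
        catalan (n + 1) * catalan (2 * n)
          + 1 / 2 * (n + 1) * catalan n * (2 * k).choose k) ∧
    (∀ k : ℕ, n + 1 = 2 * k → ¬ 3 ∣ n + 1 →
      (2 * n + 2 : ℚ) * numTreeRootedCubicMaps (2 * n) =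
        catalan (n + 1) * catalan (2 * n)
          + (n + 1) * catalan n * (2 * k).choose k) ∧
    (∀ k : ℕ, n + 1 = 3 * (2 * k - 1) →
      (2 * n + 2 : ℚ) * numTreeRootedCubicMaps (2 * n) =
        catalan (n + 1) * catalan (2 * n)
          + 4 * (2 * k - 1) * catalan (4 * k - 3) * (4 * k - 2).choose (2 * k - 1)
          + 1 / 2 * (n + 1) * catalan n * (6 * k - 2).choose (3 * k - 1)) ∧
    (∀ k : ℕ, n + 1 = 6 * k →
      (2 * n + 2 : ℚ) * numTreeRootedCubicMaps (2 * n) =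
        catalan (n + 1) * catalan (2 * n)
          + 8 * k * catalan (4 * k - 1) * (4 * k).choose (2 * k)
          + (n + 1) * catalan n * (6 * k).choose (3 * k)) := by
  have cast := fun {b : ℕ} (h : (2 * n + 2) * numTreeRootedCubicMaps (2 * n) = b) =>
    congrArg (Nat.cast : ℕ → ℚ) h
  refine ⟨fun k hk h3 => ?_, fun k hk h3 => ?_, fun k hk => ?_, fun k hk => ?_⟩
  -- With k = 0 the truncated difference `2 * k - 1` would be 0, contrary to n ≥ 1.
  · obtain ⟨j, rfl⟩ : ∃ j, k = j + 1 := ⟨k - 1, by omega⟩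
    have h := cast (mul_numTreeRootedCubicMaps_of_not_dvd hn h3)
    push_cast at h
    rw [h, ← Nat.cast_succ, ← numFixed_half_odd hn (by omega)]
  · have h := cast (mul_numTreeRootedCubicMaps_of_not_dvd hn h3)
    rw [numFixed_half_even hn hk] at h
    push_cast at h
    exact h
  · obtain ⟨j, rfl⟩ : ∃ j, k = j + 1 := ⟨k - 1, by omega⟩
    have h := cast (mul_numTreeRootedCubicMaps_of_eq hn (K := 2 * j + 1) (by omega))
    -- n + 1 = 3(2j + 1) = 2(3j + 1) + 1 is odd, so the half turn falls under the odd case although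
    -- the rotations of order three have an even step.
    rw [Nat.cast_add, numFixed_half_odd hn (j := 3 * j + 1) (by omega)] at h
    rw [show 4 * (j + 1) - 3 = 2 * (2 * j + 1) - 1 by omega,
      show 4 * (j + 1) - 2 = 2 * (2 * j + 1) by omega, show 2 * (j + 1) - 1 = 2 * j + 1 by omega,
      show 6 * (j + 1) - 2 = 2 * (3 * j + 1 + 1) by omega,
      show 3 * (j + 1) - 1 = 3 * j + 1 + 1 by omega]
    push_cast at h ⊢
    rw [h]
    ring
  · have h := cast (mul_numTreeRootedCubicMaps_of_eq hn (K := 2 * k) (by omega))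
    rw [numFixed_half_even hn (k := 3 * k) (by omega)] at h
    rw [show 4 * k = 2 * (2 * k) by ring, show 6 * k = 2 * (3 * k) by ring]
    push_cast at h ⊢
    rw [h]
    ring
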